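/- Let $\overline M$ be a compact oriented 3-manifold whose boundary is a nonempty union of tori $T_1,\dots,T_c$, and let $\tau$ be an ideal triangulation of its interior $M$: $\overline M$ is decomposed into finitely many truncated tetrahedra, glued in pairs along all their hexagonal faces, so that the truncation triangles triangulate $\partial\overline M$. The vertices of this triangulation of $\partial\overline M$ are the ends of the edges of $\tau$. A *generalized angle structure* $\theta$ assigns a real number to each pair of opposite edges of each tetrahedron, so that the three angles of each tetrahedron have sum $\pi$ and the angles around each edge of $\tau$ have sum $2\pi$. It is *nonnegative* if all angles are $\geq 0$, and *taut* if all angles are $0$ (thin) or $\pi$ (wide). It gives angles to the corners of the triangles of $\partial\overline M$. A taut structure is *veering* if for every vertex $v$ of $\partial\overline M$, either all triangles with a thin corner at $v$ have their wide corner immediately before $v$ in the counterclockwise order ($v$ is left-veering), or all of them have it immediately after $v$ ($v$ is right-veering). In that case, the edges in $\partial\overline M$ that join two vertices veering in the same direction form disjoint essential simple closed curves, the *ladderpoles*, which in each torus $T_i$ are parallel to each other. For an oriented simple closed curve $\gamma\subset T_i$ that is transverse to the edges of $\partial\overline M$ and enters and leaves each triangle through different sides (a normal curve), each arc of $\gamma$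 in a triangle cuts off one corner. If $\gamma$ is homologically nontrivial, put $h_\theta([\gamma])=\mathcal A_\gamma-\mathcal B_\gamma$, where $\mathcal A_\gamma$ and $\mathcal B_\gamma$ are the sums of the angles $\theta$ at the corners that $\gamma$ cuts off on its left and on its right, respectively; this depends only on the class $[\gamma]\in H_1(\partial\overline M,\mathbb Z)$. **Proposition 5.8.** Let $\tau$ be endowed with a veering structure. For $1\le i\le c$ let $\ell_i\subset T_i$ be an oriented simple closed curve in the direction of the ladderpoles of $T_i$, i.e. homologous to a ladderpole of $T_i$ with either one of its orientations; these orientations may be chosen arbitrarily and independently. Then there exists a nonnegative angle structure $\theta$ on $\tau$ such that $$h_\theta([\ell_i])=\frac{\pi}{4}\qquad\text{for all } 1\le i\le c,$$ that is, $\mathcal A_\gamma-\mathcal B_\gamma=\pi/4$ for every $i$ and every simple closed normal curve $\gamma$ homologous to $\ell_i$. -/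

import Mathlib

open Real

/-- The vertices of an oriented tetrahedron are labelled `0, 1, 2, 3`. Cutting off the tip `v` leaves
a triangle, the cusp triangle at `v`; its corners lie on the edges from `v` to the other vertices `w`
and are labelled by these `w`. Seen from the tip, `ccw v w` is the corner that follows `w`
counterclockwise (`ccw v v = v` has no meaning). See `ccw_eq_iff`. -/
def ccw (v w : Fin 4) : Fin 4 :=
  (![![0, 2, 3, 1], ![3, 1, 0, 2], ![1, 3, 2, 0], ![2, 0, 1, 3]] : Fin 4 → Fin 4 → Fin 4) v w

/-- `w, x, y` is the counterclockwise order at the tip `v` iff `(v, w, x, y)` is an even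
permutation of `(0, 1, 2, 3)`. -/
theorem ccw_eq_iff : ∀ σ : Equiv.Perm (Fin 4),
    ccw (σ 0) (σ 1) = σ 2 ↔ Equiv.Perm.sign σ = 1 := by decide

theorem ne_ccw : ∀ v w : Fin 4, v ≠ w → v ≠ ccw v w := by decide

/-- The three pairs of opposite edges of a tetrahedron; `edgePair v w` is the one containing the
edge `vw` (no meaning for `v = w`). -/
def edgePair (v w : Fin 4) : Fin 3 :=
  (![![0, 0, 1, 2], ![0, 0, 2, 1], ![1, 2, 0, 0], ![2, 1, 0, 0]] : Fin 4 → Fin 4 → Fin 3) v w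

/-- Two edges are in the same pair iff they are equal or have no common vertex. -/
theorem edgePair_eq_iff : ∀ v w v' w' : Fin 4, v ≠ w → v' ≠ w' →
    (edgePair v w = edgePair v' w' ↔
      ((v = v' ∧ w = w') ∨ (v = w' ∧ w = v')) ∨ (v ≠ v' ∧ v ≠ w' ∧ w ≠ v' ∧ w ≠ w')) := by
  decide

/-- A triple (tetrahedron, tip `v`, label `w ≠ v`). It stands for a corner of the cusp triangle at
`v`, namely the one on the edge `vw`, or, where it is called a *side*, for the side of that triangle
opposite to this corner, i.e. its intersection with the face of the tetrahedron opposite to `w`. -/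
abbrev Corner (T : Type*) := T × {p : Fin 4 × Fin 4 // p.1 ≠ p.2}

namespace Corner

variable {T : Type*}

/-- The tetrahedron. -/
def tet (c : Corner T) : T := c.1

/-- The truncated vertex. -/
def tip (c : Corner T) : Fin 4 := c.2.1.1

/-- The other vertex of the edge through the corner. -/
def label (c : Corner T) : Fin 4 := c.2.1.2

/-- The cusp triangle to which the corner belongs. -/
def triangle (c : Corner T) : T × Fin 4 := (c.tet, c.tip)

/-- The next corner of the same cusp triangle, counterclockwise. -/
def next (c : Corner T) : Corner T :=
  (c.tet, ⟨(c.tip, ccw c.tip c.label), ne_ccw _ _ c.2.2⟩)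

/-- The previous corner of the same cusp triangle, counterclockwise. -/
def prev (c : Corner T) : Corner T := c.next.next

end Corner

/-- Oriented tetrahedra, indexed by `T`, glued in pairs along all their faces by orientation-preserving
identifications. Face `f` of `t` (opposite to the vertex `f`) is glued to the face `glue t f f` of
`adj t f`; each vertex `v ≠ f` of it goes to the vertex `glue t f v`. -/
structure OrientedGluing (T : Type*) where
  adj : T → Fin 4 → T
  glue : T → Fin 4 → Equiv.Perm (Fin 4)
  adj_adj : ∀ t f, adj (adj t f) (glue t f f) = t
  glue_glue : ∀ t f, glue (adj t f) (glue t f f) = (glue t f)⁻¹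
  no_fold : ∀ t f, ¬ (adj t f = t ∧ glue t f f = f)
  oriented : ∀ t f, Equiv.Perm.sign (glue t f) = -1

namespace OrientedGluing

variable {T : Type*} (τ : OrientedGluing T)

/-! ### The triangulated boundary -/

/-- Two corners of cusp triangles are identified through a face that contains the edge on which
they lie. -/
def CornerAdj (c d : Corner T) : Prop :=
  ∃ f, f ≠ c.tip ∧ f ≠ c.label ∧ d.tet = τ.adj c.tet f ∧
    d.tip = τ.glue c.tet f c.tip ∧ d.label = τ.glue c.tet f c.label

/-- The vertices of the triangulation of the boundary, i.e. the ends of the edges of the ideal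
triangulation. -/
def Vertex : Type _ := Quot τ.CornerAdj

/-- The vertex at a corner. -/
def vertex (c : Corner T) : τ.Vertex := Quot.mk _ c

/-- The side of a cusp triangle that is glued to the side `s`. -/
def across (s : Corner T) : Corner T :=
  (τ.adj s.tet s.label,
    ⟨(τ.glue s.tet s.label s.tip, τ.glue s.tet s.label s.label),
      fun h => s.2.2 ((τ.glue s.tet s.label).injective h)⟩)

/-- The edges of the triangulation of the boundary. -/
def Edge : Type _ := Quot (fun s s' : Corner T => s' = τ.across s)

/-- Two cusp triangles share an edge. -/
def TriangleAdj (x y : T × Fin 4) : Prop :=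
  ∃ s : Corner T, s.triangle = x ∧ (τ.across s).triangle = y

/-- The cusps, i.e. the connected components of the boundary. -/
def Cusp : Type _ := Quot τ.TriangleAdj

/-- The cusp containing a cusp triangle. -/
def cusp (x : T × Fin 4) : τ.Cusp := Quot.mk _ x

/-- The Euler characteristic of a boundary component. -/
noncomputable def eulerChar (κ : τ.Cusp) : ℤ :=
  (Nat.card {q : τ.Vertex // ∃ c : Corner T, τ.vertex c = q ∧ τ.cusp c.triangle = κ} : ℤ)
    - (Nat.card {e : τ.Edge // ∃ s : Corner T, Quot.mk _ s = e ∧ τ.cusp s.triangle = κ} : ℤ)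
    + (Nat.card {x : T × Fin 4 // τ.cusp x = κ} : ℤ)

/-- Every component of the (closed, oriented) boundary surface is a torus. -/
def HasTorusCusps : Prop := ∀ κ : τ.Cusp, τ.eulerChar κ = 0

/-! ### Angle structures -/

/-- The angle at a corner, if `θ` assigns an angle to each pair of opposite edges of each
tetrahedron. -/
def angleAt (θ : T → Fin 3 → ℝ) (c : Corner T) : ℝ := θ c.tet (edgePair c.tip c.label)

open Classical in
/-- Angle sum `π` in every tetrahedron and `2π` around every edge of the ideal triangulation. The
angles around such an edge are those at either of its two ends, which are vertices of the
boundary. -/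
def IsGeneralizedAngleStructure [Fintype T] (θ : T → Fin 3 → ℝ) : Prop :=
  (∀ t, ∑ j, θ t j = π) ∧
    ∀ q : τ.Vertex, ∑ c : Corner T with τ.vertex c = q, angleAt θ c = 2 * π

/-- A generalized angle structure with nonnegative angles. -/
def IsNonnegAngleStructure [Fintype T] (θ : T → Fin 3 → ℝ) : Prop :=
  τ.IsGeneralizedAngleStructure θ ∧ ∀ t j, 0 ≤ θ t j

/-- A generalized angle structure all of whose angles are `0` (thin) or `π` (wide). -/
def IsTaut [Fintype T] (θ : T → Fin 3 → ℝ) : Prop :=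
  τ.IsGeneralizedAngleStructure θ ∧ ∀ t j, θ t j = 0 ∨ θ t j = π

/-- At each thin corner at the vertex `q`, the wide corner of the triangle comes immediately before
`q` in the counterclockwise order. -/
def IsLeftVeering (θ : T → Fin 3 → ℝ) (q : τ.Vertex) : Prop :=
  ∀ c : Corner T, τ.vertex c = q → angleAt θ c = 0 → angleAt θ c.prev = π

/-- At each thin corner at the vertex `q`, the wide corner of the triangle comes immediately after
`q` in the counterclockwise order. -/
def IsRightVeering (θ : T → Fin 3 → ℝ) (q : τ.Vertex) : Prop :=
  ∀ c : Corner T, τ.vertex c = q → angleAt θ c = 0 → angleAt θ c.next = π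

/-- A veering structure: a taut angle structure for which every vertex of the boundary veers left
or right. -/
def IsVeering [Fintype T] (θ : T → Fin 3 → ℝ) : Prop :=
  τ.IsTaut θ ∧ ∀ q : τ.Vertex, τ.IsLeftVeering θ q ∨ τ.IsRightVeering θ q

/-- The side `s` is a ladderpole segment: both its ends veer left, or both veer right. -/
def IsLadderpoleSegment (θ : T → Fin 3 → ℝ) (s : Corner T) : Prop :=
  (τ.IsLeftVeering θ (τ.vertex s.next) ∧ τ.IsLeftVeering θ (τ.vertex s.prev)) ∨
    (τ.IsRightVeering θ (τ.vertex s.next) ∧ τ.IsRightVeering θ (τ.vertex s.prev))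

end OrientedGluing

/-! ### Normal curves -/

/-- An oriented arc in a cusp triangle that runs from one side to another one, up to isotopy: it is
determined by the corner that it cuts off and by whether this corner is on its left. -/
structure Arc (T : Type*) where
  corner : Corner T
  left : Bool

namespace Arc

variable {T : Type*}

/-- The side through which the arc enters the triangle. With the corner on the left, the arc runs
counterclockwise around it, so it starts on the side from `corner` to `corner.next`. -/
def enter (a : Arc T) : Corner T := if a.left then a.corner.prev else a.corner.next

/-- The side through which the arc leaves the triangle. -/
def leave (a : Arc T) : Corner T := if a.left then a.corner.next else a.corner.prev

end Arc

namespace OrientedGluing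

/-- An oriented closed curve in the boundary that is transverse to the edges and enters and leaves
each triangle through different sides, recorded as the cyclic sequence of its arcs. It need not be
embedded: see `NormalCurve.IsSimple`. -/
structure NormalCurve {T : Type*} (τ : OrientedGluing T) where
  /-- The number of arcs is `n + 1`. -/
  n : ℕ
  /-- The arcs; indices are cyclic, as `i + 1` is computed modulo `n + 1`. -/
  arc : Fin (n + 1) → Arc T
  closed : ∀ i, (arc (i + 1)).enter = τ.across (arc i).leave

/-- `x` gives the barycentric coordinates of an interior point of the side `s` (the coordinate with
index `k` is that of the corner labelled `k`). -/
def IsPointOfSide {T : Type*} (s : Corner T) (x : Fin 4 → ℝ) : Prop :=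
  x s.tip = 0 ∧ x s.label = 0 ∧ (∀ k, k ≠ s.tip → k ≠ s.label → 0 < x k) ∧ ∑ k, x k = 1

namespace NormalCurve

variable {T : Type*} {τ : OrientedGluing T}

/-- The curve is embedded: it can be realized with straight arcs, the `i`-th one from `x i` to
`y i`, which match along the glued sides and are pairwise disjoint in each triangle. -/
def IsSimple (γ : τ.NormalCurve) : Prop :=
  ∃ x y : Fin (γ.n + 1) → Fin 4 → ℝ,
    (∀ i, IsPointOfSide (γ.arc i).enter (x i)) ∧
    (∀ i, IsPointOfSide (γ.arc i).leave (y i)) ∧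
    (∀ i k, x (i + 1) (τ.glue (γ.arc i).leave.tet (γ.arc i).leave.label k) = y i k) ∧
    ∀ i j, i ≠ j → (γ.arc i).corner.triangle = (γ.arc j).corner.triangle →
      Disjoint (segment ℝ (x i) (y i)) (segment ℝ (x j) (y j))

/-- The curve lies in the cusp `κ`. -/
def LiesIn (γ : τ.NormalCurve) (κ : τ.Cusp) : Prop :=
  ∀ i, τ.cusp (γ.arc i).corner.triangle = κ

/-- The turning angle: the sum of the angles that the curve cuts off on its left, minus the sum of
those that it cuts off on its right. -/
noncomputable def turningAngle (θ : T → Fin 3 → ℝ) (γ : τ.NormalCurve) : ℝ :=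
  (∑ i with (γ.arc i).left = true, angleAt θ (γ.arc i).corner) -
    ∑ i with (γ.arc i).left = false, angleAt θ (γ.arc i).corner

open Classical in
/-- The number of times, counted with sign, that the curve leaves a triangle through its side `s`. -/
noncomputable def flow (γ : τ.NormalCurve) (s : Corner T) : ℤ :=
  (Finset.card {i | (γ.arc i).leave = s} : ℤ) - (Finset.card {i | (γ.arc i).enter = s} : ℤ)

/-- The curves define the same class in the first homology group of the boundary with integer
coefficients. This is computed from the dual cell structure: the `1`-cells are dual to the edges of
the triangulation, the `2`-cells to its vertices, and the difference of the cycles of the two curves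
has to be the boundary of the `2`-chain `m`. (Leaving a triangle through its side `s`, one has the
corner `s.prev` on the left and `s.next` on the right.) -/
def Homologous (γ δ : τ.NormalCurve) : Prop :=
  ∃ m : τ.Vertex → ℤ, ∀ s : Corner T,
    γ.flow s - δ.flow s = m (τ.vertex s.prev) - m (τ.vertex s.next)

/-- The angular holonomy of the homology class of `γ` is `r`: every embedded normal curve that
represents this class has turning angle `r`. -/
def HasHolonomy (θ : T → Fin 3 → ℝ) (γ : τ.NormalCurve) (r : ℝ) : Prop :=
  ∀ δ : τ.NormalCurve, δ.IsSimple → δ.Homologous γ → δ.turningAngle θ = r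

/-- The curve runs once around a ladder, parallel to the two ladderpoles that bound it: it crosses
no ladderpole segment, and passes through each triangle at most once. -/
def IsLadderCurve (α : T → Fin 3 → ℝ) (γ : τ.NormalCurve) : Prop :=
  (∀ i, ¬ τ.IsLadderpoleSegment α (γ.arc i).leave) ∧
    Function.Injective fun i => (γ.arc i).corner.triangle

/-- The curve is a simple closed curve in the direction of the ladderpoles of the veering structure
`α`, with one of the two orientations. -/
def IsLadderpoleDirection (α : T → Fin 3 → ℝ) (γ : τ.NormalCurve) : Prop :=
  γ.IsSimple ∧ ∃ δ : τ.NormalCurve, δ.IsLadderCurve α ∧ γ.Homologous δ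

end NormalCurve

end OrientedGluing

/-! The angles `θ` arise from the veering structure `α` by a deformation along a cocycle. A cocycle
`z` on the boundary is antisymmetric under the gluing of sides and has sum zero on each triangle.
Adding to the angle of a pair of opposite edges the values of `z` on the four sides facing its
corners preserves all angle sums (`sum_deformation`, `sum_vertex_deformation`). The turning of any
closed normal curve changes by `turn z` only (`turn_deformation`, after Neumann and Zagier), because
the contributions of the other tips telescope. On cocycles `turn` is a homology invariant.

The cocycle counts intersections with a transversal that enters each ladder once, at a hinge, and
leaves it once on the other side; one copy of the core of each ladder is added. So 1 or 2 strands
cross each rung. A wide pair loses at most 2 at each of its four tips, and the step `π / 8` leaves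
`π - 8 * (π / 8) = 0`. A thin pair can lose 1 at a tip only at a hinge; there the two wide edges of
the tetrahedron veer in different directions, and the tips of the other wide edge make up for the
loss. A curve along a ladder meets the transversal once, which gives `turn = ±2`. Directing the
transversal in each torus suitably makes the sign positive, and `π / 8 * 2 = π / 4`.

It remains to see that `α` itself has turning zero on every simple curve `γ` homologous to a
ladderpole. For a curve along a ladder this is visible, as it cuts off thin corners only, but the
angles of `α` do not have vanishing sums over triangles and vertices, so for other curves simplicity
must be used. The tori are given a Euclidean structure in which ladders are vertical strips of width
1 (`position`); the heights come from the transversal, corrected by `exists_rise_pos` so that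
ladderpoles are monotone. Euclidean and taut angles give the same turning (`turn_arg_shape`), since
they differ by directions of sides in a half plane. The development is injective
(`samePoint_of_place_eq`), so `γ` lifts to a simple periodic polygonal line, and its period is
nonzero because of its homology class. A polygonal Umlaufsatz (`sum_arg_eq_zero_of_simple`) shows
that the total turning is zero. -/

namespace Corner

/-! ### Corners and pairs of opposite edges in a tetrahedron -/

variable {T : Type*}

theorem eq_of_labels {c d : Corner T} (h₁ : c.tet = d.tet) (h₂ : c.tip = d.tip)
    (h₃ : c.label = d.label) : c = d :=
  Prod.ext h₁ (Subtype.ext (Prod.ext h₂ h₃))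

theorem ccw_ccw_ccw : ∀ v w : Fin 4, v ≠ w → ccw v (ccw v (ccw v w)) = w := by decide

theorem next_next_next (c : Corner T) : c.next.next.next = c :=
  eq_of_labels rfl rfl (ccw_ccw_ccw _ _ c.2.2)

@[simp] theorem next_next (c : Corner T) : c.next.next = c.prev := rfl

@[simp] theorem prev_next (c : Corner T) : c.prev.next = c := c.next_next_next

@[simp] theorem next_prev (c : Corner T) : c.next.prev = c := c.next_next_next

@[simp] theorem prev_prev (c : Corner T) : c.prev.prev = c.next := by
  rw [prev, prev_next]

@[simp] theorem triangle_next (c : Corner T) : c.next.triangle = c.triangle := rfl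
@[simp] theorem triangle_prev (c : Corner T) : c.prev.triangle = c.triangle := rfl

theorem labels_distinct : ∀ v w : Fin 4, v ≠ w → ccw v w ≠ w ∧ ccw v (ccw v w) ≠ w ∧
    ccw v (ccw v w) ≠ ccw v w ∧ ccw v w ≠ v ∧ ccw v (ccw v w) ≠ v := by decide

theorem label_ne_tip (c : Corner T) : c.label ≠ c.tip := c.2.2.symm

theorem label_next_ne (c : Corner T) : c.next.label ≠ c.label :=
  (labels_distinct _ _ c.2.2).1

theorem label_prev_ne (c : Corner T) : c.prev.label ≠ c.label :=
  (labels_distinct _ _ c.2.2).2.1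

theorem label_prev_ne_next (c : Corner T) : c.prev.label ≠ c.next.label :=
  (labels_distinct _ _ c.2.2).2.2.1

theorem next_ne (c : Corner T) : c.next ≠ c := fun h => c.label_next_ne (congrArg label h)

theorem prev_ne (c : Corner T) : c.prev ≠ c := fun h => c.label_prev_ne (congrArg label h)

theorem prev_ne_next (c : Corner T) : c.prev ≠ c.next :=
  fun h => c.label_prev_ne_next (congrArg label h)

theorem label_cases : ∀ v w w' : Fin 4, v ≠ w → v ≠ w' →
    w' = w ∨ w' = ccw v w ∨ w' = ccw v (ccw v w) := by decide

/-- The corners of a cusp triangle. -/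
theorem eq_or_eq_next_or_eq_prev {c d : Corner T} (h : d.triangle = c.triangle) :
    d = c ∨ d = c.next ∨ d = c.prev := by
  have h₁ : d.tet = c.tet := congrArg (fun X : T × Fin 4 => X.1) h
  have h₂ : d.tip = c.tip := congrArg (fun X : T × Fin 4 => X.2) h
  have hd : c.tip ≠ d.label := h₂ ▸ d.2.2
  rcases label_cases c.tip c.label d.label c.2.2 hd with h | h | h
  · exact .inl (eq_of_labels h₁ h₂ h)
  · exact .inr (.inl (eq_of_labels h₁ h₂ h))
  · exact .inr (.inr (eq_of_labels h₁ h₂ h))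

theorem univ_labels : ∀ v w k : Fin 4, v ≠ w →
    k = v ∨ k = w ∨ k = ccw v w ∨ k = ccw v (ccw v w) := by decide

theorem sum_labels {A : Type*} [AddCommMonoid A] (c : Corner T) (x : Fin 4 → A) :
    ∑ k, x k = x c.tip + x c.label + x c.next.label + x c.prev.label := by
  have h : ∀ v w : Fin 4, v ≠ w → (Finset.univ : Finset (Fin 4)) =
    {v, w, ccw v w, ccw v (ccw v w)} := by decide
  have hd := labels_distinct c.tip c.label c.2.2
  rw [h c.tip c.label c.2.2, Finset.sum_insert, Finset.sum_insert, Finset.sum_insert,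
    Finset.sum_singleton, ← add_assoc, ← add_assoc]
  · rfl
  · simpa using hd.2.2.1.symm
  · simpa using ⟨hd.1.symm, hd.2.1.symm⟩
  · simpa using ⟨c.2.2, hd.2.2.2.1.symm, hd.2.2.2.2.symm⟩

/-- The corner at the other end of the same edge of the tetrahedron. -/
def flip (c : Corner T) : Corner T := (c.tet, ⟨(c.label, c.tip), c.2.2.symm⟩)

@[simp] theorem flip_flip (c : Corner T) : c.flip.flip = c := rfl

/-- The corner at the opposite edge of the tetrahedron, at the tip `c.next.label`. -/
def opp (c : Corner T) : Corner T := (c.tet, ⟨(c.next.label, c.prev.label), c.label_prev_ne_next.symm⟩)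

/-- The pair of opposite edges to which the corner belongs. -/
def pair (c : Corner T) : Fin 3 := edgePair c.tip c.label

theorem ccw_flip : ∀ v w : Fin 4, v ≠ w → ccw w v = ccw v (ccw v w) ∧ ccw w (ccw w v) = ccw v w := by
  decide

theorem ccw_opp : ∀ v w : Fin 4, v ≠ w →
    ccw (ccw v w) (ccw v (ccw v w)) = v ∧ ccw (ccw v w) (ccw (ccw v w) (ccw v (ccw v w))) = w := by
  decide

theorem label_next_flip (c : Corner T) : c.flip.next.label = c.prev.label :=
  (ccw_flip _ _ c.2.2).1

theorem label_prev_flip (c : Corner T) : c.flip.prev.label = c.next.label :=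
  (ccw_flip _ _ c.2.2).2

theorem pair_facts : ∀ v w : Fin 4, v ≠ w → edgePair w v = edgePair v w ∧
    edgePair (ccw v w) (ccw v (ccw v w)) = edgePair v w ∧
    edgePair v (ccw v w) ≠ edgePair v w ∧ edgePair v (ccw v (ccw v w)) ≠ edgePair v w ∧
    edgePair v (ccw v w) ≠ edgePair v (ccw v (ccw v w)) ∧
    edgePair v (ccw v w) = edgePair v w + 1 ∧ edgePair v (ccw v (ccw v w)) = edgePair v w + 2 := by
  decide

theorem pair_flip (c : Corner T) : c.flip.pair = c.pair := (pair_facts _ _ c.2.2).1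
theorem pair_opp (c : Corner T) : c.opp.pair = c.pair := (pair_facts _ _ c.2.2).2.1
theorem pair_next (c : Corner T) : c.next.pair = c.pair + 1 := (pair_facts _ _ c.2.2).2.2.2.2.2.1
theorem pair_prev (c : Corner T) : c.prev.pair = c.pair + 2 := (pair_facts _ _ c.2.2).2.2.2.2.2.2

/-- The label of the corner of the cusp triangle at `v` that belongs to the pair `j`. -/
def labelOf (v : Fin 4) (j : Fin 3) : Fin 4 :=
  (![![1, 2, 3], ![0, 3, 2], ![3, 0, 1], ![2, 1, 0]] : Fin 4 → Fin 3 → Fin 4) v j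

theorem ne_labelOf : ∀ v j, v ≠ labelOf v j := by decide

theorem labelOf_spec : ∀ v j, edgePair v (labelOf v j) = j := by decide

theorem labelOf_edgePair : ∀ v w, v ≠ w → labelOf v (edgePair v w) = w := by decide

/-- The corner of the cusp triangle `X` that belongs to the pair `j`. -/
def ofPair (X : T × Fin 4) (j : Fin 3) : Corner T := (X.1, ⟨(X.2, labelOf X.2 j), ne_labelOf _ _⟩)

@[simp] theorem triangle_ofPair (X : T × Fin 4) (j : Fin 3) : (ofPair X j).triangle = X := rfl

@[simp] theorem pair_ofPair (X : T × Fin 4) (j : Fin 3) : (ofPair X j).pair = j := labelOf_spec _ _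

theorem ofPair_pair (c : Corner T) : ofPair c.triangle c.pair = c :=
  eq_of_labels rfl rfl (labelOf_edgePair _ _ c.2.2)

theorem sum_tips {A : Type*} [AddCommMonoid A] (c : Corner T) (z : Corner T → A) :
    ∑ v, z (ofPair (c.tet, v) c.pair) = z c + z c.flip + z c.opp + z c.opp.flip := by
  rw [c.sum_labels (fun v => z (ofPair (c.tet, v) c.pair))]
  have h₁ : ofPair (c.tet, c.tip) c.pair = c := c.ofPair_pair
  have h₂ : ofPair (c.tet, c.label) c.pair = c.flip := by
    rw [← c.pair_flip]; exact c.flip.ofPair_pair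
  have h₃ : ofPair (c.tet, c.next.label) c.pair = c.opp := by
    rw [← c.pair_opp]; exact c.opp.ofPair_pair
  have h₄ : ofPair (c.tet, c.prev.label) c.pair = c.opp.flip := by
    rw [← c.pair_opp, ← c.opp.pair_flip]; exact c.opp.flip.ofPair_pair
  simp only [h₁, h₂, h₃, h₄]

theorem angleAt_eq (θ : T → Fin 3 → ℝ) (c : Corner T) :
    OrientedGluing.angleAt θ c = θ c.tet c.pair := rfl

end Corner

/-! ### Gluing of sides, rotation about vertices, and cocycles -/

namespace OrientedGluing

variable {T : Type*} (τ : OrientedGluing T)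

@[simp] theorem tet_across (s : Corner T) : (τ.across s).tet = τ.adj s.tet s.label := rfl
@[simp] theorem tip_across (s : Corner T) :
    (τ.across s).tip = τ.glue s.tet s.label s.tip := rfl
@[simp] theorem label_across (s : Corner T) :
    (τ.across s).label = τ.glue s.tet s.label s.label := rfl

/-- An odd relabelling reverses the cyclic order of the three corners at each tip. This is how the
orientability of the gluing enters. -/
theorem ccw_odd : ∀ g : Equiv.Perm (Fin 4), Equiv.Perm.sign g = -1 → ∀ v w, v ≠ w →
    ccw (g v) (g w) = g (ccw v (ccw v w)) ∧ ccw (g v) (g (ccw v (ccw v w))) = g (ccw v w) := by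
  decide

theorem label_across_next (s : Corner T) :
    (τ.across s).next.label = τ.glue s.tet s.label s.prev.label :=
  (ccw_odd _ (τ.oriented _ _) _ _ s.2.2).1

theorem label_across_prev (s : Corner T) :
    (τ.across s).prev.label = τ.glue s.tet s.label s.next.label := by
  have h := ccw_odd _ (τ.oriented s.tet s.label) s.tip s.label s.2.2
  change ccw (τ.glue s.tet s.label s.tip)
    (ccw (τ.glue s.tet s.label s.tip) (τ.glue s.tet s.label s.label)) = _
  rw [h.1, h.2]; rfl

theorem glue_across (s : Corner T) (k : Fin 4) :
    τ.glue (τ.across s).tet (τ.across s).label (τ.glue s.tet s.label k) = k := by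
  simp [τ.glue_glue]

@[simp] theorem across_across (s : Corner T) : τ.across (τ.across s) = s := by
  refine Corner.eq_of_labels ?_ ?_ ?_
  · exact τ.adj_adj _ _
  · exact τ.glue_across s s.tip
  · exact τ.glue_across s s.label

theorem across_ne (s : Corner T) : τ.across s ≠ s := fun h =>
  τ.no_fold s.tet s.label ⟨congrArg Corner.tet h, congrArg Corner.label h⟩

/-- The next corner at the same vertex of the boundary, counterclockwise. -/
def rotate : Equiv.Perm (Corner T) where
  toFun c := (τ.across c.next).next
  invFun c := (τ.across c.prev).prev
  left_inv c := by simp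
  right_inv c := by simp

theorem rotate_apply (c : Corner T) : τ.rotate c = (τ.across c.next).next := rfl

theorem rotate_symm_apply (c : Corner T) : τ.rotate.symm c = (τ.across c.prev).prev := rfl

theorem label_rotate (c : Corner T) :
    (τ.rotate c).label = τ.glue c.tet c.next.label c.label := by
  rw [rotate_apply, label_across_next, Corner.next_prev]; rfl

/-- The two faces containing the edge of `c` are those through the two sides adjacent to `c`, so the
vertices of the boundary are the orbits of `rotate`. -/
theorem cornerAdj_iff {c d : Corner T} :
    τ.CornerAdj c d ↔ d = τ.rotate c ∨ d = τ.rotate.symm c := by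
  have h₁ := τ.label_across_next c.next
  have h₂ := τ.label_across_prev c.prev
  rw [Corner.next_prev] at h₁
  rw [Corner.prev_next] at h₂
  constructor
  · rintro ⟨f, h, h', ht, hv, hl⟩
    rcases Corner.label_cases c.tip c.label f c.2.2 h.symm with rfl | rfl | rfl
    · exact absurd rfl h'
    · exact .inl (Corner.eq_of_labels ht hv (hl.trans h₁.symm))
    · exact .inr (Corner.eq_of_labels ht hv (hl.trans h₂.symm))
  · rintro (rfl | rfl)
    · exact ⟨c.next.label, c.next.label_ne_tip, c.label_next_ne, rfl, rfl, h₁⟩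
    · exact ⟨c.prev.label, c.prev.label_ne_tip, c.label_prev_ne, rfl, rfl, h₂⟩

theorem vertex_rotate (c : Corner T) : τ.vertex (τ.rotate c) = τ.vertex c :=
  (Quot.sound (τ.cornerAdj_iff.2 (.inl rfl))).symm

theorem vertex_across_next (s : Corner T) : τ.vertex (τ.across s).next = τ.vertex s.prev := by
  rw [← τ.vertex_rotate s.prev, rotate_apply, Corner.prev_next]

theorem vertex_across_prev (s : Corner T) : τ.vertex (τ.across s).prev = τ.vertex s.next := by
  rw [← τ.across_across s, vertex_across_next, across_across]

/-- A set of corners that is stable under one of the two rotations is a union of vertices. -/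
theorem mem_of_vertex_eq [Finite T] {g : Equiv.Perm (Corner T)}
    (hg : g = τ.rotate ∨ g = τ.rotate.symm) {A : Set (Corner T)} (hA : ∀ c ∈ A, g c ∈ A)
    {c d : Corner T} (hc : c ∈ A) (h : τ.vertex c = τ.vertex d) : d ∈ A := by
  have hmaps : Set.MapsTo g A A := hA
  -- Finiteness turns stability under the permutation into stability under its inverse.
  have hA' : ∀ c ∈ A, g.symm c ∈ A := fun c hc => by
    obtain ⟨d, hd, rfl⟩ := (((Set.toFinite A).injOn_iff_bijOn_of_mapsTo hmaps).1 g.injective.injOn).surjOn hc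
    simpa using hd
  have key : ∀ c d, τ.CornerAdj c d → (c ∈ A ↔ d ∈ A) := by
    have h₁ : ∀ c, c ∈ A ↔ g c ∈ A := fun c => ⟨hA c, fun h => by simpa using hA' _ h⟩
    have h₂ : ∀ c, c ∈ A ↔ g.symm c ∈ A := fun c => ⟨hA' c, fun h => by simpa using hA _ h⟩
    intro c d hcd
    rcases τ.cornerAdj_iff.1 hcd with rfl | rfl <;> rcases hg with rfl | rfl
    exacts [h₁ c, h₂ c, h₂ c, h₁ c]
  have : Quot.lift (· ∈ A) (fun c d h => propext (key c d h)) (τ.vertex c) =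
      Quot.lift (· ∈ A) (fun c d h => propext (key c d h)) (τ.vertex d) := by rw [h]
  exact Eq.mp this hc

/-- Seen from the other end, the tetrahedra around an edge follow each other in the opposite sense.
-/
theorem rotate_flip (c : Corner T) : (τ.rotate c).flip = τ.rotate.symm c.flip := by
  have h₂ := τ.label_across_prev c.flip.prev
  rw [Corner.prev_next] at h₂
  refine Corner.eq_of_labels ?_ ?_ ?_
  · change τ.adj _ _ = τ.adj c.flip.tet c.flip.prev.label
    rw [c.label_prev_flip]; rfl
  · change (τ.rotate c).label = τ.glue c.flip.tet c.flip.prev.label c.flip.tip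
    rw [c.label_prev_flip, label_rotate]; rfl
  · refine Eq.trans ?_ h₂.symm
    change τ.glue c.tet c.next.label c.tip = _
    rw [c.label_prev_flip]; rfl

theorem cornerAdj_flip {c d : Corner T} (h : τ.CornerAdj c d) : τ.CornerAdj c.flip d.flip := by
  rcases τ.cornerAdj_iff.1 h with rfl | rfl
  · exact τ.cornerAdj_iff.2 (.inr (τ.rotate_flip c))
  · refine τ.cornerAdj_iff.2 (.inl ?_)
    rw [← Equiv.symm_apply_eq, ← rotate_flip, Equiv.apply_symm_apply]

/-- The other end of an edge of the ideal triangulation. -/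
def otherEnd : τ.Vertex → τ.Vertex :=
  Quot.map Corner.flip fun _ _ => τ.cornerAdj_flip

theorem otherEnd_vertex (c : Corner T) : τ.otherEnd (τ.vertex c) = τ.vertex c.flip := rfl

theorem otherEnd_otherEnd (q : τ.Vertex) : τ.otherEnd (τ.otherEnd q) = q := by
  induction q using Quot.ind; rfl

/-- Consecutive tetrahedra around an edge share a face. This face cuts one side out of the cusp
triangle at each of its tips; at the tip off the edge, the two copies of that side are the ones
identified here. It makes the last two terms of the deformation cancel around an edge. -/
theorem opp_rotate (c : Corner T) : (τ.rotate c).opp = τ.across c.opp.flip := by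
  have h₁ : (τ.rotate c).prev.label = τ.glue c.tet c.next.label c.next.label := by
    rw [rotate_apply, Corner.next_prev]; rfl
  have h₂ : (τ.rotate c).next.label = τ.glue c.tet c.next.label c.prev.label := by
    rw [rotate_apply, Corner.next_next, label_across_prev]; rfl
  exact Corner.eq_of_labels rfl h₂ h₁

/-! ### Cocycles -/

/-- An antisymmetric function on the sides of the cusp triangles whose values on each of them have
sum zero. -/
structure IsCocycle {A : Type*} [AddCommGroup A] (z : Corner T → A) : Prop where
  across : ∀ s, z (τ.across s) = -z s
  sum_eq : ∀ c, z c + z c.next + z c.prev = 0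

variable {τ}

open Classical in
theorem sum_vertex_rotate [Fintype T] {A : Type*} [AddCommMonoid A] (q : τ.Vertex)
    (f : Corner T → A) :
    ∑ c with τ.vertex c = q, f (τ.rotate c) = ∑ c with τ.vertex c = q, f c :=
  Finset.sum_equiv τ.rotate (by simp [vertex_rotate]) (by simp)

-- By the triangle relation, `z` on the side opposite to a corner is minus its sum over the two
-- adjacent sides. Around a vertex the adjacent sides are glued in pairs, so their values cancel.
open Classical in
theorem IsCocycle.sum_vertex [Fintype T] {A : Type*} [AddCommGroup A] {z : Corner T → A}
    (hz : τ.IsCocycle z) (q : τ.Vertex) : ∑ c with τ.vertex c = q, z c = 0 := by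
  have h₁ : ∀ c, z c = -(z c.next) - z c.prev := fun c => by
    have h := hz.sum_eq c
    rw [add_assoc, ← eq_neg_iff_add_eq_zero] at h
    rw [h]; abel
  have h₂ : ∀ c, z (τ.rotate c).prev = -z c.next := fun c => by
    rw [rotate_apply, Corner.next_prev, hz.across]
  rw [Finset.sum_congr rfl fun c _ => h₁ c, Finset.sum_sub_distrib,
    ← sum_vertex_rotate q fun c => z c.prev, Finset.sum_congr rfl fun c _ => h₂ c, sub_self]

/-- The change of the angles along a cocycle. -/
def deformation {A : Type*} [AddCommMonoid A] (z : Corner T → A) (t : T) (j : Fin 3) : A :=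
  ∑ v, z (Corner.ofPair (t, v) j)

theorem deformation_pair {A : Type*} [AddCommMonoid A] (z : Corner T → A) (c : Corner T) :
    deformation z c.tet c.pair = z c + z c.flip + z c.opp + z c.opp.flip := c.sum_tips z

-- The terms at `c` and `c.flip` vanish separately, as vertex sums at the two ends of the edge.
-- Those at `c.opp` and `c.opp.flip` cancel between neighbouring tetrahedra by `opp_rotate`.
open Classical in
theorem IsCocycle.sum_vertex_deformation [Fintype T] {A : Type*} [AddCommGroup A]
    {z : Corner T → A} (hz : τ.IsCocycle z) (q : τ.Vertex) :
    ∑ c with τ.vertex c = q, deformation z c.tet c.pair = 0 := by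
  simp only [deformation_pair, Finset.sum_add_distrib]
  have h₁ : ∑ c with τ.vertex c = q, z c.flip = ∑ c with τ.vertex c = τ.otherEnd q, z c :=
    Finset.sum_bij' (fun c _ => c.flip) (fun c _ => c.flip)
      (by rintro c hc; simp only [Finset.mem_filter, Finset.mem_univ, true_and] at hc ⊢
          rw [← hc, otherEnd_vertex])
      (by rintro c hc; simp only [Finset.mem_filter, Finset.mem_univ, true_and] at hc ⊢
          rw [← otherEnd_vertex, hc, otherEnd_otherEnd])
      (by simp) (by simp) (by simp)
  rw [h₁, hz.sum_vertex, hz.sum_vertex, ← sum_vertex_rotate q fun c => z c.opp,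
    Finset.sum_congr rfl fun c _ => show z (τ.rotate c).opp = -z c.opp.flip by
      rw [opp_rotate, hz.across]]
  simp

theorem IsCocycle.sum_deformation {A : Type*} [AddCommGroup A]
    {z : Corner T → A} (hz : τ.IsCocycle z) (t : T) : ∑ j, deformation z t j = 0 := by
  unfold deformation
  rw [Finset.sum_comm]
  refine Finset.sum_eq_zero fun v _ => ?_
  rw [Fin.sum_univ_three]
  have h : ∀ v : Fin 4, Corner.labelOf v 1 = ccw v (Corner.labelOf v 0) ∧
    Corner.labelOf v 2 = ccw v (ccw v (Corner.labelOf v 0)) := by decide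
  have h₁ : Corner.ofPair (t, v) 1 = (Corner.ofPair (t, v) 0).next :=
    Corner.eq_of_labels rfl rfl (h v).1
  have h₂ : Corner.ofPair (t, v) 2 = (Corner.ofPair (t, v) 0).prev :=
    Corner.eq_of_labels rfl rfl (h v).2
  rw [h₁, h₂, hz.sum_eq]

/-- The contribution of the other three tips to the deformation is a difference of functions of the
sides. -/
def sideDefect {A : Type*} [AddCommGroup A] (z : Corner T → A) (s : Corner T) : A :=
  z s.prev.opp.flip - z s.next.opp

/-- The triangle relation at the other end of the edge, `c.flip`, replaces the value there by those
on the two adjacent sides; together with the values at the opposite edge these group into one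
expression for each side at `c`. -/
theorem deformation_sub {A : Type*} [AddCommGroup A] {z : Corner T → A} (hz : τ.IsCocycle z)
    (c : Corner T) : deformation z c.tet c.pair - z c =
      sideDefect z c.next - sideDefect z c.prev := by
  rw [deformation_pair, sideDefect, sideDefect, Corner.next_prev, Corner.prev_next,
    Corner.next_next, Corner.prev_prev]
  have h := hz.sum_eq c.flip
  have hq := Corner.ccw_opp c.tip c.label c.2.2
  have h₁ : c.prev.opp = c.flip.prev := by
    refine Corner.eq_of_labels rfl ?_ ?_
    · change ccw c.tip c.prev.label = c.label
      exact congrArg Corner.label c.prev_next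
    · rw [c.label_prev_flip]; change c.prev.prev.label = _; rw [Corner.prev_prev]
  have h₂ : c.next.opp.flip = c.flip.next := by
    refine Corner.eq_of_labels rfl ?_ ?_
    · change c.next.prev.label = c.label
      rw [Corner.next_prev]
    · rw [c.label_next_flip]; rfl
  rw [h₁, h₂]
  rw [add_assoc, ← eq_neg_iff_add_eq_zero] at h
  rw [h]; abel

/-- Both terms of the defect are values on sides cut out by the face of `s`. Under the gluing they
are exchanged and change sign, so their difference is preserved. -/
theorem IsCocycle.sideDefect_across {A : Type*} [AddCommGroup A] {z : Corner T → A}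
    (hz : τ.IsCocycle z) (s : Corner T) : sideDefect z (τ.across s) = sideDefect z s := by
  have h₁ : (τ.across s).prev.opp.flip = τ.across s.next.opp := by
    have e₁ : (τ.across s).prev.prev.label = τ.glue s.tet s.label s.prev.label := by
      rw [Corner.prev_prev, label_across_next]
    have e₂ : (τ.across s).prev.next.label = τ.glue s.tet s.label s.label := by
      rw [Corner.prev_next]; rfl
    have e₃ : s.next.opp.label = s.label := by
      change s.next.prev.label = _; rw [Corner.next_prev]
    refine Corner.eq_of_labels ?_ (e₁.trans ?_) (e₂.trans ?_)
    · rw [tet_across, e₃]; rfl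
    · rw [tip_across, e₃]; rfl
    · rw [label_across, e₃]; rfl
  have h₂ : (τ.across s).next.opp = τ.across s.prev.opp.flip := by
    have e₁ : (τ.across s).next.prev.label = τ.glue s.tet s.label s.label := by
      rw [Corner.next_prev]; rfl
    have e₂ : (τ.across s).next.next.label = τ.glue s.tet s.label s.next.label := by
      rw [Corner.next_next, label_across_prev]
    have e₃ : s.prev.opp.flip.label = s.label := by
      change s.prev.next.label = _; rw [Corner.prev_next]
    have e₄ : s.prev.opp.flip.tip = s.next.label := by
      change s.prev.prev.label = _; rw [Corner.prev_prev]
    refine Corner.eq_of_labels ?_ (e₂.trans ?_) (e₁.trans ?_)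
    · rw [tet_across, e₃]; rfl
    · rw [tip_across, e₃, e₄]; rfl
    · rw [label_across, e₃]; rfl
  rw [sideDefect, sideDefect, h₁, h₂, hz.across, hz.across]; abel

end OrientedGluing

/-! ### Signed sums along normal curves -/

namespace Arc

variable {T : Type*}

@[simp] theorem triangle_enter (a : Arc T) : a.enter.triangle = a.corner.triangle := by
  unfold enter; split <;> rfl

@[simp] theorem triangle_leave (a : Arc T) : a.leave.triangle = a.corner.triangle := by
  unfold leave; split <;> rfl

theorem enter_of_left {a : Arc T} (h : a.left = true) : a.enter = a.corner.prev := by simp [enter, h]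
theorem leave_of_left {a : Arc T} (h : a.left = true) : a.leave = a.corner.next := by simp [leave, h]
theorem enter_of_right {a : Arc T} (h : a.left = false) : a.enter = a.corner.next := by
  simp [enter, h]
theorem leave_of_right {a : Arc T} (h : a.left = false) : a.leave = a.corner.prev := by
  simp [leave, h]

theorem enter_ne_leave (a : Arc T) : a.enter ≠ a.leave := by
  cases h : a.left
  · rw [enter_of_right h, leave_of_right h]; exact (Corner.prev_ne_next _).symm
  · rw [enter_of_left h, leave_of_left h]; exact Corner.prev_ne_next _

/-- The value at the corner that is cut off, with sign `+` if it is on the left. -/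
def signed {A : Type*} [AddGroup A] (φ : Corner T → A) (a : Arc T) : A :=
  if a.left then φ a.corner else -φ a.corner

theorem signed_of_left {A : Type*} [AddGroup A] {φ : Corner T → A} {a : Arc T}
    (h : a.left = true) : a.signed φ = φ a.corner := by simp [signed, h]

theorem signed_of_right {A : Type*} [AddGroup A] {φ : Corner T → A} {a : Arc T}
    (h : a.left = false) : a.signed φ = -φ a.corner := by simp [signed, h]

theorem signed_eq_of_sub {A : Type*} [AddCommGroup A] {φ g : Corner T → A}
    (h : ∀ c, φ c = g c.next - g c.prev) (a : Arc T) : a.signed φ = g a.leave - g a.enter := by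
  cases hl : a.left
  · rw [signed_of_right hl, enter_of_right hl, leave_of_right hl, h]; abel
  · rw [signed_of_left hl, enter_of_left hl, leave_of_left hl, h]

theorem signed_add {A : Type*} [AddCommGroup A] (φ ψ : Corner T → A) (a : Arc T) :
    a.signed (fun c => φ c + ψ c) = a.signed φ + a.signed ψ := by
  unfold signed; split
  · rfl
  · exact neg_add _ _

end Arc

namespace OrientedGluing.NormalCurve

variable {T : Type*} {τ : OrientedGluing T}

/-- The sum over the corners that the curve cuts off, with sign `+` on the left. -/
def turn {A : Type*} [AddCommGroup A] (φ : Corner T → A) (γ : τ.NormalCurve) : A :=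
  ∑ i, (γ.arc i).signed φ

theorem turningAngle_eq_turn (θ : T → Fin 3 → ℝ) (γ : τ.NormalCurve) :
    γ.turningAngle θ = γ.turn (angleAt θ) := by
  rw [turningAngle, turn, Finset.sum_filter, Finset.sum_filter, ← Finset.sum_sub_distrib]
  refine Finset.sum_congr rfl fun i _ => ?_
  unfold Arc.signed
  cases (γ.arc i).left <;> simp

theorem turn_add {A : Type*} [AddCommGroup A] (φ ψ : Corner T → A) (γ : τ.NormalCurve) :
    γ.turn (fun c => φ c + ψ c) = γ.turn φ + γ.turn ψ := by
  simp only [turn, Arc.signed_add, Finset.sum_add_distrib]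

theorem sum_enter {A : Type*} [AddCommMonoid A] (γ : τ.NormalCurve) (f : Corner T → A) :
    ∑ i, f (γ.arc i).enter = ∑ i, f (τ.across (γ.arc i).leave) := by
  rw [← Equiv.sum_comp (Equiv.addRight (1 : Fin (γ.n + 1))) fun i => f (γ.arc i).enter]
  exact Finset.sum_congr rfl fun i _ => by simp only [Equiv.coe_addRight, γ.closed]

/-- The sum telescopes: the value on the side through which an arc leaves cancels the value on the
glued side through which the next arc enters. -/
theorem turn_eq_zero_of_sub {A : Type*} [AddCommGroup A] {φ g : Corner T → A}
    (h : ∀ c, φ c = g c.next - g c.prev) (hg : ∀ s, g (τ.across s) = g s) (γ : τ.NormalCurve) :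
    γ.turn φ = 0 := by
  simp only [turn, Arc.signed_eq_of_sub h, Finset.sum_sub_distrib]
  rw [γ.sum_enter, sub_eq_zero]
  simp only [hg]

/-- Neumann and Zagier: only the tip that the curve goes around contributes to the turning of the
deformation along a cocycle. -/
theorem turn_deformation {A : Type*} [AddCommGroup A] {z : Corner T → A} (hz : τ.IsCocycle z)
    (γ : τ.NormalCurve) : γ.turn (fun c => deformation z c.tet c.pair) = γ.turn z := by
  have h := γ.turn_eq_zero_of_sub (fun c => deformation_sub hz c) hz.sideDefect_across
  rw [← add_zero (γ.turn z), ← h, ← turn_add]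
  simp

open Classical in
theorem sum_eq_sum_card [Fintype T] {ι : Type*} [Fintype ι] (s : ι → Corner T)
    (g : Corner T → ℝ) :
    ∑ i, g (s i) = ∑ c, (Finset.card {i | s i = c} : ℝ) * g c := by
  rw [← Finset.sum_fiberwise (s := Finset.univ) (g := s) (f := fun i => g (s i))]
  refine Finset.sum_congr rfl fun c _ => ?_
  rw [Finset.sum_congr rfl fun i hi => by rw [(Finset.mem_filter.1 hi).2]]
  simp

/-- The turning of a function with vanishing sums over triangles and vertices depends only on the
homology class. -/
theorem turn_eq_of_homologous [Fintype T] {φ : Corner T → ℝ}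
    (h₃ : ∀ c, φ c + φ c.next + φ c.prev = 0)
    (hv : ∀ q : τ.Vertex, ∀ (_ : DecidablePred fun c => τ.vertex c = q),
      ∑ c with τ.vertex c = q, φ c = 0)
    {γ δ : τ.NormalCurve} (h : γ.Homologous δ) : γ.turn φ = δ.turn φ := by
  classical
  obtain ⟨m, hm⟩ := h
  -- When the three values on a triangle have sum zero, this inverts the passage from `g` to the
  -- differences `g c.next - g c.prev`; the factor 3 comes from `2 φ c - φ c.next - φ c.prev = 3 φ
  -- c`.
  set g : Corner T → ℝ := fun s => (φ s.prev - φ s.next) / 3 with hg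
  have hφ : ∀ c, φ c = g c.next - g c.prev := fun c => by
    simp only [hg, Corner.next_prev, Corner.next_next, Corner.prev_prev, Corner.prev_next]
    linarith [h₃ c]
  have key : ∀ γ : τ.NormalCurve, γ.turn φ = ∑ s, (γ.flow s : ℝ) * g s := fun γ => by
    simp only [turn, Arc.signed_eq_of_sub hφ, Finset.sum_sub_distrib]
    rw [sum_eq_sum_card (fun i => (γ.arc i).leave), sum_eq_sum_card (fun i => (γ.arc i).enter),
      ← Finset.sum_sub_distrib]
    refine Finset.sum_congr rfl fun s _ => ?_
    rw [flow]; push_cast; ring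
  rw [key, key, ← sub_eq_zero, ← Finset.sum_sub_distrib]
  have hnext : ∀ f : Corner T → ℝ, ∑ c : Corner T, f c.next = ∑ c : Corner T, f c := fun f =>
    Equiv.sum_comp ⟨Corner.next, Corner.prev, fun c => by simp, fun c => by simp⟩ f
  have hprev : ∀ f : Corner T → ℝ, ∑ c : Corner T, f c.prev = ∑ c : Corner T, f c := fun f =>
    Equiv.sum_comp ⟨Corner.prev, Corner.next, fun c => by simp, fun c => by simp⟩ f
  have h₁ : ∑ s : Corner T, ((γ.flow s : ℝ) * g s - δ.flow s * g s) =
      ∑ s : Corner T, ((m (τ.vertex s.prev) : ℝ) * g s - m (τ.vertex s.next) * g s) := by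
    refine Finset.sum_congr rfl fun s _ => ?_
    have := hm s
    rw [← sub_mul, ← sub_mul]
    congr 1
    exact_mod_cast this
  rw [h₁, Finset.sum_sub_distrib,
    ← hnext fun s : Corner T => (m (τ.vertex s.prev) : ℝ) * g s,
    ← hprev fun s : Corner T => (m (τ.vertex s.next) : ℝ) * g s, ← Finset.sum_sub_distrib]
  -- Summation by parts moves the boundary operator from `m` to `g`, which leaves `m` paired with
  -- the vertex sums of `φ`.
  have h₂ : ∀ c : Corner T, (m (τ.vertex c.next.prev) : ℝ) * g c.next -
      m (τ.vertex c.prev.next) * g c.prev = m (τ.vertex c) * φ c := fun c => by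
    rw [Corner.next_prev, Corner.prev_next, hφ c]; ring
  rw [Finset.sum_congr rfl fun c _ => h₂ c]
  have hmaps : ∀ c ∈ (Finset.univ : Finset (Corner T)),
      τ.vertex c ∈ Finset.univ.image τ.vertex := fun c hc => Finset.mem_image_of_mem _ hc
  rw [← Finset.sum_fiberwise_of_maps_to hmaps]
  refine Finset.sum_eq_zero fun q _ => ?_
  rw [Finset.sum_congr rfl fun c hc => by rw [(Finset.mem_filter.1 hc).2], ← Finset.mul_sum, hv,
    mul_zero]

theorem Homologous.trans {γ δ ε : τ.NormalCurve} (h : γ.Homologous δ) (h' : δ.Homologous ε) :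
    γ.Homologous ε := by
  obtain ⟨m, hm⟩ := h
  obtain ⟨m', hm'⟩ := h'
  exact ⟨m + m', fun s => by simp only [Pi.add_apply]; linarith [hm s, hm' s]⟩

theorem _root_.OrientedGluing.IsCocycle.turn_eq [Fintype T] {z : Corner T → ℝ} (hz : τ.IsCocycle z)
    {γ δ : τ.NormalCurve} (h : γ.Homologous δ) : γ.turn z = δ.turn z :=
  turn_eq_of_homologous hz.sum_eq (fun q _ => by convert hz.sum_vertex q) h

theorem ofNat_succ (n k : ℕ) : Fin.ofNat (n + 1) (k + 1) = Fin.ofNat (n + 1) k + 1 := by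
  ext
  simp [Fin.val_add]

/-- Induction along a cyclically indexed family. -/
theorem forall_of_succ {n : ℕ} {p : Fin (n + 1) → Prop} (h₀ : ∃ i, p i)
    (h : ∀ i, p i → p (i + 1)) (i : Fin (n + 1)) : p i := by
  obtain ⟨j, hj⟩ := h₀
  have key : ∀ k : ℕ, p (Fin.ofNat (n + 1) (j.val + k)) := fun k => by
    induction k with
    | zero => simpa using hj
    | succ k ih => rw [← add_assoc, ofNat_succ]; exact h _ ih
  -- One full turn is added to keep the number of steps from `j` to `i` nonnegative.
  have := key (i.val + (n + 1) - j.val)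
  rw [show j.val + (i.val + (n + 1) - j.val) = i.val + (n + 1) by omega] at this
  have hi : Fin.ofNat (n + 1) (i.val + (n + 1)) = i := by
    ext
    simp [Nat.mod_eq_of_lt i.isLt]
  rwa [hi] at this

end OrientedGluing.NormalCurve

/-- Two involutions without fixed points admit a two-colouring that both of them flip. -/
theorem exists_bool_coloring {S : Type*} {f g : S → S} (hf : Function.Involutive f)
    (hg : Function.Involutive g) (hf' : ∀ x, f x ≠ x) (hg' : ∀ x, g x ≠ x) :
    ∃ s : S → Bool, ∀ x, s (f x) = !s x ∧ s (g x) = !s x := by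
  set F : Equiv.Perm S := hf.toPerm
  set G : Equiv.Perm S := hg.toPerm
  have hFF : F⁻¹ = F := rfl
  have hGG : G⁻¹ = G := rfl
  have hF2 : F * F = 1 := (congrArg (· * F) hFF).symm.trans (inv_mul_cancel F)
  have hG2 : G * G = 1 := (congrArg (· * G) hGG).symm.trans (inv_mul_cancel G)
  set r := F * G
  have hconj : ∀ k : ℤ, F * r ^ k = (r ^ k)⁻¹ * F := fun k => by
    have h₁ : F * r * F⁻¹ = r⁻¹ := by
      simp only [r, mul_inv_rev, hFF, hGG, ← mul_assoc, hF2, one_mul]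
    rw [← mul_inv_eq_iff_eq_mul, ← conj_zpow, h₁, inv_zpow]
  -- In the infinite dihedral group every reflection is conjugate to `F` or to `G`. If `F x` were a
  -- rotation `r ^ k` of `x`, one of these would have a fixed point on the cycle, according to the
  -- parity of `k`.
  have hne : ∀ x, ¬ r.SameCycle x (F x) := by
    rintro x ⟨k, hk⟩
    have happ : ∀ j : ℤ, F ((r ^ j) x) = (r ^ (k - j)) x := fun j => by
      rw [← Equiv.Perm.mul_apply, hconj, Equiv.Perm.mul_apply, ← hk, ← Equiv.Perm.mul_apply,
        ← zpow_neg, ← zpow_add]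
      congr 2; ring
    rcases Int.even_or_odd' k with ⟨j, rfl | rfl⟩
    · exact hf' ((r ^ j) x) ((happ j).trans (by congr 2; ring))
    · have h := happ j
      rw [show 2 * j + 1 - j = 1 + j by ring, zpow_add, zpow_one, Equiv.Perm.mul_apply] at h
      exact hg' ((r ^ j) x) (F.injective h).symm
  let Q := Quotient (Equiv.Perm.SameCycle.setoid r)
  have hF : ∀ x y, r.SameCycle x y → r.SameCycle (F x) (F y) := by
    rintro x _ ⟨k, rfl⟩
    refine ⟨-k, ?_⟩
    rw [← Equiv.Perm.mul_apply F, hconj, zpow_neg]; rfl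
  let F' : Q → Q := Quotient.map F hF
  have hF' : Function.Involutive F' := fun q => by
    induction q using Quotient.ind
    exact congrArg _ (hf _)
  have hne' : ∀ q, F' q ≠ q := fun q => by
    induction q using Quotient.ind with | _ x
    exact fun h => hne x (Quotient.exact h.symm)
  classical
  -- The cycles of `r` come in pairs exchanged by `F`; an arbitrary linear order selects one of each
  -- pair.
  let _ : LinearOrder Q := linearOrderOfSTO WellOrderingRel
  have hs : ∀ q, decide (F' q < F' (F' q)) = !decide (q < F' q) := fun q => by
    rw [hF' q]
    rcases lt_or_gt_of_ne (hne' q) with h | h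
    · simp [h, h.le]
    · simp [h, h.le]
  refine ⟨fun x => decide ((⟦x⟧ : Q) < F' ⟦x⟧), fun x => ⟨hs ⟦x⟧, ?_⟩⟩
  have hgx : (⟦g x⟧ : Q) = ⟦f x⟧ :=
    Quotient.sound ⟨1, by rw [zpow_one]; exact congrArg F (hg x)⟩
  change decide ((⟦g x⟧ : Q) < F' ⟦g x⟧) = !decide ((⟦x⟧ : Q) < F' ⟦x⟧)
  rw [hgx]
  exact hs ⟦x⟧

/-! ### Triangles and ladders of a veering structure -/

namespace OrientedGluing

variable {T : Type*} (τ : OrientedGluing T)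

/-- The combinatorial content of a veering structure: the pair of wide edges of each tetrahedron and
the directions in which the vertices of the boundary veer (`true` for left). -/
structure VeeringColoring where
  wide : T → Fin 3
  color : τ.Vertex → Bool
  color_next : ∀ X : T × Fin 4, color (τ.vertex (Corner.ofPair X (wide X.1)).next) = true
  color_prev : ∀ X : T × Fin 4, color (τ.vertex (Corner.ofPair X (wide X.1)).prev) = false
  two_wide : ∀ q, ∃ X Y, X ≠ Y ∧
    ∀ Z : T × Fin 4, τ.vertex (Corner.ofPair Z (wide Z.1)) = q ↔ Z = X ∨ Z = Y
  color_otherEnd : ∀ q, color (τ.otherEnd q) = color q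

/-- The rotation around the vertices, counterclockwise for `true` and clockwise for `false`. -/
def turnUp (e : Bool) : Equiv.Perm (Corner T) := if e then τ.rotate else τ.rotate.symm

namespace VeeringColoring

variable {τ} (D : τ.VeeringColoring)

/-- The wide corner of a cusp triangle. -/
def wideCorner (X : T × Fin 4) : Corner T := Corner.ofPair X (D.wide X.1)

/-- The thin corner of a cusp triangle at a vertex that veers in the given direction. -/
def thinCorner (e : Bool) (X : T × Fin 4) : Corner T :=
  if e then (D.wideCorner X).next else (D.wideCorner X).prev

/-- The direction in which the vertex at the wide corner veers. -/
def type (X : T × Fin 4) : Bool := D.color (τ.vertex (D.wideCorner X))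

/-- The rung of the ladder that contains the wide corner. -/
def top (X : T × Fin 4) : Corner T := D.thinCorner (D.type X) X

/-- The side of a cusp triangle that is a ladderpole segment. -/
def pole (X : T × Fin 4) : Corner T := D.thinCorner (!D.type X) X

variable (X Y : T × Fin 4) (e : Bool)

@[simp] theorem triangle_wideCorner : (D.wideCorner X).triangle = X := rfl

@[simp] theorem triangle_thinCorner : (D.thinCorner e X).triangle = X := by
  unfold thinCorner; split <;> rfl

@[simp] theorem triangle_top : (D.top X).triangle = X := D.triangle_thinCorner _ _

@[simp] theorem triangle_pole : (D.pole X).triangle = X := D.triangle_thinCorner _ _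

@[simp] theorem thinCorner_true : D.thinCorner true X = (D.wideCorner X).next := rfl
@[simp] theorem thinCorner_false : D.thinCorner false X = (D.wideCorner X).prev := rfl

@[simp] theorem color_thinCorner : D.color (τ.vertex (D.thinCorner e X)) = e := by
  cases e
  · exact D.color_prev X
  · exact D.color_next X

theorem thinCorner_ne_wideCorner : D.thinCorner e X ≠ D.wideCorner Y := fun h => by
  have hX : X = Y := by simpa using congrArg Corner.triangle h
  subst hX
  cases e
  · exact Corner.prev_ne _ h
  · exact Corner.next_ne _ h

variable {X} in
theorem corner_cases {c : Corner T} (h : c.triangle = X) :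
    c = D.wideCorner X ∨ c = D.top X ∨ c = D.pole X := by
  rcases Corner.eq_or_eq_next_or_eq_prev (c := D.wideCorner X) (d := c) h with h | h | h
  · exact .inl h
  · cases ht : D.type X
    · exact .inr (.inr (by simp [pole, ht, h]))
    · exact .inr (.inl (by simp [top, ht, h]))
  · cases ht : D.type X
    · exact .inr (.inl (by simp [top, ht, h]))
    · exact .inr (.inr (by simp [pole, ht, h]))

/-- The directions in which the two ends of a side veer, in the counterclockwise order. -/
def ends (s : Corner T) : Bool × Bool := (D.color (τ.vertex s.next), D.color (τ.vertex s.prev))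

theorem ends_wideCorner : D.ends (D.wideCorner X) = (true, false) :=
  Prod.ext (D.color_next X) (D.color_prev X)

theorem ends_top : D.ends (D.top X) = (false, true) := by
  cases ht : D.type X
  · have : D.top X = (D.wideCorner X).prev := by simp [top, ht]
    rw [this, ends, Corner.prev_next, Corner.prev_prev]
    exact Prod.ext ht (D.color_next X)
  · have : D.top X = (D.wideCorner X).next := by simp [top, ht]
    rw [this, ends, Corner.next_prev, Corner.next_next]
    exact Prod.ext (D.color_prev X) ht

theorem ends_pole : D.ends (D.pole X) = (D.type X, D.type X) := by
  cases ht : D.type X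
  · have : D.pole X = (D.wideCorner X).next := by simp [pole, ht]
    rw [this, ends, Corner.next_prev, Corner.next_next]
    exact Prod.ext (D.color_prev X) ht
  · have : D.pole X = (D.wideCorner X).prev := by simp [pole, ht]
    rw [this, ends, Corner.prev_next, Corner.prev_prev]
    exact Prod.ext ht (D.color_next X)

theorem ends_across (s : Corner T) : D.ends (τ.across s) = (D.ends s).swap := by
  rw [ends, vertex_across_next, vertex_across_prev]; rfl

/-- The corner, on the ladderpole that veers in the given direction, of the side `D.top X`. -/
def topCorner : Corner T := if D.type X = e then D.wideCorner X else D.thinCorner e X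

/-- The colours at the ends of a side determine which side of its triangle it is. The gluing
reverses the order of the ends, so upper rungs meet lower rungs and ladderpole segments meet
ladderpole segments. -/
theorem across_top_eq : τ.across (D.top X) = D.wideCorner (τ.across (D.top X)).triangle := by
  have h := D.ends_across (D.top X)
  rw [ends_top] at h
  rcases D.corner_cases (c := τ.across (D.top X)) rfl with h' | h' | h'
  · exact h'
  · rw [h', ends_top] at h; simp at h
  · rw [h', ends_pole] at h; simp at h

theorem across_wideCorner_eq :
    τ.across (D.wideCorner X) = D.top (τ.across (D.wideCorner X)).triangle := by
  have h := D.ends_across (D.wideCorner X)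
  rw [ends_wideCorner] at h
  rcases D.corner_cases (c := τ.across (D.wideCorner X)) rfl with h' | h' | h'
  · rw [h', ends_wideCorner] at h; simp at h
  · exact h'
  · rw [h', ends_pole] at h; simp at h

/-- The next triangle in the same ladder, across the rung `D.top X`. -/
def up : Equiv.Perm (T × Fin 4) where
  toFun X := (τ.across (D.top X)).triangle
  invFun X := (τ.across (D.wideCorner X)).triangle
  left_inv X := by
    change (τ.across (D.wideCorner (τ.across (D.top X)).triangle)).triangle = X
    rw [← across_top_eq, across_across, triangle_top]
  right_inv X := by
    change (τ.across (D.top (τ.across (D.wideCorner X)).triangle)).triangle = X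
    rw [← across_wideCorner_eq, across_across, triangle_wideCorner]

/-- The triangle on the other side of the ladderpole. -/
def pass : T × Fin 4 := (τ.across (D.pole X)).triangle

theorem across_top : τ.across (D.top X) = D.wideCorner (D.up X) := D.across_top_eq X

theorem across_wideCorner : τ.across (D.wideCorner X) = D.top (D.up.symm X) :=
  D.across_wideCorner_eq X

theorem across_pole_and_type_pass :
    τ.across (D.pole X) = D.pole (D.pass X) ∧ D.type (D.pass X) = D.type X := by
  have h := D.ends_across (D.pole X)
  rw [ends_pole] at h
  rcases D.corner_cases (c := τ.across (D.pole X)) rfl with h' | h' | h'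
  · rw [h', ends_wideCorner] at h
    have h₁ := congrArg Prod.fst h
    have h₂ := congrArg Prod.snd h
    simp only [Prod.swap] at h₁ h₂
    exact absurd (h₁.trans h₂.symm) (by simp)
  · rw [h', ends_top] at h
    have h₁ := congrArg Prod.fst h
    have h₂ := congrArg Prod.snd h
    simp only [Prod.swap] at h₁ h₂
    exact absurd (h₁.trans h₂.symm) (by simp)
  · rw [h', ends_pole] at h
    exact ⟨h', congrArg Prod.fst h⟩

theorem across_pole : τ.across (D.pole X) = D.pole (D.pass X) := (D.across_pole_and_type_pass X).1

@[simp] theorem type_pass : D.type (D.pass X) = D.type X := (D.across_pole_and_type_pass X).2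

@[simp] theorem pass_pass : D.pass (D.pass X) = X := by
  change (τ.across (D.pole (D.pass X))).triangle = X
  rw [← across_pole, across_across, triangle_pole]

theorem pass_ne : D.pass X ≠ X := fun h =>
  τ.across_ne (D.pole X) (by rw [across_pole, h])

theorem prev_topCorner_true : (D.top X).prev = D.topCorner X true := by
  cases h : D.type X <;> simp [top, topCorner, h]

theorem next_topCorner_false : (D.top X).next = D.topCorner X false := by
  cases h : D.type X <;> simp [top, topCorner, h]

theorem turnUp_topCorner : τ.turnUp e (D.topCorner X e) = D.thinCorner e (D.up X) := by
  cases e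
  · change τ.rotate.symm _ = _
    rw [← next_topCorner_false, rotate_symm_apply, Corner.next_prev, across_top]; rfl
  · change τ.rotate _ = _
    rw [← prev_topCorner_true, rotate_apply, Corner.prev_next, across_top]; rfl

variable {X e} in
theorem turnUp_thinCorner_of_type_eq (h : D.type X = e) :
    τ.turnUp e (D.thinCorner e X) = D.wideCorner (D.pass X) := by
  have hp : D.pole X = D.thinCorner (!e) X := by rw [pole, h]
  have hp' : D.pole (D.pass X) = D.thinCorner (!e) (D.pass X) := by rw [pole, type_pass, h]
  have ha := D.across_pole X
  cases e
  · change τ.rotate.symm _ = _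
    rw [rotate_symm_apply, thinCorner_false, Corner.prev_prev, ← thinCorner_true,
      ← Bool.not_false, ← hp, ha, hp']
    simp
  · change τ.rotate _ = _
    rw [rotate_apply, thinCorner_true, Corner.next_next, ← thinCorner_false,
      ← Bool.not_true, ← hp, ha, hp']
    simp

theorem vertex_turnUp (c : Corner T) : τ.vertex (τ.turnUp e c) = τ.vertex c := by
  cases e
  · change τ.vertex (τ.rotate.symm c) = _
    rw [← τ.vertex_rotate (τ.rotate.symm c), Equiv.apply_symm_apply]
  · exact τ.vertex_rotate c

theorem vertex_thinCorner_up : τ.vertex (D.thinCorner e (D.up X)) = τ.vertex (D.topCorner X e) := by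
  rw [← turnUp_topCorner, vertex_turnUp]

variable {X e} in
theorem vertex_wideCorner_pass (h : D.type X = e) :
    τ.vertex (D.wideCorner (D.pass X)) = τ.vertex (D.thinCorner e X) := by
  rw [← D.turnUp_thinCorner_of_type_eq h, vertex_turnUp]

variable {X e} in
theorem topCorner_of_type_eq (h : D.type X = e) : D.topCorner X e = D.wideCorner X := if_pos h

variable {X e} in
theorem topCorner_of_type_ne (h : D.type X ≠ e) : D.topCorner X e = D.thinCorner e X := if_neg h

theorem mem_of_vertex_eq [Finite T] {A : Set (Corner T)} (hA : ∀ c ∈ A, τ.turnUp e c ∈ A)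
    {c d : Corner T} (hc : c ∈ A) (h : τ.vertex c = τ.vertex d) : d ∈ A :=
  τ.mem_of_vertex_eq (g := τ.turnUp e) (by cases e; exacts [.inr rfl, .inl rfl]) hA hc h

/-- Every ladder contains triangles of both types. -/
theorem exists_type_eq [Finite T] : ∃ i : ℕ, D.type ((D.up ^ i) X) = e := by
  by_contra! hne
  obtain ⟨Z, _, _, hZ⟩ := D.two_wide (τ.vertex (D.thinCorner e X))
  have hw := (hZ Z).2 (.inl rfl)
  -- If no triangle of the ladder had type `e`, its thin corners on that side would fill up whole
  -- vertices without any wide corner, contrary to `two_wide`.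
  have := mem_of_vertex_eq (τ := τ) e (A := {c | ∃ i : ℕ, c = D.thinCorner e ((D.up ^ i) X)})
    (by rintro _ ⟨i, rfl⟩
        refine ⟨i + 1, ?_⟩
        rw [← D.topCorner_of_type_ne (hne i), turnUp_topCorner, pow_succ']; rfl)
    (c := D.thinCorner e X) (d := D.wideCorner Z) ⟨0, rfl⟩ hw.symm
  obtain ⟨i, hi⟩ := this
  exact D.thinCorner_ne_wideCorner _ _ _ hi.symm

theorem exists_other : ∃ Y, Y ≠ X ∧
    ∀ Z, τ.vertex (D.wideCorner Z) = τ.vertex (D.wideCorner X) ↔ Z = X ∨ Z = Y := by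
  obtain ⟨A, B, hAB, h⟩ := D.two_wide (τ.vertex (D.wideCorner X))
  rcases (h X).1 rfl with rfl | rfl
  · exact ⟨B, hAB.symm, h⟩
  · exact ⟨A, hAB, fun Z => (h Z).trans or_comm⟩

/-- The triangle of the other wide corner at the vertex of the wide corner of `X`. -/
noncomputable def other : T × Fin 4 := (D.exists_other X).choose

theorem other_ne : D.other X ≠ X := (D.exists_other X).choose_spec.1

variable {X Y} in
theorem vertex_wideCorner_eq_iff :
    τ.vertex (D.wideCorner Y) = τ.vertex (D.wideCorner X) ↔ Y = X ∨ Y = D.other X :=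
  (D.exists_other X).choose_spec.2 Y

theorem vertex_other : τ.vertex (D.wideCorner (D.other X)) = τ.vertex (D.wideCorner X) :=
  D.vertex_wideCorner_eq_iff.2 (.inr rfl)

@[simp] theorem other_other : D.other (D.other X) = X := by
  rcases D.vertex_wideCorner_eq_iff.1 (D.vertex_other X).symm with h | h
  · exact absurd h.symm (D.other_ne X)
  · exact h.symm

@[simp] theorem type_other : D.type (D.other X) = D.type X := congrArg D.color (D.vertex_other X)

/-- The next triangle of the same type in the same ladder is the one across the ladderpole from
`D.other X`. -/
theorem exists_up_pow_eq [Finite T] : ∃ k : ℕ, 0 < k ∧ (D.up ^ k) X = D.pass (D.other X) ∧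
    ∀ i, 0 < i → i < k → D.type ((D.up ^ i) X) ≠ D.type X := by
  classical
  set e := D.type X with he
  have hex : ∃ k : ℕ, 0 < k ∧ D.type ((D.up ^ k) X) = e := by
    obtain ⟨i, hi⟩ := D.exists_type_eq (D.up X) e
    exact ⟨i + 1, i.succ_pos, by rwa [pow_succ]⟩
  obtain ⟨hk, hke⟩ := Nat.find_spec hex
  set k := Nat.find hex
  have hmin : ∀ i, 0 < i → i < k → D.type ((D.up ^ i) X) ≠ e := fun i hi hik h =>
    Nat.find_min hex hik ⟨hi, h⟩
  have htop : ∀ i < k, D.topCorner ((D.up ^ i) X) e =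
      if i = 0 then D.wideCorner X else D.thinCorner e ((D.up ^ i) X) := fun i hi => by
    split
    · subst i; exact D.topCorner_of_type_eq he.symm
    · exact D.topCorner_of_type_ne (hmin i (by omega) hi)
  have hup : ∀ i, (D.up ^ (i + 1)) X = D.up ((D.up ^ i) X) := fun i => by rw [pow_succ']; rfl
  -- Climbing the ladder turns around the vertex of the wide corner of `X`: all triangles up to the
  -- next one of the same type have a corner there.
  have hv : ∀ i < k, τ.vertex (D.thinCorner e ((D.up ^ (i + 1)) X)) =
      τ.vertex (D.wideCorner X) := fun i => by
    induction i with
    | zero => intro h; rw [hup, vertex_thinCorner_up, htop 0 h, if_pos rfl]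
    | succ i ih =>
      intro h
      rw [hup, vertex_thinCorner_up, htop _ h, if_neg i.succ_ne_zero, ih (by omega)]
  have hvk : τ.vertex (D.wideCorner (D.pass ((D.up ^ k) X))) = τ.vertex (D.wideCorner X) := by
    rw [D.vertex_wideCorner_pass hke]
    obtain ⟨j, hj⟩ : ∃ j, k = j + 1 := ⟨k - 1, by omega⟩
    rw [hj]; exact hv j (by omega)
  refine ⟨k, hk, ?_, hmin⟩
  rcases D.vertex_wideCorner_eq_iff.1 hvk with h | h
  · exfalso
    -- If crossing the ladderpole led back to `X`, the fan of corners just described would be the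
    -- whole star of the vertex and would contain only one wide corner.
    have := mem_of_vertex_eq (τ := τ) e (A := {c | c = D.wideCorner X ∨
        ∃ i : ℕ, 0 < i ∧ i ≤ k ∧ c = D.thinCorner e ((D.up ^ i) X)})
      (by rintro _ (rfl | ⟨i, hi, hik, rfl⟩)
          · refine .inr ⟨1, one_pos, hk, ?_⟩
            rw [← D.topCorner_of_type_eq he.symm, turnUp_topCorner]; simp
          · rcases hik.lt_or_eq with hik | rfl
            · refine .inr ⟨i + 1, i.succ_pos, hik, ?_⟩
              rw [← D.topCorner_of_type_ne (hmin i hi hik), turnUp_topCorner, hup]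
            · left
              rw [D.turnUp_thinCorner_of_type_eq hke, h])
      (c := D.wideCorner X) (d := D.wideCorner (D.other X)) (.inl rfl) (D.vertex_other X).symm
    rcases this with h' | ⟨i, -, -, h'⟩
    · exact D.other_ne X (by simpa using congrArg Corner.triangle h')
    · exact D.thinCorner_ne_wideCorner _ _ _ h'.symm
  · rw [← h, pass_pass]

/-! ### Ladders -/

/-- The set of ladders. -/
def Ladder : Type _ := Quotient (Equiv.Perm.SameCycle.setoid D.up)

/-- The ladder of a triangle. -/
def ladder : D.Ladder := Quotient.mk _ X

variable {X Y} in
theorem ladder_eq_iff : D.ladder X = D.ladder Y ↔ D.up.SameCycle X Y := Quotient.eq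

@[simp] theorem ladder_up : D.ladder (D.up X) = D.ladder X :=
  (D.ladder_eq_iff.2 ⟨1, by simp⟩).symm

@[simp] theorem ladder_up_symm : D.ladder (D.up.symm X) = D.ladder X := by
  rw [← ladder_up, Equiv.apply_symm_apply]

@[simp] theorem ladder_up_pow (i : ℕ) : D.ladder ((D.up ^ i) X) = D.ladder X :=
  (D.ladder_eq_iff.2 ⟨i, by simp⟩).symm

variable [Finite T]

theorem ladder_pass_other : D.ladder (D.pass (D.other X)) = D.ladder X := by
  obtain ⟨k, -, hk, -⟩ := D.exists_up_pow_eq X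
  rw [← hk, ladder_up_pow]

theorem ladder_other : D.ladder (D.other X) = D.ladder (D.pass X) := by
  rw [← D.ladder_pass_other (D.other X), other_other]

variable {X Y} in
theorem exists_up_pow_of_ladder_eq (h : D.ladder X = D.ladder Y) : ∃ i : ℕ, (D.up ^ i) X = Y := by
  obtain ⟨i, _, hi⟩ := (D.ladder_eq_iff.1 h).exists_pow_eq'
  exact ⟨i, hi⟩

variable {X Y} in
/-- Triangles of the same type in a ladder are related by the passage to the next one. -/
theorem exists_iterate_of_ladder_eq (h : D.ladder X = D.ladder Y) (ht : D.type X = D.type Y) :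
    ∃ j : ℕ, (fun Z => D.pass (D.other Z))^[j] X = Y := by
  obtain ⟨i, hi⟩ := D.exists_up_pow_of_ladder_eq h
  clear h
  induction i using Nat.strong_induction_on generalizing X with
  | _ i ih =>
    rcases Nat.eq_zero_or_pos i with rfl | hpos
    · exact ⟨0, hi⟩
    · obtain ⟨k, hk, hkX, hmin⟩ := D.exists_up_pow_eq X
      have hki : k ≤ i := by
        by_contra! hlt
        exact hmin i hpos hlt (by rw [hi, ht])
      obtain ⟨j, hj⟩ := ih (i - k) (by omega) (X := D.pass (D.other X)) (by simp [ht])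
        (by rw [← hkX, ← Equiv.Perm.mul_apply, ← pow_add, Nat.sub_add_cancel hki, hi])
      exact ⟨j + 1, by rw [Function.iterate_succ_apply]; exact hj⟩

variable {X Y} in
theorem ladder_pass_eq (h : D.ladder X = D.ladder Y) (ht : D.type X = D.type Y) :
    D.ladder (D.pass X) = D.ladder (D.pass Y) := by
  obtain ⟨j, rfl⟩ := D.exists_iterate_of_ladder_eq h ht
  clear h ht
  induction j generalizing X with
  | zero => rfl
  | succ j ih =>
    rw [Function.iterate_succ_apply, ← ih, pass_pass, ladder_other]

/-- Triangles of one type in a ladder form an orbit of `pass ∘ other`. A two-colouring flipped by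
both involutions is constant on such orbits, but separates `X` from `D.pass X`. -/
theorem ladder_pass_ne : D.ladder (D.pass X) ≠ D.ladder X := by
  intro h
  obtain ⟨s, hs⟩ := exists_bool_coloring D.pass_pass D.other_other D.pass_ne D.other_ne
  obtain ⟨j, hj⟩ := D.exists_iterate_of_ladder_eq h (D.type_pass X)
  have hinv : ∀ j X, s ((fun Z => D.pass (D.other Z))^[j] X) = s X := fun j => by
    induction j with
    | zero => exact fun _ => rfl
    | succ j ih => intro X; rw [Function.iterate_succ_apply, ih, (hs _).1, (hs _).2]; simp
  have := hinv j (D.pass X)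
  rw [hj, (hs X).1] at this
  simp at this

theorem exists_mem_ladder (O : D.Ladder) : ∃ X, D.ladder X = O ∧ D.type X = e := by
  induction O using Quotient.ind with | _ X
  obtain ⟨i, hi⟩ := D.exists_type_eq X e
  exact ⟨_, D.ladder_up_pow X i, hi⟩

/-- The ladder on the other side of the ladderpole that veers in the given direction. -/
noncomputable def neighbor (O : D.Ladder) : D.Ladder :=
  D.ladder (D.pass (D.exists_mem_ladder e O).choose)

variable {X e} in
theorem neighbor_ladder (h : D.type X = e) : D.neighbor e (D.ladder X) = D.ladder (D.pass X) := by
  obtain ⟨h₁, h₂⟩ := (D.exists_mem_ladder e (D.ladder X)).choose_spec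
  exact D.ladder_pass_eq h₁ (h₂.trans h.symm)

theorem neighbor_neighbor (O : D.Ladder) : D.neighbor e (D.neighbor e O) = O := by
  obtain ⟨X, rfl, h⟩ := D.exists_mem_ladder e O
  rw [D.neighbor_ladder h, D.neighbor_ladder ((D.type_pass X).trans h), pass_pass]

theorem neighbor_ne (O : D.Ladder) : D.neighbor e O ≠ O := by
  obtain ⟨X, rfl, h⟩ := D.exists_mem_ladder e O
  rw [D.neighbor_ladder h]
  exact D.ladder_pass_ne X

/-- The ladders can be directed so that adjacent ones run in opposite directions. -/
theorem exists_ladder_sign : ∃ s : D.Ladder → Bool, ∀ X, s (D.ladder (D.pass X)) = !s (D.ladder X) := by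
  obtain ⟨s, hs⟩ := exists_bool_coloring (D.neighbor_neighbor true) (D.neighbor_neighbor false)
    (D.neighbor_ne true) (D.neighbor_ne false)
  refine ⟨s, fun X => ?_⟩
  rw [← D.neighbor_ladder rfl]
  cases D.type X
  exacts [(hs _).2, (hs _).1]

end VeeringColoring

end OrientedGluing

/-! ### Flows on ladders -/

theorem exists_first {p : ℕ → Prop} (h : ∃ i, p i) : ∃ i, p i ∧ ∀ j < i, ¬ p j := by
  classical
  exact ⟨Nat.find h, Nat.find_spec h, fun _ => Nat.find_min h⟩

/-- On the cycles of a permutation, with one source `a` and one sink `b` on each, there is a flow of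
values `1` and `2`. -/
theorem exists_alternating {S Q : Type*} (N : Equiv.Perm S) (L : S → Q)
    (hL : ∀ x, L (N x) = L x) (htrans : ∀ x y, L x = L y → ∃ i : ℕ, (N ^ i) x = y)
    (a b : Q → S) (ha : ∀ q, L (a q) = q) (hb : ∀ q, L (b q) = q) (hab : ∀ q, a q ≠ b q) :
    ∃ f : S → ℤ, (∀ x, f x = 1 ∨ f x = 2) ∧ ∀ x, (N x = a (L x) → f (N x) = f x + 1) ∧
      (N x = b (L x) → f (N x) = f x - 1) ∧
      (N x ≠ a (L x) → N x ≠ b (L x) → f (N x) = f x) := by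
  classical
  have hM : ∀ i x, L (N.symm^[i] x) = L x := fun i => by
    induction i with
    | zero => exact fun _ => rfl
    | succ i ih => intro x; rw [Function.iterate_succ_apply, ih, ← hL, Equiv.apply_symm_apply]
  have hback : ∀ x y, L x = L y → ∃ i : ℕ, N.symm^[i] x = y := fun x y h => by
    obtain ⟨i, rfl⟩ := htrans y x h.symm
    refine ⟨i, ?_⟩
    rw [← Equiv.Perm.iterate_eq_pow]
    exact N.leftInverse_symm.iterate i y
  have hex : ∀ x, ∃ i, (N.symm^[i] x = a (L x) ∨ N.symm^[i] x = b (L x)) ∧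
      ∀ j < i, ¬ (N.symm^[j] x = a (L x) ∨ N.symm^[j] x = b (L x)) := fun x => by
    obtain ⟨i, hi⟩ := hback x (a (L x)) (ha _).symm
    exact exists_first ⟨i, .inl hi⟩
  choose i hi hmin using hex
  have huniq : ∀ x k, (N.symm^[k] x = a (L x) ∨ N.symm^[k] x = b (L x)) →
      (∀ j < k, ¬ (N.symm^[j] x = a (L x) ∨ N.symm^[j] x = b (L x))) → i x = k := by
    intro x k hk hk'
    by_contra hne
    rcases lt_or_gt_of_ne hne with h | h
    · exact hk' _ h (hi x)
    · exact hmin x _ h hk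
  -- Going back from just before `c`, the first marked element cannot be `c` again, since `d` lies
  -- on the same cycle. So sources and sinks are met alternately.
  have hkey : ∀ x c d, L c = L d → c ≠ d → N x = c →
      (∀ j < i x, N.symm^[j] x ≠ d) → N.symm^[i x] x ≠ c := by
    rintro x _ d hcd hne rfl hj h
    obtain ⟨m, hm⟩ := hback _ _ hcd
    have hper : Function.IsPeriodicPt N.symm (i x + 1) (N x) := by
      change N.symm^[i x + 1] (N x) = N x
      rwa [Function.iterate_succ_apply, Equiv.symm_apply_apply]
    rw [← hper.iterate_mod_apply] at hm
    have hlt := Nat.mod_lt m (i x).succ_pos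
    rcases hr : m % (i x + 1) with _ | r
    · rw [hr] at hm; exact hne hm
    · rw [hr, Function.iterate_succ_apply, Equiv.symm_apply_apply] at hm
      refine hj r ?_ hm
      have : m % (i x + 1) < i x + 1 := hlt
      omega
  -- The flow is 2 if the last marked element up to `x` is the source, and 1 if it is the sink.
  refine ⟨fun x => if N.symm^[i x] x = a (L x) then 2 else 1, fun x => ?_, fun x => ⟨fun h => ?_,
    fun h => ?_, fun h₁ h₂ => ?_⟩⟩
  · dsimp only; split <;> simp
  · have h₀ : i (N x) = 0 := huniq _ 0 (.inl (by rw [hL]; exact h)) (by simp)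
    have hx := hkey x (a (L x)) (b (L x)) (by rw [ha, hb]) (hab _) h
      (fun j hj hjx => hmin x j hj (.inr hjx))
    dsimp only; rw [h₀, hL, if_neg hx, Function.iterate_zero, id, if_pos h]; norm_num
  · have h₀ : i (N x) = 0 := huniq _ 0 (.inr (by rw [hL]; exact h)) (by simp)
    have hx := hkey x (b (L x)) (a (L x)) (by rw [ha, hb]) (hab _).symm h
      (fun j hj hjx => hmin x j hj (.inl hjx))
    have hx' := (hi x).resolve_right hx
    dsimp only
    rw [h₀, hL, if_pos hx', Function.iterate_zero, id, if_neg (h ▸ (hab _).symm)]; norm_num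
  · have hs : ∀ j, N.symm^[j + 1] (N x) = N.symm^[j] x := fun j => by
      rw [Function.iterate_succ_apply, Equiv.symm_apply_apply]
    have h₀ : i (N x) = i x + 1 := by
      refine huniq _ _ (by rw [hL, hs]; exact hi x) fun j hj => ?_
      rcases j with _ | j
      · rw [hL]; exact not_or.2 ⟨h₁, h₂⟩
      · rw [hL, hs]; exact hmin x j (by omega)
    simp only [h₀, hL, hs]

namespace OrientedGluing

variable {T : Type*} {τ : OrientedGluing T}

/-- A taut structure is given by the pairs of wide edges. -/
theorem IsTaut.exists_wide [Fintype T] {α : T → Fin 3 → ℝ} (h : τ.IsTaut α) :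
    ∃ w : T → Fin 3, ∀ t j, α t j = if j = w t then π else 0 := by
  have : ∀ t, ∃ k, ∀ j, α t j = if j = k then π else 0 := fun t => by
    have hsum := h.1.1 t
    rw [Fin.sum_univ_three] at hsum
    have hpi := Real.pi_pos
    rcases h.2 t 0 with h0 | h0 <;> rcases h.2 t 1 with h1 | h1 <;>
      rcases h.2 t 2 with h2 | h2 <;> rw [h0, h1, h2] at hsum
    all_goals first
      | (refine ⟨0, fun j => ?_⟩; fin_cases j <;> (simp [h0, h1, h2]; done))
      | (refine ⟨1, fun j => ?_⟩; fin_cases j <;> (simp [h0, h1, h2]; done))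
      | (refine ⟨2, fun j => ?_⟩; fin_cases j <;> (simp [h0, h1, h2]; done))
      | (exfalso; linarith)
  choose w hw using this
  exact ⟨w, hw⟩

/-- The thin corner after a wide one excludes right-veering, the one before it excludes
left-veering. Exactly two wide corners meet at a vertex because the angle sum is `2π`. The two ends
of an edge veer alike because `flip` preserves both the pair and the cyclic order of pairs. -/
theorem IsVeering.exists_coloring [Fintype T] {α : T → Fin 3 → ℝ} (h : τ.IsVeering α) :
    ∃ D : τ.VeeringColoring, (∀ t j, α t j = if j = D.wide t then π else 0) ∧
      ∀ s e, D.ends s = (e, e) → τ.IsLadderpoleSegment α s := by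
  classical
  obtain ⟨w, hw⟩ := h.1.exists_wide
  have hpi := Real.pi_pos
  have hang : ∀ c : Corner T, angleAt α c = if c.pair = w c.tet then π else 0 := fun c => hw _ _
  have hfin : ∀ j : Fin 3, j + 1 ≠ j ∧ j + 2 ≠ j := by decide
  have hnext : ∀ X : T × Fin 4, angleAt α (Corner.ofPair X (w X.1)).next = 0 := fun X => by
    rw [hang, Corner.pair_next, Corner.pair_ofPair]
    exact if_neg (hfin _).1
  have hprev : ∀ X : T × Fin 4, angleAt α (Corner.ofPair X (w X.1)).prev = 0 := fun X => by
    rw [hang, Corner.pair_prev, Corner.pair_ofPair]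
    exact if_neg (hfin _).2
  have hflip : ∀ q, τ.IsLeftVeering α q → τ.IsLeftVeering α (τ.otherEnd q) := by
    intro q hq c hc hc0
    have h₁ : τ.vertex c.flip = q := by rw [← otherEnd_vertex, hc, otherEnd_otherEnd]
    have h₂ : angleAt α c.flip = 0 := by rw [hang, Corner.pair_flip] at *; exact hc0
    have h₃ := hq _ h₁ h₂
    rw [hang, Corner.pair_prev] at *
    rw [Corner.pair_flip] at h₃
    exact h₃
  refine ⟨⟨w, fun q => decide (τ.IsLeftVeering α q), fun X => ?_, fun X => ?_, fun q => ?_,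
    fun q => ?_⟩, hw, fun s e hs => ?_⟩
  · refine decide_eq_true ((h.2 _).resolve_right fun hr => ?_)
    have := hr _ rfl (hnext X)
    rw [Corner.next_next, hprev] at this
    exact hpi.ne this
  · refine decide_eq_false fun hl => ?_
    have := hl _ rfl (hprev X)
    rw [Corner.prev_prev, hnext] at this
    exact hpi.ne this
  · have hq := h.1.1.2 q
    simp only [hang] at hq
    rw [← Finset.sum_filter, Finset.sum_const, Finset.filter_filter, nsmul_eq_mul] at hq
    have hcard := mul_right_cancel₀ hpi.ne' hq
    have hcard' : Finset.card {c : Corner T | τ.vertex c = q ∧ c.pair = w c.tet} = 2 := by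
      exact_mod_cast hcard
    obtain ⟨a, b, hab, hS⟩ := Finset.card_eq_two.1 hcard'
    have hmem : ∀ c : Corner T, (τ.vertex c = q ∧ c.pair = w c.tet) ↔ c = a ∨ c = b := fun c => by
      have := Finset.ext_iff.1 hS c
      simpa using this
    have ha := (hmem a).2 (.inl rfl)
    have hb := (hmem b).2 (.inr rfl)
    have ha' : Corner.ofPair a.triangle (w a.triangle.1) = a := by
      conv_rhs => rw [← a.ofPair_pair, ha.2]
      rfl
    have hb' : Corner.ofPair b.triangle (w b.triangle.1) = b := by
      conv_rhs => rw [← b.ofPair_pair, hb.2]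
      rfl
    refine ⟨a.triangle, b.triangle, fun hne => hab (by rw [← ha', ← hb', hne]), fun Z => ?_⟩
    have := hmem (Corner.ofPair Z (w Z.1))
    rw [Corner.pair_ofPair] at this
    constructor
    · intro hZ
      rcases this.1 ⟨hZ, rfl⟩ with h | h
      · exact .inl (by rw [← h]; rfl)
      · exact .inr (by rw [← h]; rfl)
    · rintro (rfl | rfl)
      · rw [ha']; exact ha.1
      · rw [hb']; exact hb.1
  · refine decide_eq_decide.2 ⟨fun hl => ?_, hflip q⟩
    have := hflip _ hl
    rwa [otherEnd_otherEnd] at this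
  · have h₁ := congrArg Prod.fst hs
    have h₂ := congrArg Prod.snd hs
    simp only [VeeringColoring.ends] at h₁ h₂
    cases e
    · exact .inr ⟨(h.2 _).resolve_left (of_decide_eq_false h₁),
        (h.2 _).resolve_left (of_decide_eq_false h₂)⟩
    · exact .inl ⟨of_decide_eq_true h₁, of_decide_eq_true h₂⟩

theorem cusp_across (s : Corner T) : τ.cusp (τ.across s).triangle = τ.cusp s.triangle :=
  (Quot.sound ⟨s, rfl, rfl⟩ : τ.cusp s.triangle = _).symm

open Classical in
-- Cutting a cocycle down to one boundary component allows homologous curves to be located in the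
-- same cusp.
theorem IsCocycle.restrict {A : Type*} [AddCommGroup A] {z : Corner T → A} (hz : τ.IsCocycle z)
    (κ : τ.Cusp) : τ.IsCocycle fun c => if τ.cusp c.triangle = κ then z c else 0 where
  across s := by
    rw [cusp_across]
    split
    · exact hz.across s
    · simp
  sum_eq c := by
    by_cases h : τ.cusp c.triangle = κ
    · rw [if_pos h, if_pos (show τ.cusp c.next.triangle = κ from h),
        if_pos (show τ.cusp c.prev.triangle = κ from h), hz.sum_eq c]
    · rw [if_neg h, if_neg (show ¬ τ.cusp c.next.triangle = κ from h),
        if_neg (show ¬ τ.cusp c.prev.triangle = κ from h), add_zero, add_zero]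

theorem IsCocycle.map {A B : Type*} [AddCommGroup A] [AddCommGroup B] {z : Corner T → A}
    (hz : τ.IsCocycle z) (g : A →+ B) : τ.IsCocycle fun c => g (z c) where
  across s := by rw [hz.across, map_neg]
  sum_eq c := by rw [← map_add, ← map_add, hz.sum_eq, map_zero]

namespace VeeringColoring

variable (D : τ.VeeringColoring)

theorem sum_triangle {A : Type*} [AddCommMonoid A] (z : Corner T → A) (c : Corner T) :
    z c + z c.next + z c.prev =
      z (D.wideCorner c.triangle) + z (D.top c.triangle) + z (D.pole c.triangle) := by
  have hw : z (D.wideCorner c.triangle) + z (D.top c.triangle) + z (D.pole c.triangle) =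
      z (D.wideCorner c.triangle) + z (D.wideCorner c.triangle).next +
        z (D.wideCorner c.triangle).prev := by
    cases h : D.type c.triangle
    · simp only [top, pole, h, thinCorner_false, Bool.not_false, thinCorner_true]
      exact add_right_comm _ _ _
    · simp only [top, pole, h, thinCorner_false, Bool.not_true, thinCorner_true]
  rw [hw]
  rcases Corner.eq_or_eq_next_or_eq_prev (c := D.wideCorner c.triangle) (d := c) rfl with h | h | h
  · rw [← h]
  · generalize D.wideCorner c.triangle = w at h
    subst h
    simp only [Corner.next_next, Corner.next_prev]
    rw [add_comm, ← add_assoc]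
  · generalize D.wideCorner c.triangle = w at h
    subst h
    simp only [Corner.prev_prev, Corner.prev_next]
    rw [add_assoc, add_comm]

theorem top_ne_wideCorner (X : T × Fin 4) : D.top X ≠ D.wideCorner X :=
  D.thinCorner_ne_wideCorner _ _ _

theorem pole_ne_wideCorner (X : T × Fin 4) : D.pole X ≠ D.wideCorner X :=
  D.thinCorner_ne_wideCorner _ _ _

theorem thinCorner_inj {X : T × Fin 4} {e e' : Bool} (h : D.thinCorner e X = D.thinCorner e' X) :
    e = e' := by
  rw [← D.color_thinCorner X e, h, color_thinCorner]

theorem pole_ne_top (X : T × Fin 4) : D.pole X ≠ D.top X := fun h => by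
  have := D.thinCorner_inj h
  simp at this

open Classical in
/-- The function on the sides with the values `f` on the upper rungs and `p` on the ladderpole
segments that is antisymmetric along rungs. -/
noncomputable def rungFlow {A : Type*} [AddCommGroup A] (f p : T × Fin 4 → A) (c : Corner T) : A :=
  if c = D.wideCorner c.triangle then -f (D.up.symm c.triangle)
  else if c = D.top c.triangle then f c.triangle else p c.triangle

section rungFlow

variable {A : Type*} [AddCommGroup A] (f p : T × Fin 4 → A) (X : T × Fin 4)

@[simp] theorem rungFlow_wideCorner : D.rungFlow f p (D.wideCorner X) = -f (D.up.symm X) := by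
  simp [rungFlow]

@[simp] theorem rungFlow_top : D.rungFlow f p (D.top X) = f X := by
  simp [rungFlow, top_ne_wideCorner]

@[simp] theorem rungFlow_pole : D.rungFlow f p (D.pole X) = p X := by
  simp [rungFlow, pole_ne_wideCorner, pole_ne_top]

variable {f p} in
-- The condition on `f` is conservation: what comes in through the lower rung leaves through the
-- upper rung or through the ladderpole segment.
theorem isCocycle_rungFlow (hp : ∀ X, p (D.pass X) = -p X)
    (hf : ∀ X, f X + p X = f (D.up.symm X)) : τ.IsCocycle (D.rungFlow f p) where
  across s := by
    rcases D.corner_cases (c := s) rfl with h | h | h <;> rw [h]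
    · rw [across_wideCorner, rungFlow_top, rungFlow_wideCorner, neg_neg]
    · rw [across_top, rungFlow_wideCorner, rungFlow_top, Equiv.symm_apply_apply]
    · rw [across_pole, rungFlow_pole, rungFlow_pole, hp]
  sum_eq c := by
    rw [D.sum_triangle, rungFlow_wideCorner, rungFlow_top, rungFlow_pole, ← hf]; abel

end rungFlow

/-- Directions of the ladders, opposite for adjacent ones, and a hinge in each ladder, at which a
transversal enters it. -/
structure Transversal where
  sign : D.Ladder → Bool
  sign_pass : ∀ X, sign (D.ladder (D.pass X)) = !sign (D.ladder X)
  hinge : D.Ladder → T × Fin 4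
  ladder_hinge : ∀ O, D.ladder (hinge O) = O
  type_hinge : ∀ O, D.type (hinge O) = sign O
  type_down_hinge : ∀ O, D.type (D.up.symm (hinge O)) = !sign O

variable {D}

/-- Both types occur in each ladder, so on the way up there is a change from type `!s O` to type `s
O`; the hinge is the triangle just after it. -/
theorem exists_transversal [Finite T] (s : D.Ladder → Bool)
    (hs : ∀ X, s (D.ladder (D.pass X)) = !s (D.ladder X)) : ∃ R : D.Transversal, R.sign = s := by
  have : ∀ O, ∃ X, D.ladder X = O ∧ D.type X = s O ∧ D.type (D.up.symm X) = !s O := fun O => by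
    obtain ⟨Y, rfl, hY⟩ := D.exists_mem_ladder (!s O) O
    obtain ⟨k, hk, hmin⟩ := exists_first (D.exists_type_eq Y (s (D.ladder Y)))
    obtain ⟨j, rfl⟩ : ∃ j, k = j + 1 := by
      refine ⟨k - 1, ?_⟩
      rcases k with _ | k
      · rw [pow_zero, Equiv.Perm.one_apply, hY] at hk; simp at hk
      · rfl
    refine ⟨_, D.ladder_up_pow Y (j + 1), hk, ?_⟩
    have := hmin j j.lt_succ_self
    rw [pow_succ', Equiv.Perm.mul_apply, Equiv.symm_apply_apply]
    exact Bool.eq_not_of_ne this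
  choose X h₁ h₂ h₃ using this
  exact ⟨⟨s, hs, X, h₁, h₂, h₃⟩, rfl⟩

namespace Transversal

variable (R : D.Transversal) (X : T × Fin 4)

/-- The triangle at which the transversal leaves a ladder. -/
noncomputable def exit [Finite T] (O : D.Ladder) : T × Fin 4 :=
  D.pass (R.hinge (D.neighbor (!R.sign O) O))

theorem sign_neighbor [Finite T] (e : Bool) (O : D.Ladder) :
    R.sign (D.neighbor e O) = !R.sign O := by
  obtain ⟨X, rfl, h⟩ := D.exists_mem_ladder e O
  rw [D.neighbor_ladder h, R.sign_pass]

theorem type_exit [Finite T] (O : D.Ladder) : D.type (R.exit O) = !R.sign O := by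
  rw [exit, type_pass, R.type_hinge, R.sign_neighbor]

theorem ladder_exit [Finite T] (O : D.Ladder) : D.ladder (R.exit O) = O := by
  have h : D.type (R.hinge (D.neighbor (!R.sign O) O)) = !R.sign O := by
    rw [R.type_hinge, R.sign_neighbor]
  rw [exit, ← D.neighbor_ladder h, R.ladder_hinge, neighbor_neighbor]

theorem hinge_ne_exit [Finite T] (O : D.Ladder) : R.hinge O ≠ R.exit O := fun h => by
  have := congrArg D.type h
  rw [R.type_hinge, R.type_exit] at this
  simp at this

/-- The transversal enters its ladder at this triangle. -/
def IsEntry : Prop := X = R.hinge (D.ladder X)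

theorem isEntry_pass_iff [Finite T] : R.IsEntry (D.pass X) ↔ X = R.exit (D.ladder X) := by
  constructor
  · intro h
    have ht : D.type X = !R.sign (D.ladder X) := by
      rw [← type_pass, h, R.type_hinge, R.sign_pass]
    rw [exit, ← ht, D.neighbor_ladder rfl, ← h, pass_pass]
  · intro h
    have : D.pass X = R.hinge (D.neighbor (!R.sign (D.ladder X)) (D.ladder X)) := by
      conv_lhs => rw [h, exit, pass_pass]
    rw [IsEntry, this, R.ladder_hinge]

open Classical in
/-- The number of times that the transversal leaves a triangle through its ladderpole segment. -/
noncomputable def crossing : ℤ :=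
  (if R.IsEntry (D.pass X) then 1 else 0) - (if R.IsEntry X then 1 else 0)

theorem crossing_pass : R.crossing (D.pass X) = -R.crossing X := by
  rw [crossing, crossing, D.pass_pass X, neg_sub]

theorem neg_one_le_crossing : -1 ≤ R.crossing X := by
  unfold crossing; split_ifs <;> simp

theorem crossing_nonneg (h : ¬ R.IsEntry X) : 0 ≤ R.crossing X := by
  unfold crossing; rw [if_neg h]; split_ifs <;> simp

/-- Conservation makes the flow along a ladder rise by 1 at the hinge and drop by 1 at the exit. The
added copy of the core makes all values positive, which the nonnegativity of the thin angles needs.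
-/
theorem exists_rungs [Finite T] : ∃ f : T × Fin 4 → ℤ, (∀ X, f X = 1 ∨ f X = 2) ∧
    ∀ X, f X + R.crossing X = f (D.up.symm X) := by
  obtain ⟨f, hf, h⟩ := exists_alternating D.up D.ladder D.ladder_up
    (fun _ _ => D.exists_up_pow_of_ladder_eq) R.hinge R.exit R.ladder_hinge R.ladder_exit
    R.hinge_ne_exit
  refine ⟨f, hf, fun X => ?_⟩
  have hX := h (D.up.symm X)
  rw [Equiv.apply_symm_apply, ladder_up_symm] at hX
  by_cases h₁ : X = R.hinge (D.ladder X)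
  · have h₂ : X ≠ R.exit (D.ladder X) := fun h => R.hinge_ne_exit _ (h₁.symm.trans h)
    rw [crossing, isEntry_pass_iff, IsEntry, if_neg h₂, if_pos h₁, hX.1 h₁]; ring
  · by_cases h₂ : X = R.exit (D.ladder X)
    · rw [crossing, isEntry_pass_iff, IsEntry, if_pos h₂, if_neg h₁, hX.2.1 h₂]; ring
    · rw [crossing, isEntry_pass_iff, IsEntry, if_neg h₂, if_neg h₁, hX.2.2 h₁ h₂]; ring

/-- The number of times that the transversal leaves a triangle through its upper rung, where it
contains one copy of the core of each ladder. -/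
noncomputable def rungs [Finite T] : T × Fin 4 → ℤ := R.exists_rungs.choose

theorem rungs_eq [Finite T] : R.rungs X = 1 ∨ R.rungs X = 2 := R.exists_rungs.choose_spec.1 X

theorem rungs_add_crossing [Finite T] : R.rungs X + R.crossing X = R.rungs (D.up.symm X) :=
  R.exists_rungs.choose_spec.2 X

/-- The intersection numbers of the sides with the transversal. -/
noncomputable def flow [Finite T] : Corner T → ℤ := D.rungFlow R.rungs R.crossing

theorem isCocycle_flow [Finite T] : τ.IsCocycle R.flow :=
  D.isCocycle_rungFlow R.crossing_pass fun X => R.rungs_add_crossing X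

@[simp] theorem flow_pole [Finite T] : R.flow (D.pole X) = R.crossing X := D.rungFlow_pole _ _ _
@[simp] theorem flow_top [Finite T] : R.flow (D.top X) = R.rungs X := D.rungFlow_top _ _ _
@[simp] theorem flow_wideCorner [Finite T] :
    R.flow (D.wideCorner X) = -R.rungs (D.up.symm X) := D.rungFlow_wideCorner _ _ _

end Transversal

/-! ### Hinges and nonnegativity -/

variable (D)

theorem wideCorner_flip (X : T × Fin 4) :
    D.wideCorner (X.1, (D.wideCorner X).label) = (D.wideCorner X).flip := by
  have h : (D.wideCorner X).flip.pair = D.wide X.1 := by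
    rw [Corner.pair_flip]; exact Corner.pair_ofPair _ _
  rw [← (D.wideCorner X).flip.ofPair_pair, h]; rfl

theorem wideCorner_opp (X : T × Fin 4) :
    D.wideCorner (X.1, (D.wideCorner X).next.label) = (D.wideCorner X).opp := by
  have h : (D.wideCorner X).opp.pair = D.wide X.1 := by
    rw [Corner.pair_opp]; exact Corner.pair_ofPair _ _
  rw [← (D.wideCorner X).opp.ofPair_pair, h]; rfl

theorem wideCorner_opp_flip (X : T × Fin 4) :
    D.wideCorner (X.1, (D.wideCorner X).prev.label) = (D.wideCorner X).opp.flip := by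
  have h : (D.wideCorner X).opp.flip.pair = D.wide X.1 := by
    rw [Corner.pair_flip, Corner.pair_opp]; exact Corner.pair_ofPair _ _
  rw [← (D.wideCorner X).opp.flip.ofPair_pair, h]; rfl

theorem type_flip (X : T × Fin 4) : D.type (X.1, (D.wideCorner X).label) = D.type X := by
  rw [type, wideCorner_flip, ← otherEnd_vertex, D.color_otherEnd]; rfl

theorem type_opp_flip (X : T × Fin 4) : D.type (X.1, (D.wideCorner X).prev.label) =
    D.type (X.1, (D.wideCorner X).next.label) := by
  rw [type, wideCorner_opp_flip, ← otherEnd_vertex, D.color_otherEnd, ← wideCorner_opp]; rfl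

theorem pair_thinCorner (e : Bool) (X : T × Fin 4) :
    (D.thinCorner e X).pair = D.wide X.1 + if e then 1 else 2 := by
  cases e
  · exact (Corner.pair_prev _).trans (by rw [wideCorner, Corner.pair_ofPair]; rfl)
  · exact (Corner.pair_next _).trans (by rw [wideCorner, Corner.pair_ofPair]; rfl)

theorem ofPair_eq_thinCorner (e : Bool) (X : T × Fin 4) :
    Corner.ofPair X (D.wide X.1 + if e then 1 else 2) = D.thinCorner e X := by
  rw [← pair_thinCorner]
  conv_rhs => rw [← (D.thinCorner e X).ofPair_pair, triangle_thinCorner]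

/-- The type of the triangle below is the direction in which the opposite wide edge veers. -/
theorem type_down (X : T × Fin 4) :
    D.type (D.up.symm X) = D.type (X.1, (D.wideCorner X).prev.label) := by
  set c := D.wideCorner X with hc
  set Y := D.up.symm X with hY
  have hacross : τ.across c = D.thinCorner (D.type Y) Y := D.across_wideCorner X
  have hopp : c.opp.flip.opp.flip = c := by
    have h := Corner.ccw_opp c.tip c.label c.2.2
    have h₁ := c.opp.label_next_flip
    have h₂ := c.opp.label_prev_flip
    exact Corner.eq_of_labels rfl (h₂.trans h.1) (h₁.trans h.2)
  -- Turning around the opposite wide edge through the face below `X` leads to the tetrahedron of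
  -- `Y`, to a corner in the pair of the upper rung of `Y`. That pair is thin and its position
  -- relative to the wide pair determines the colour.
  have hpair : (τ.rotate c.opp.flip).pair = (D.thinCorner (D.type Y) Y).pair := by
    rw [← Corner.pair_opp, opp_rotate, hopp, hacross]
  have htet : (τ.rotate c.opp.flip).tet = Y.1 := by
    have h₁ : (τ.rotate c.opp.flip).opp = τ.across c := by rw [opp_rotate, hopp]
    have h₂ : (τ.rotate c.opp.flip).opp.tet = (τ.across c).tet := by rw [h₁]
    have h₃ := congrArg Prod.fst (D.triangle_thinCorner Y (D.type Y))
    exact (h₂.trans (by rw [hacross]; rfl)).trans h₃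
  have hrot : τ.rotate c.opp.flip =
      D.thinCorner (D.type Y) (τ.rotate c.opp.flip).triangle := by
    conv_lhs => rw [← (τ.rotate c.opp.flip).ofPair_pair, hpair, pair_thinCorner, ← htet]
    exact D.ofPair_eq_thinCorner _ _
  have hv := congrArg (fun d => D.color (τ.vertex d)) hrot
  simp only [color_thinCorner, vertex_rotate] at hv
  rw [type, type, wideCorner_opp_flip, ← hc]
  exact hv.symm

theorem sum_types (X : T × Fin 4) (g : T × Fin 4 → ℤ) : ∑ v, g (X.1, v) = g X +
    g (X.1, (D.wideCorner X).label) + g (X.1, (D.wideCorner X).next.label) +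
    g (X.1, (D.wideCorner X).prev.label) :=
  (D.wideCorner X).sum_labels fun v => g (X.1, v)

namespace Transversal

variable {D} (R : D.Transversal) [Finite T]

theorem deformation_flow_wide (t : T) : -8 ≤ deformation R.flow t (D.wide t) := by
  have h : ∀ v, -2 ≤ R.flow (Corner.ofPair (t, v) (D.wide t)) := fun v => by
    have := R.flow_wideCorner (t, v)
    rw [show Corner.ofPair (t, v) (D.wide t) = D.wideCorner (t, v) from rfl, this]
    rcases R.rungs_eq (D.up.symm (t, v)) with h | h <;> omega
  have := Finset.sum_le_sum fun v (_ : v ∈ (Finset.univ : Finset (Fin 4))) => h v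
  simpa [deformation] using this

/-- At a tip of type `e` the value is a rung, at least 1; at any other tip it is a crossing, at
least -1. Types agree at the two ends of each wide edge, so there are four, two or no tips of type
`e`. With two of them the signs balance; with none, all types agree and no triangle of the
tetrahedron is a hinge. -/
theorem deformation_flow_thin (t : T) (e : Bool) :
    0 ≤ deformation R.flow t (D.wide t + if e then 1 else 2) := by
  set g : T × Fin 4 → ℤ := fun X => R.flow (D.thinCorner e X) with hg
  have hdef : deformation R.flow t (D.wide t + if e then 1 else 2) = ∑ v, g (t, v) :=
    Finset.sum_congr rfl fun v _ => congrArg R.flow (D.ofPair_eq_thinCorner e (t, v))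
  have h₁ : ∀ X, D.type X = e → 1 ≤ g X := fun X h => by
    have : g X = R.rungs X := by rw [← R.flow_top, top, h]
    rcases R.rungs_eq X with h | h <;> rw [this, h]
    norm_num
  have h₂ : ∀ X, D.type X ≠ e → g X = R.crossing X := fun X h => by
    rw [← R.flow_pole, pole, ← Bool.eq_not_of_ne (Ne.symm h)]
  have h₃ : ∀ X, D.type X ≠ e → -1 ≤ g X := fun X h => by
    rw [h₂ X h]; exact R.neg_one_le_crossing X
  -- A negative crossing occurs only at a hinge, where the type differs from that of the triangle
  -- below, hence by `type_down` from that of the opposite wide edge.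
  have h₄ : ∀ X, D.type X ≠ e → D.type (X.1, (D.wideCorner X).prev.label) = D.type X → 0 ≤ g X :=
    fun X h h' => by
      rw [h₂ X h]
      refine R.crossing_nonneg X fun hX => ?_
      rw [← type_down] at h'
      have h₅ := R.type_hinge (D.ladder X)
      have h₆ := R.type_down_hinge (D.ladder X)
      rw [← hX] at h₅ h₆
      rw [h₅, h₆] at h'
      simp at h'
  set X₀ : T × Fin 4 := (t, 0)
  set c := D.wideCorner X₀ with hc
  rw [hdef, D.sum_types X₀]
  have e₁ := D.type_flip X₀
  have e₂ := D.type_opp_flip X₀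
  by_cases ha : D.type X₀ = e <;> by_cases hb : D.type (X₀.1, c.next.label) = e
  · linarith [h₁ _ ha, h₁ _ (e₁.trans ha), h₁ _ hb, h₁ _ (e₂.trans hb)]
  · linarith [h₁ _ ha, h₁ _ (e₁.trans ha), h₃ _ hb, h₃ (X₀.1, c.prev.label) (by rwa [e₂])]
  · linarith [h₃ _ ha, h₃ (X₀.1, c.label) (by rwa [e₁]), h₁ _ hb, h₁ _ (e₂.trans hb)]
  · have hsame : ∀ v, D.type (t, v) = D.type X₀ := fun v => by
      have hab : D.type (X₀.1, c.next.label) = D.type X₀ := by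
        cases h : D.type X₀ <;> cases h' : D.type (X₀.1, c.next.label) <;> cases e <;> simp_all
      rcases Corner.univ_labels c.tip c.label v c.2.2 with rfl | rfl | rfl | rfl
      · rfl
      · exact e₁
      · exact hab
      · exact e₂.trans hab
    have hall : ∀ v, 0 ≤ g (t, v) := fun v =>
      h₄ _ (by rw [hsame]; exact ha) (by rw [hsame v]; exact hsame _)
    linarith [hall 0, hall c.label, hall c.next.label, hall c.prev.label]

end Transversal

end VeeringColoring

end OrientedGluing

/-! ### Curves along ladders and the deformed angles -/

namespace OrientedGluing

variable {T : Type*} {τ : OrientedGluing T}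

namespace NormalCurve

variable (γ : τ.NormalCurve)

/-- The cusp triangle in which an arc lies. -/
def tri (i : Fin (γ.n + 1)) : T × Fin 4 := (γ.arc i).corner.triangle

theorem triangle_across_leave (i : Fin (γ.n + 1)) :
    (τ.across (γ.arc i).leave).triangle = γ.tri (i + 1) := by
  rw [← γ.closed, Arc.triangle_enter]; rfl

theorem liesIn_cusp (i : Fin (γ.n + 1)) : γ.LiesIn (τ.cusp (γ.tri i)) :=
  forall_of_succ ⟨i, rfl⟩ fun j hj => by
    rw [← hj]
    change τ.cusp (γ.tri (j + 1)) = _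
    rw [← triangle_across_leave, cusp_across, Arc.triangle_leave]

/-- The curve runs along a ladder, upwards for `true` and downwards for `false`. -/
structure RunsAlong (D : τ.VeeringColoring) (d : Bool) : Prop where
  corner : ∀ i, (γ.arc i).corner = D.pole (γ.tri i)
  left : ∀ i, (γ.arc i).left = (d != D.type (γ.tri i))
  succ : ∀ i, γ.tri (i + 1) = if d then D.up (γ.tri i) else D.up.symm (γ.tri i)
  injective : Function.Injective γ.tri

variable {γ} {D : τ.VeeringColoring}

theorem corner_of_rungs {a : Arc T} {d : Bool} {X : T × Fin 4} (hX : a.corner.triangle = X)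
    (he : a.enter = if d then D.wideCorner X else D.top X)
    (hl : a.leave = if d then D.top X else D.wideCorner X) :
    a.corner = D.pole X ∧ a.left = (d != D.type X) := by
  have hc : a.corner = D.pole X := by
    have h₁ : a.corner ≠ a.enter ∧ a.corner ≠ a.leave := by
      unfold Arc.enter Arc.leave
      split <;> exact ⟨by first | exact (Corner.prev_ne _).symm | exact (Corner.next_ne _).symm,
        by first | exact (Corner.prev_ne _).symm | exact (Corner.next_ne _).symm⟩
    rcases D.corner_cases hX with h | h | h
    · exfalso
      cases d
      · exact h₁.2 (h.trans hl.symm)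
      · exact h₁.1 (h.trans he.symm)
    · exfalso
      cases d
      · exact h₁.1 (h.trans he.symm)
      · exact h₁.2 (h.trans hl.symm)
    · exact h
  refine ⟨hc, ?_⟩
  have h₁ : a.left = true → a.corner.next = a.leave := fun h => (Arc.leave_of_left h).symm
  have h₂ : a.left = false → a.corner.prev = a.leave := fun h => (Arc.leave_of_right h).symm
  have hw := D.top_ne_wideCorner X
  have hnext : (D.pole X).next = if D.type X then D.wideCorner X else D.top X := by
    cases ht : D.type X <;> simp [VeeringColoring.pole, VeeringColoring.top, ht]
  have hprev : (D.pole X).prev = if D.type X then D.top X else D.wideCorner X := by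
    cases ht : D.type X <;> simp [VeeringColoring.pole, VeeringColoring.top, ht]
  rw [hc, hnext, hl] at h₁
  rw [hc, hprev, hl] at h₂
  cases ha : a.left <;> cases d <;> cases ht : D.type X <;> simp_all [Ne.symm hw]

/-- A curve that avoids ladderpole segments goes from rung to rung. It enters and leaves a triangle
through different rungs, so it never turns back, and its direction is constant. -/
theorem IsLadderCurve.exists_runsAlong {α : T → Fin 3 → ℝ}
    (hα : ∀ s e, D.ends s = (e, e) → τ.IsLadderpoleSegment α s) (h : γ.IsLadderCurve α) :
    ∃ d, γ.RunsAlong D d := by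
  have hleave : ∀ i, (γ.arc i).leave ≠ D.pole (γ.tri i) := fun i hi =>
    h.1 i (hα _ (D.type (γ.tri i)) (by rw [hi, D.ends_pole]))
  have hl : ∀ i, (γ.arc i).leave = D.wideCorner (γ.tri i) ∨ (γ.arc i).leave = D.top (γ.tri i) :=
    fun i => by
      rcases D.corner_cases (X := γ.tri i) (Arc.triangle_leave _) with h | h | h
      exacts [.inl h, .inr h, absurd h (hleave i)]
  have hup : ∀ i, (γ.arc i).leave = D.top (γ.tri i) → γ.tri (i + 1) = D.up (γ.tri i) ∧
      (γ.arc (i + 1)).enter = D.wideCorner (γ.tri (i + 1)) := fun i hi => by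
    have h₁ : γ.tri (i + 1) = D.up (γ.tri i) := by
      rw [← triangle_across_leave, hi, D.across_top]; rfl
    exact ⟨h₁, by rw [γ.closed, hi, D.across_top, h₁]⟩
  have hdown : ∀ i, (γ.arc i).leave = D.wideCorner (γ.tri i) →
      γ.tri (i + 1) = D.up.symm (γ.tri i) ∧
      (γ.arc (i + 1)).enter = D.top (γ.tri (i + 1)) := fun i hi => by
    have h₁ : γ.tri (i + 1) = D.up.symm (γ.tri i) := by
      rw [← triangle_across_leave, hi, D.across_wideCorner, D.triangle_top]
    exact ⟨h₁, by rw [γ.closed, hi, D.across_wideCorner, h₁]⟩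
  have hsucc : ∀ d : Bool, ∀ i, (γ.arc i).leave = (if d then D.top (γ.tri i)
      else D.wideCorner (γ.tri i)) → (γ.arc (i + 1)).leave = if d then D.top (γ.tri (i + 1))
      else D.wideCorner (γ.tri (i + 1)) := by
    intro d i hi
    have hne := (γ.arc (i + 1)).enter_ne_leave
    cases d
    · rw [(hdown i hi).2] at hne
      exact (hl (i + 1)).resolve_right hne.symm
    · rw [(hup i hi).2] at hne
      exact (hl (i + 1)).resolve_left hne.symm
  obtain ⟨d, hd⟩ : ∃ d : Bool, (γ.arc 0).leave = if d then D.top (γ.tri 0)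
      else D.wideCorner (γ.tri 0) := by
    rcases hl 0 with h | h
    exacts [⟨false, h⟩, ⟨true, h⟩]
  have hall := forall_of_succ (p := fun i => (γ.arc i).leave = if d then D.top (γ.tri i)
    else D.wideCorner (γ.tri i)) ⟨0, hd⟩ (hsucc d)
  have henter : ∀ i, (γ.arc i).enter = if d then D.wideCorner (γ.tri i) else D.top (γ.tri i) :=
    fun i => by
      have hi := hall (i - 1)
      rw [← sub_add_cancel i 1]
      cases d
      · exact (hdown _ hi).2
      · exact (hup _ hi).2
  refine ⟨d, fun i => (corner_of_rungs rfl (henter i) (hall i)).1,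
    fun i => (corner_of_rungs rfl (henter i) (hall i)).2, fun i => ?_, h.2⟩
  have hi := hall i
  cases d
  · exact (hdown _ hi).1
  · exact (hup _ hi).1

namespace RunsAlong

variable {d : Bool} (h : γ.RunsAlong D d)
include h

theorem signed (φ : Corner T → ℝ) (i : Fin (γ.n + 1)) : (γ.arc i).signed φ =
    if (d != D.type (γ.tri i)) then φ (D.pole (γ.tri i)) else -φ (D.pole (γ.tri i)) := by
  rw [Arc.signed, h.left, h.corner]

theorem ladder_eq (i j : Fin (γ.n + 1)) : D.ladder (γ.tri i) = D.ladder (γ.tri j) := by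
  refine forall_of_succ (p := fun i => D.ladder (γ.tri i) = D.ladder (γ.tri j)) ⟨j, rfl⟩
    (fun i hi => ?_) i
  rw [h.succ, ← hi]
  cases d
  · exact D.ladder_up_symm _
  · exact D.ladder_up _

theorem exists_tri_eq [Finite T] {X : T × Fin 4} (hX : D.ladder X = D.ladder (γ.tri 0)) :
    ∃ i, γ.tri i = X := by
  have hstep : ∀ k : ℕ, ∃ i, γ.tri i = (if d then D.up else D.up.symm)^[k] (γ.tri 0) := fun k => by
    induction k with
    | zero => exact ⟨0, rfl⟩
    | succ k ih =>
      obtain ⟨i, hi⟩ := ih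
      refine ⟨i + 1, ?_⟩
      rw [h.succ, Function.iterate_succ_apply', ← hi]
      cases d <;> rfl
  cases d
  · obtain ⟨k, hk⟩ := D.exists_up_pow_of_ladder_eq hX
    obtain ⟨i, hi⟩ := hstep k
    refine ⟨i, hi.trans ?_⟩
    rw [← hk, ← Equiv.Perm.iterate_eq_pow]
    exact D.up.leftInverse_symm.iterate k X
  · obtain ⟨k, hk⟩ := D.exists_up_pow_of_ladder_eq hX.symm
    obtain ⟨i, hi⟩ := hstep k
    refine ⟨i, hi.trans ?_⟩
    rw [← hk, ← Equiv.Perm.iterate_eq_pow]; rfl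

open Classical in
theorem sum_tri [Fintype T] (F : T × Fin 4 → ℝ) :
    ∑ i, F (γ.tri i) = ∑ X with D.ladder X = D.ladder (γ.tri 0), F X := by
  rw [← Finset.sum_image (s := Finset.univ) (g := γ.tri) (f := F) h.injective.injOn]
  refine Finset.sum_congr ?_ fun _ _ => rfl
  ext X
  simp only [Finset.mem_image, Finset.mem_univ, true_and, Finset.mem_filter]
  exact ⟨fun ⟨i, hi⟩ => hi ▸ h.ladder_eq i 0, h.exists_tri_eq⟩

/-- The transversal crosses a curve along a ladder once; with the Neumann--Zagier formula this
counts twice. -/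
theorem turn_flow [Fintype T] (R : D.Transversal) :
    γ.turn (fun c => (R.flow c : ℝ)) = if d = R.sign (D.ladder (γ.tri 0)) then 2 else -2 := by
  classical
  set O := D.ladder (γ.tri 0) with hO
  set F : T × Fin 4 → ℝ := fun X =>
    if (d != D.type X) then (R.crossing X : ℝ) else -(R.crossing X : ℝ) with hF
  have h₁ : γ.turn (fun c => (R.flow c : ℝ)) = ∑ X with D.ladder X = O, F X := by
    rw [← h.sum_tri]
    refine Finset.sum_congr rfl fun i _ => ?_
    rw [h.signed, R.flow_pole]
  -- Only the hinge and the exit contribute. They have opposite types, hence lie on opposite sides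
  -- of the curve, and opposite crossings, so their contributions add up.
  have h₂ : ∀ X ∈ ({X | D.ladder X = O} : Finset (T × Fin 4)), F X =
      (if X = R.exit O then (if (d != D.type (R.exit O)) then (1 : ℝ) else -1) else 0) -
      (if X = R.hinge O then (if (d != D.type (R.hinge O)) then (1 : ℝ) else -1) else 0) := by
    intro X hX
    have hX : D.ladder X = O := by simpa using hX
    have hc : R.crossing X = (if X = R.exit O then 1 else 0) - (if X = R.hinge O then 1 else 0) := by
      rw [VeeringColoring.Transversal.crossing, R.isEntry_pass_iff,
        VeeringColoring.Transversal.IsEntry, hX]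
      congr
    have hne := R.hinge_ne_exit O
    simp only [hF, hc]
    by_cases he : X = R.exit O
    · have hh : X ≠ R.hinge O := fun h => hne (h.symm.trans he)
      rw [if_pos he, if_neg hh, if_pos he, if_neg hh, ← he]; simp
    · by_cases hh : X = R.hinge O
      · rw [if_neg he, if_pos hh, if_neg he, if_pos hh, ← hh]
        split <;> simp
      · rw [if_neg he, if_neg hh, if_neg he, if_neg hh]; simp
  rw [h₁, Finset.sum_congr rfl h₂, Finset.sum_sub_distrib, Finset.sum_ite_eq', Finset.sum_ite_eq',
    if_pos (Finset.mem_filter.2 ⟨Finset.mem_univ (R.exit O), R.ladder_exit O⟩),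
    if_pos (Finset.mem_filter.2 ⟨Finset.mem_univ (R.hinge O), R.ladder_hinge O⟩), R.type_exit, R.type_hinge]
  cases d <;> cases R.sign O <;> norm_num

end RunsAlong

end NormalCurve

namespace VeeringColoring.Transversal

variable {D : τ.VeeringColoring} (R : D.Transversal)

/-- The angles obtained from a veering structure by a deformation along the transversal. -/
noncomputable def angles [Finite T] (α : T → Fin 3 → ℝ) (t : T) (j : Fin 3) : ℝ :=
  α t j + π / 8 * deformation (fun c => (R.flow c : ℝ)) t j

variable {R} {α : T → Fin 3 → ℝ}

theorem isCocycle_flow_real [Finite T] : τ.IsCocycle fun c => (R.flow c : ℝ) :=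
  R.isCocycle_flow.map (Int.castAddHom ℝ)

/-- The step `π / 8` is the largest one for which the lower bound -8 on wide pairs still guarantees
a nonnegative angle. -/
theorem isNonnegAngleStructure_angles [Fintype T] (hα : τ.IsGeneralizedAngleStructure α)
    (hD : ∀ t j, α t j = if j = D.wide t then π else 0) :
    τ.IsNonnegAngleStructure (R.angles α) := by
  classical
  have hz := R.isCocycle_flow_real
  refine ⟨⟨fun t => ?_, fun q => ?_⟩, fun t j => ?_⟩
  · simp only [angles, Finset.sum_add_distrib, ← Finset.mul_sum, hz.sum_deformation, hα.1]
    ring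
  · have h := hz.sum_vertex_deformation q
    have h' := hα.2 q
    have : ∀ c : Corner T, angleAt (R.angles α) c =
        angleAt α c + π / 8 * deformation (fun c => (R.flow c : ℝ)) c.tet c.pair := fun c => rfl
    simp only [this, Finset.sum_add_distrib, ← Finset.mul_sum]
    rw [h, h', mul_zero, add_zero]
  · have hcast : deformation (fun c => (R.flow c : ℝ)) t j = (deformation R.flow t j : ℤ) := by
      simp [deformation]
    have hpi := Real.pi_pos
    rw [angles, hD, hcast]
    have hj : ∀ j k : Fin 3, j = k ∨ j = k + 1 ∨ j = k + 2 := by decide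
    rcases hj j (D.wide t) with rfl | rfl | rfl
    · have h : (-8 : ℝ) ≤ (deformation R.flow t (D.wide t) : ℤ) := by
        exact_mod_cast R.deformation_flow_wide t
      rw [if_pos rfl]
      nlinarith
    · have h : (0 : ℝ) ≤ (deformation R.flow t (D.wide t + 1) : ℤ) := by
        exact_mod_cast R.deformation_flow_thin t true
      rw [if_neg (by simp)]
      positivity
    · have h : (0 : ℝ) ≤ (deformation R.flow t (D.wide t + 2) : ℤ) := by
        exact_mod_cast R.deformation_flow_thin t false
      rw [if_neg (by simp)]
      positivity

theorem turn_angles [Finite T] (γ : τ.NormalCurve) : γ.turningAngle (R.angles α) =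
    γ.turningAngle α + π / 8 * γ.turn fun c => (R.flow c : ℝ) := by
  have hz := R.isCocycle_flow_real
  rw [← γ.turn_deformation hz, NormalCurve.turningAngle_eq_turn, NormalCurve.turningAngle_eq_turn]
  have : ∀ c : Corner T, angleAt (R.angles α) c =
    angleAt α c + π / 8 * deformation (fun c => (R.flow c : ℝ)) c.tet c.pair := fun c => rfl
  simp only [NormalCurve.turn, Finset.mul_sum, ← Finset.sum_add_distrib]
  refine Finset.sum_congr rfl fun i _ => ?_
  unfold Arc.signed
  split
  · rfl
  · rw [this]; ring

end VeeringColoring.Transversal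

/-- A curve along a ladder is not homologous to a curve in another cusp. -/
theorem NormalCurve.RunsAlong.liesIn [Fintype T] {D : τ.VeeringColoring} (R : D.Transversal)
    {γ δ : τ.NormalCurve} {d : Bool} (hδ : δ.RunsAlong D d) (h : γ.Homologous δ) {κ : τ.Cusp}
    (hγ : γ.LiesIn κ) : δ.LiesIn κ := by
  classical
  have hδκ := δ.liesIn_cusp 0
  set κ' := τ.cusp (δ.tri 0) with hκ'
  by_contra hne
  have hκ : κ ≠ κ' := fun h => hne (h ▸ hδκ)
  -- The flow restricted to the cusp of `δ` has turning `±2` on `δ`, but 0 on a curve in another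
  -- cusp.
  have h₁ := (R.isCocycle_flow_real.restrict κ').turn_eq h
  have h₂ : γ.turn (fun c => if τ.cusp c.triangle = κ' then (R.flow c : ℝ) else 0) = 0 :=
    Finset.sum_eq_zero fun i _ => by
      have hi : τ.cusp (γ.arc i).corner.triangle ≠ κ' := by rw [hγ i]; exact hκ
      rw [Arc.signed, if_neg hi, neg_zero, ite_self]
  have h₃ : δ.turn (fun c => if τ.cusp c.triangle = κ' then (R.flow c : ℝ) else 0) =
      δ.turn fun c => (R.flow c : ℝ) :=
    Finset.sum_congr rfl fun i _ => by
      have hi : τ.cusp (δ.arc i).corner.triangle = κ' := hδκ i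
      rw [Arc.signed, if_pos hi]; rfl
  rw [h₂, h₃, hδ.turn_flow R] at h₁
  split at h₁ <;> norm_num at h₁

/-- Adjacent ladders lie in the same cusp, so an alternating choice of directions remains
alternating when it is reversed on whole cusps. This adapts the transversal to the given
orientations, independently in each torus. -/
theorem exists_transversal_of_runsAlong [Fintype T] (D : τ.VeeringColoring)
    (ℓ : τ.Cusp → τ.NormalCurve) (d : τ.Cusp → Bool) (hℓ : ∀ κ, (ℓ κ).RunsAlong D (d κ))
    (hcusp : ∀ κ, (ℓ κ).LiesIn κ) :
    ∃ R : D.Transversal, ∀ κ, (ℓ κ).turn (fun c => (R.flow c : ℝ)) = 2 := by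
  obtain ⟨s, hs⟩ := D.exists_ladder_sign
  have hlift : ∀ X Y, D.ladder X = D.ladder Y → τ.cusp X = τ.cusp Y := by
    intro X Y h
    obtain ⟨i, rfl⟩ := D.exists_up_pow_of_ladder_eq h
    clear h
    induction i with
    | zero => rfl
    | succ i ih =>
      rw [ih, pow_succ']
      have := τ.cusp_across (D.top ((D.up ^ i) X))
      rw [D.triangle_top] at this
      exact this.symm
  let κ : D.Ladder → τ.Cusp := Quotient.lift τ.cusp fun X Y h => hlift X Y (Quotient.sound h)
  have hκ : ∀ X, κ (D.ladder X) = τ.cusp X := fun _ => rfl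
  let r : τ.Cusp → Bool := fun k => s (D.ladder ((ℓ k).tri 0))
  -- The correction by `r` and `d` is constant on each cusp and makes the sign of the ladder of `ℓ
  -- k` equal to `d k`.
  set s' : D.Ladder → Bool := fun O => (s O ^^ r (κ O)) ^^ d (κ O) with hs'
  have hpass : ∀ X, κ (D.ladder (D.pass X)) = κ (D.ladder X) := fun X => by
    rw [hκ, hκ]
    have := τ.cusp_across (D.pole X)
    rw [D.triangle_pole] at this
    exact this
  obtain ⟨R, hR⟩ := VeeringColoring.exists_transversal s' fun X => by
    simp only [hs', hpass, hs]
    cases s (D.ladder X) <;> cases r (κ (D.ladder X)) <;> cases d (κ (D.ladder X)) <;> rfl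
  refine ⟨R, fun k => ?_⟩
  rw [(hℓ k).turn_flow R, if_pos]
  have hk : κ (D.ladder ((ℓ k).tri 0)) = k := hcusp k 0
  rw [hR]
  have hr : s (D.ladder ((ℓ k).tri 0)) = r k := rfl
  simp only [hs', hk, hr]
  cases r k <;> cases d k <;> rfl

end OrientedGluing

/-! ### A polygonal version of the Hopf Umlaufsatz -/

theorem Complex.arg_div_eq_sub_of_mem {a b : ℂ} (ha : a ≠ 0) (hb : b ≠ 0)
    (h : a.arg - b.arg ∈ Set.Ioc (-π) π) : (a / b).arg = a.arg - b.arg := by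
  have : ((a / b).arg : Real.Angle) = ((a.arg - b.arg : ℝ) : Real.Angle) := by
    rw [Complex.arg_div_coe_angle ha hb]; rfl
  rwa [← Complex.arg_coe_angle_toReal_eq_arg, this, Real.Angle.toReal_coe_eq_self_iff_mem_Ioc]

theorem Complex.arg_div_eq_sub {a b : ℂ} (ha : 0 < a.re) (hb : 0 < b.re) :
    (a / b).arg = a.arg - b.arg := by
  have h₁ := Complex.abs_arg_lt_pi_div_two_iff.2 (.inl ha)
  have h₂ := Complex.abs_arg_lt_pi_div_two_iff.2 (.inl hb)
  rw [abs_lt] at h₁ h₂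
  exact Complex.arg_div_eq_sub_of_mem (fun h => by simp [h] at ha) (fun h => by simp [h] at hb)
    ⟨by linarith, by linarith⟩

/-- The arguments of quotients of numbers in an open half plane are differences. -/
theorem Complex.exists_arg_div_eq_sub {S : Set ℂ} {c : ℂ} (hS : ∀ z ∈ S, 0 < (c * z).re) :
    ∃ φ : ℂ → ℝ, ∀ a ∈ S, ∀ b ∈ S, (a / b).arg = φ a - φ b := by
  refine ⟨fun z => (c * z).arg, fun a ha b hb => ?_⟩
  have hc : c ≠ 0 := fun h => by have := hS a ha; simp [h] at this
  rw [← Complex.arg_div_eq_sub (hS a ha) (hS b hb), mul_div_mul_left _ _ hc]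

/-- A finite set of numbers whose convex hull does not contain `0` lies in an open half plane. -/
theorem Complex.exists_half_plane {S : Set ℂ} (hS : S.Finite) (h : (0 : ℂ) ∉ convexHull ℝ S) :
    ∃ c : ℂ, ∀ z ∈ S, 0 < (c * z).re := by
  obtain ⟨f, u, hu, hf⟩ : ∃ (f : StrongDual ℝ ℂ) (u : ℝ), f 0 < u ∧
      ∀ b ∈ convexHull ℝ S, u < f b :=
    geometric_hahn_banach_point_closed (convex_convexHull ℝ S)
      (Set.Finite.isCompact_convexHull (𝕜 := ℝ) hS).isClosed h
  rw [map_zero] at hu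
  refine ⟨⟨f 1, -f Complex.I⟩, fun z hz => ?_⟩
  have h₁ : f z = z.re * f 1 + z.im * f Complex.I := by
    conv_lhs => rw [← Complex.re_add_im z, ← mul_one (z.re : ℂ)]
    rw [map_add, ← Complex.real_smul, ← Complex.real_smul, map_smul, map_smul]; rfl
  have h₂ := hf z (subset_convexHull ℝ S hz)
  rw [h₁] at h₂
  simp only [Complex.mul_re]
  linarith

open scoped Pointwise in
/-- The secants of two disjoint segments lie in an open half plane. -/
theorem exists_arg_secants {a b c d : ℂ} (h : Disjoint (segment ℝ a b) (segment ℝ c d)) :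
    ((c - b) / (c - a)).arg + ((d - b) / (c - b)).arg =
      ((d - a) / (c - a)).arg + ((d - b) / (d - a)).arg := by
  set S : Set ℂ := {c - a, c - b, d - a, d - b}
  have hsub : (segment ℝ c d - segment ℝ a b : Set ℂ) = convexHull ℝ S := by
    rw [← convexHull_pair, ← convexHull_pair, ← convexHull_sub]
    congr 1
    ext z
    simp only [Set.mem_sub, Set.mem_insert_iff, Set.mem_singleton_iff, S]
    constructor
    · rintro ⟨x, rfl | rfl, y, rfl | rfl, rfl⟩ <;> simp
    · rintro (rfl | rfl | rfl | rfl)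
      exacts [⟨c, by simp, a, by simp, rfl⟩, ⟨c, by simp, b, by simp, rfl⟩,
        ⟨d, by simp, a, by simp, rfl⟩, ⟨d, by simp, b, by simp, rfl⟩]
  have h0 : (0 : ℂ) ∉ convexHull ℝ S := by
    rw [← hsub]
    rintro ⟨x, hx, y, hy, hxy⟩
    exact Set.disjoint_left.1 h (sub_eq_zero.1 hxy ▸ hy) hx
  obtain ⟨w, hw⟩ := Complex.exists_half_plane (Set.toFinite S) h0
  obtain ⟨φ, hφ⟩ := Complex.exists_arg_div_eq_sub hw
  have m₁ : c - a ∈ S := by simp [S]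
  have m₂ : c - b ∈ S := by simp [S]
  have m₃ : d - a ∈ S := by simp [S]
  have m₄ : d - b ∈ S := by simp [S]
  rw [hφ _ m₂ _ m₁, hφ _ m₄ _ m₂, hφ _ m₃ _ m₁, hφ _ m₄ _ m₃]
  ring

/-- Two consecutive edges of a polygon. -/
theorem exists_arg_corner {v w : ℂ} (h : (w / v).arg ≠ π) (hv : v ≠ 0) (hw : w ≠ 0) :
    ((v + w) / v).arg + (w / (v + w)).arg = (w / v).arg := by
  have h0 : (0 : ℂ) ∉ convexHull ℝ {v, w} := by
    rw [convexHull_pair]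
    rintro ⟨s, t, hs, ht, hst, h0⟩
    have ht0 : t ≠ 0 := by
      rintro rfl
      simp only [add_zero] at hst
      subst hst
      simp [hv] at h0
    apply h
    rw [Complex.arg_eq_pi_iff]
    have hwv : w / v = ((-(s / t) : ℝ) : ℂ) := by
      rw [div_eq_iff hv]
      have ht0' : (t : ℂ) ≠ 0 := by exact_mod_cast ht0
      rw [Complex.real_smul, Complex.real_smul] at h0
      push_cast
      field_simp
      linear_combination h0
    have hs0 : s ≠ 0 := by
      rintro rfl
      simp at hwv
      tauto
    rw [hwv, Complex.ofReal_re, Complex.ofReal_im]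
    have : 0 < s / t := div_pos (lt_of_le_of_ne hs hs0.symm) (lt_of_le_of_ne ht ht0.symm)
    exact ⟨by linarith, rfl⟩
  obtain ⟨c, hc⟩ := Complex.exists_half_plane (Set.toFinite _) h0
  have hv' := hc v (by simp)
  have hw' := hc w (by simp)
  have hS : ∀ z ∈ ({v, w, v + w} : Set ℂ), 0 < (c * z).re := by
    rintro z (rfl | rfl | rfl)
    · exact hv'
    · exact hw'
    · rw [mul_add, Complex.add_re]; exact add_pos hv' hw'
  obtain ⟨φ, hφ⟩ := Complex.exists_arg_div_eq_sub hS
  rw [hφ _ (by simp) _ (by simp), hφ _ (by simp) _ (by simp), hφ _ (by simp) _ (by simp)]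
  ring

theorem sum_range_shift {n : ℕ} {f : ℕ → ℝ} (hf : ∀ i, f (i + n) = f i) :
    ∑ i ∈ Finset.range n, f (i + 1) = ∑ i ∈ Finset.range n, f i := by
  have h := (Finset.sum_range_succ f n).symm.trans (Finset.sum_range_succ' f n)
  have h0 := hf 0
  rw [zero_add] at h0
  rw [h0] at h
  exact (add_right_cancel h).symm

/-- The total turning of a simple periodic polygonal line is zero. -/
theorem sum_arg_eq_zero_of_simple {n : ℕ} (hn : 0 < n) {Z : ℕ → ℂ} {h : ℂ} (hh : h ≠ 0)
    (hZ : ∀ i, Z (i + n) = Z i + h) (hne : ∀ i, Z (i + 1) ≠ Z i)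
    (hturn : ∀ i, ((Z (i + 2) - Z (i + 1)) / (Z (i + 1) - Z i)).arg ≠ π)
    (hdis : ∀ i m, 2 ≤ m → m < n →
      Disjoint (segment ℝ (Z i) (Z (i + 1))) (segment ℝ (Z (i + m)) (Z (i + m + 1)))) :
    ∑ i ∈ Finset.range n, ((Z (i + 2) - Z (i + 1)) / (Z (i + 1) - Z i)).arg = 0 := by
  set w : ℕ → ℕ → ℂ := fun i m => Z (i + m) - Z i with hw
  have hper : ∀ i m, w (i + n) m = w i m := fun i m => by
    simp only [hw]
    rw [show i + n + m = i + m + n by ring, hZ, hZ]; ring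
  -- the two sums along staircases of secants
  set A : ℕ → ℝ := fun m => ∑ i ∈ Finset.range n, ((w (i + 1) m / w i (m + 1)).arg) with hA
  set B : ℕ → ℝ := fun m => ∑ i ∈ Finset.range n, ((w i (m + 1) / w i m).arg) with hB
  have hB' : ∀ m, B m = ∑ i ∈ Finset.range n, ((w (i + 1) (m + 1) / w (i + 1) m).arg) := fun m =>
    (sum_range_shift (f := fun i => (w i (m + 1) / w i m).arg) fun i => by
      rw [hper, hper]).symm
  have hone : ∑ i ∈ Finset.range n, ((Z (i + 2) - Z (i + 1)) / (Z (i + 1) - Z i)).arg =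
      A 1 + B 1 := by
    rw [hA, hB, ← Finset.sum_add_distrib]
    refine Finset.sum_congr rfl fun i _ => ?_
    have h := exists_arg_corner (hturn i) (sub_ne_zero.2 (hne i)) (sub_ne_zero.2 (hne (i + 1)))
    rw [← h, add_comm, show Z (i + 1) - Z i + (Z (i + 1 + 1) - Z (i + 1)) = Z (i + 2) - Z i by
      ring]
  -- Two adjacent staircases bound squares of secants between disjoint edges. The four secants of
  -- such a square lie in a half plane, where arguments are additive.
  have hstep : ∀ m, 1 ≤ m → m + 1 < n → A (m + 1) + B (m + 1) = A m + B m := by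
    intro m hm hmn
    rw [hB' m, hA, hB, ← Finset.sum_add_distrib, ← Finset.sum_add_distrib]
    refine Finset.sum_congr rfl fun i _ => ?_
    have h := exists_arg_secants (hdis i (m + 1) (by omega) hmn)
    have e₁ : w i (m + 1) = Z (i + (m + 1)) - Z i := rfl
    have e₂ : w i (m + 1 + 1) = Z (i + (m + 1) + 1) - Z i := rfl
    have e₃ : w (i + 1) m = Z (i + (m + 1)) - Z (i + 1) := by
      simp only [hw]; congr 2; ring
    have e₄ : w (i + 1) (m + 1) = Z (i + (m + 1) + 1) - Z (i + 1) := by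
      simp only [hw]; congr 2; ring
    rw [e₁, e₂, e₃, e₄, h, add_comm]
  have hwn : ∀ i, w i n = h := fun i => by simp only [hw]; rw [hZ]; ring
  rw [hone]
  obtain rfl | hn2 : n = 1 ∨ 2 ≤ n := by omega
  · rw [← hone]
    refine Finset.sum_eq_zero fun i _ => ?_
    have h₁ : Z (i + 2) - Z (i + 1) = h := by rw [hZ (i + 1)]; ring
    have h₂ : Z (i + 1) - Z i = h := by rw [hZ i]; ring
    rw [h₁, h₂, div_self hh, Complex.arg_one]
  · have hconst : ∀ m, 1 ≤ m → m < n → A m + B m = A 1 + B 1 := by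
      intro m hm
      induction m, hm using Nat.le_induction with
      | base => intro _; rfl
      | succ m hm ih => intro hmn; rw [hstep m hm hmn, ih (by omega)]
    obtain ⟨k, rfl⟩ : ∃ k, n = k + 1 := ⟨n - 1, by omega⟩
    -- On the last staircase every other secant is the period `h`, so the terms are arguments of
    -- mutually inverse numbers.
    rw [← hconst k (by omega) (by omega), hB', hA, ← Finset.sum_add_distrib]
    refine Finset.sum_eq_zero fun i _ => ?_
    rw [hwn, hwn]
    have hw' : w (i + 1) k = h - (Z (i + 1) - Z i) := by
      simp only [hw]; rw [show i + 1 + k = i + (k + 1) by ring, hZ]; ring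
    rw [← inv_div h, Complex.arg_inv, if_neg, neg_add_cancel]
    -- Arguments of inverse numbers are opposite unless they are `π`. In that case `Z i + h` would
    -- lie on the edge from `Z i` to `Z (i + 1)`: the line would turn back (`k = 1`) or meet itself.
    intro harg
    obtain ⟨hre, him⟩ := Complex.arg_eq_pi_iff.1 harg
    have hq : h = (((h / w (i + 1) k).re : ℝ) : ℂ) * w (i + 1) k := by
      have h0 : w (i + 1) k ≠ 0 := by rintro h0; simp [h0] at hre
      rw [← div_eq_iff h0]
      exact Complex.ext (by simp) (by simpa using him)
    set q := (h / w (i + 1) k).re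
    have hq1 : (q : ℂ) - 1 ≠ 0 := by
      intro h0
      have : q = 1 := by exact_mod_cast sub_eq_zero.1 h0
      linarith
    have hpt : h = ((q / (q - 1) : ℝ) : ℂ) * (Z (i + 1) - Z i) := by
      rw [hw'] at hq
      push_cast
      field_simp
      linear_combination -hq
    have hq01 : 0 < q / (q - 1) ∧ q / (q - 1) < 1 := by
      refine ⟨div_pos_of_neg_of_neg hre (by linarith), ?_⟩
      rw [div_lt_one_of_neg (by linarith)]; linarith
    set r := q / (q - 1)
    obtain rfl | hk : k = 1 ∨ 2 ≤ k := by omega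
    · apply hturn i
      have h₁ : Z (i + 2) - Z (i + 1) = ((r - 1 : ℝ) : ℂ) * (Z (i + 1) - Z i) := by
        rw [show i + 2 = i + (1 + 1) from rfl, hZ]
        push_cast
        linear_combination hpt
      rw [h₁, mul_div_assoc, div_self (sub_ne_zero.2 (hne i)), mul_one,
        Complex.arg_ofReal_of_neg (by linarith)]
    · have hmem : Z i + h ∈ segment ℝ (Z i) (Z (i + 1)) := by
        refine ⟨1 - r, r, by linarith, by linarith, by ring, ?_⟩
        rw [Complex.real_smul, Complex.real_smul]
        push_cast
        linear_combination -hpt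
      · refine Set.disjoint_left.1 (hdis i k hk (by omega)) hmem ?_
        rw [show i + k + 1 = i + (k + 1) by ring, hZ]
        exact right_mem_segment ℝ _ _

/-! ### Development of normal curves in the plane -/

theorem Complex.arg_pos_of_im_pos {z : ℂ} (hz : 0 < z.im) : 0 < z.arg ∧ z.arg < π :=
  ⟨lt_of_le_of_ne (Complex.arg_nonneg_iff.2 hz.le) fun h => hz.ne'
    (Complex.arg_eq_zero_iff.1 h.symm).2, Complex.arg_lt_pi_iff.2 (.inr hz.ne')⟩

theorem Complex.arg_div_eq_sub_of_im_pos {a b : ℂ} (ha : 0 < a.im) (hb : 0 < b.im) :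
    (a / b).arg = a.arg - b.arg := by
  have h₁ := Complex.arg_pos_of_im_pos ha
  have h₂ := Complex.arg_pos_of_im_pos hb
  exact Complex.arg_div_eq_sub_of_mem (fun h => by simp [h] at ha) (fun h => by simp [h] at hb)
    ⟨by linarith, by linarith⟩

/-- In the triangle with vertices `0`, `1` and `κ`, the directions of the sides at `0` relative to a
segment between them. -/
theorem Complex.arg_secant {κ : ℂ} (hκ : 0 < κ.im) {l m : ℝ} (hl : 0 < l) (hm : 0 < m) :
    (l - m * κ : ℂ) ≠ 0 ∧ 0 < (κ / (l - m * κ)).im ∧ 0 < (1 / (l - m * κ)).im ∧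
      (κ / (l - m * κ)).arg - (1 / (l - m * κ)).arg = κ.arg := by
  set d : ℂ := l - m * κ with hd
  have hre : d.re = l - m * κ.re := by simp [hd]
  have him : d.im = -(m * κ.im) := by simp [hd]
  have hd0 : d ≠ 0 := fun h => by
    rw [h, Complex.zero_im] at him
    have := mul_pos hm hκ
    linarith
  have hN : 0 < Complex.normSq d := Complex.normSq_pos.2 hd0
  have h₁ : 0 < (κ / d).im := by
    rw [Complex.div_im, hre, him, ← sub_div]
    refine div_pos ?_ hN
    rw [show κ.im * (l - m * κ.re) - κ.re * -(m * κ.im) = l * κ.im by ring]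
    positivity
  have h₂ : 0 < (1 / d).im := by
    rw [Complex.div_im, hre, him, ← sub_div]
    refine div_pos ?_ hN
    rw [Complex.one_im, Complex.one_re,
      show 0 * (l - m * κ.re) - 1 * -(m * κ.im) = m * κ.im by ring]
    positivity
  refine ⟨hd0, h₁, h₂, ?_⟩
  rw [← Complex.arg_div_eq_sub_of_im_pos h₁ h₂]
  congr 1
  field_simp

namespace Corner

variable {T : Type*}

/-- The image of a point of the triangle of `c` under the affine map given by `P` at the corners. -/
noncomputable def place (P : Corner T → ℂ) (c : Corner T) (p : Fin 4 → ℝ) : ℂ :=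
  p c.label * P c + p c.next.label * P c.next + p c.prev.label * P c.prev

theorem place_next (P : Corner T → ℂ) (c : Corner T) (p : Fin 4 → ℝ) :
    c.next.place P p = c.place P p := by
  simp only [place, next_next, next_prev]; ring

theorem place_prev (P : Corner T → ℂ) (c : Corner T) (p : Fin 4 → ℝ) :
    c.prev.place P p = c.place P p := by
  rw [← next_next, place_next, place_next]

theorem place_eq_of_triangle (P : Corner T → ℂ) {c d : Corner T} (h : d.triangle = c.triangle)
    (p : Fin 4 → ℝ) : d.place P p = c.place P p := by
  rcases eq_or_eq_next_or_eq_prev h with rfl | rfl | rfl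
  exacts [rfl, place_next _ _ _, place_prev _ _ _]

theorem place_combo (P : Corner T → ℂ) (c : Corner T) (p q : Fin 4 → ℝ) (s t : ℝ) :
    c.place P (s • p + t • q) = s * c.place P p + t * c.place P q := by
  simp only [place, Pi.add_apply, Pi.smul_apply, smul_eq_mul]; push_cast; ring

/-- The argument is the angle at the corner of the triangle with vertices given by `P`. -/
noncomputable def shape (P : Corner T → ℂ) (c : Corner T) : ℂ :=
  (P c.prev - P c) / (P c.next - P c)

end Corner

namespace OrientedGluing

variable {T : Type*} {τ : OrientedGluing T}

theorem IsPointOfSide.sum_eq_one {s : Corner T} {x : Fin 4 → ℝ} (h : IsPointOfSide s x) :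
    x s.next.label + x s.prev.label = 1 := by
  have := h.2.2.2
  rw [s.sum_labels, h.1, h.2.1] at this
  linarith

theorem IsPointOfSide.next_pos {s : Corner T} {x : Fin 4 → ℝ} (h : IsPointOfSide s x) :
    0 < x s.next.label := h.2.2.1 _ s.next.label_ne_tip s.label_next_ne

theorem IsPointOfSide.prev_pos {s : Corner T} {x : Fin 4 → ℝ} (h : IsPointOfSide s x) :
    0 < x s.prev.label := h.2.2.1 _ s.prev.label_ne_tip s.label_prev_ne

theorem IsPointOfSide.nonneg {s : Corner T} {x : Fin 4 → ℝ} (h : IsPointOfSide s x) (k : Fin 4) :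
    0 ≤ x k := by
  by_cases h₁ : k = s.tip
  · rw [h₁, h.1]
  by_cases h₂ : k = s.label
  · rw [h₂, h.2.1]
  exact (h.2.2.1 k h₁ h₂).le

/-- Barycentric coordinates of a point of a cusp triangle other than a vertex. -/
structure IsPointOfTriangle (X : T × Fin 4) (p : Fin 4 → ℝ) : Prop where
  tip : p X.2 = 0
  nonneg : ∀ k, 0 ≤ p k
  sum_eq : ∑ k, p k = 1
  eq_of_eq_zero : ∀ s s' : Corner T, s.triangle = X → s'.triangle = X →
    p s.label = 0 → p s'.label = 0 → s = s'

/-- The points of an arc that lie on the boundary of the triangle are its ends. -/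
theorem _root_.Arc.eq_end {a : Arc T} {x y p : Fin 4 → ℝ} (hx : IsPointOfSide a.enter x)
    (hy : IsPointOfSide a.leave y) (hp : p ∈ segment ℝ x y) {s : Corner T}
    (hs : s.triangle = a.corner.triangle) (h0 : p s.label = 0) :
    (s = a.enter ∧ p = x) ∨ (s = a.leave ∧ p = y) := by
  obtain ⟨u, v, hu, hv, huv, rfl⟩ := hp
  simp only [Pi.add_apply, Pi.smul_apply, smul_eq_mul] at h0
  have h₁ := mul_nonneg hu (hx.nonneg s.label)
  have h₂ := mul_nonneg hv (hy.nonneg s.label)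
  have hx0 : u = 0 ∨ x s.label = 0 := mul_eq_zero.1 (by linarith)
  have hy0 : v = 0 ∨ y s.label = 0 := mul_eq_zero.1 (by linarith)
  have htip : s.tip = a.corner.tip := congrArg (fun X : T × Fin 4 => X.2) hs
  have hxs : x s.label = 0 → s = a.enter := fun h => by
    by_contra hne
    rcases Corner.eq_or_eq_next_or_eq_prev (hs.trans a.triangle_enter.symm) with h' | h' | h'
    · exact hne h'
    · rw [h'] at h; exact hx.next_pos.ne' h
    · rw [h'] at h; exact hx.prev_pos.ne' h
  have hys : y s.label = 0 → s = a.leave := fun h => by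
    by_contra hne
    rcases Corner.eq_or_eq_next_or_eq_prev (hs.trans a.triangle_leave.symm) with h' | h' | h'
    · exact hne h'
    · rw [h'] at h; exact hy.next_pos.ne' h
    · rw [h'] at h; exact hy.prev_pos.ne' h
  rcases hx0 with rfl | hx0
  · have hv1 : v = 1 := by linarith
    subst hv1
    exact .inr ⟨hys (hy0.resolve_left one_ne_zero), by simp⟩
  · rcases hy0 with rfl | hy0
    · have hu1 : u = 1 := by linarith
      subst hu1
      exact .inl ⟨hxs hx0, by simp⟩
    · exact absurd ((hxs hx0).symm.trans (hys hy0)) a.enter_ne_leave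

theorem _root_.Arc.isPointOfTriangle {a : Arc T} {x y p : Fin 4 → ℝ}
    (hx : IsPointOfSide a.enter x) (hy : IsPointOfSide a.leave y) (hp : p ∈ segment ℝ x y) :
    IsPointOfTriangle a.corner.triangle p where
  tip := by
    obtain ⟨u, v, -, -, -, rfl⟩ := hp
    have h₁ : x a.corner.triangle.2 = 0 := by rw [← a.triangle_enter]; exact hx.1
    have h₂ : y a.corner.triangle.2 = 0 := by rw [← a.triangle_leave]; exact hy.1
    simp [h₁, h₂]
  nonneg k := by
    obtain ⟨u, v, hu, hv, -, rfl⟩ := hp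
    exact add_nonneg (mul_nonneg hu (hx.nonneg k)) (mul_nonneg hv (hy.nonneg k))
  sum_eq := by
    obtain ⟨u, v, -, -, huv, rfl⟩ := hp
    simp only [Pi.add_apply, Pi.smul_apply, smul_eq_mul, Finset.sum_add_distrib,
      ← Finset.mul_sum, hx.2.2.2, hy.2.2.2, mul_one, huv]
  eq_of_eq_zero s s' hs hs' h h' := by
    have hxy : x ≠ y := fun e => a.enter_ne_leave (by
      by_contra hne
      have h0 := hy.2.1
      rcases Corner.eq_or_eq_next_or_eq_prev (a.triangle_leave.trans a.triangle_enter.symm)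
        with h' | h' | h'
      · exact hne h'.symm
      · rw [h', ← e] at h0; exact hx.next_pos.ne' h0
      · rw [h', ← e] at h0; exact hx.prev_pos.ne' h0)
    rcases Arc.eq_end hx hy hp hs h with ⟨rfl, h₁⟩ | ⟨rfl, h₁⟩ <;>
      rcases Arc.eq_end hx hy hp hs' h' with ⟨rfl, h₂⟩ | ⟨rfl, h₂⟩
    · rfl
    · exact absurd (h₁.symm.trans h₂) hxy
    · exact absurd (h₂.symm.trans h₁) hxy
    · rfl

/-- Barycentric coordinates in two cusp triangles describe the same point, which is in the interior
of both or on a common side. -/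
def SamePoint (τ : OrientedGluing T) (X : T × Fin 4) (p : Fin 4 → ℝ) (Y : T × Fin 4)
    (q : Fin 4 → ℝ) : Prop :=
  (X = Y ∧ p = q) ∨ ∃ s : Corner T, s.triangle = X ∧ (τ.across s).triangle = Y ∧
    p s.label = 0 ∧ ∀ k, q (τ.glue s.tet s.label k) = p k

/-- The translation between the placements of two triangles that share the side `s`. -/
def jump {A : Type*} [Sub A] (τ : OrientedGluing T) (P : Corner T → A) (s : Corner T) : A :=
  P s.prev - P (τ.across s).next

/-- The hypothesis on `P` says that a side has the same displacement in both placements, so these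
differ on it by the translation `jump`. -/
theorem place_across {P : Corner T → ℂ}
    (hP : ∀ s, P (τ.across s).prev - P (τ.across s).next = P s.next - P s.prev)
    {s : Corner T} {p q : Fin 4 → ℝ} (hp : IsPointOfTriangle s.triangle p) (h0 : p s.label = 0)
    (hpq : ∀ k, q (τ.glue s.tet s.label k) = p k) :
    s.place P p = τ.jump P s + (τ.across s).place P q := by
  have h₁ : p s.next.label + p s.prev.label = 1 := by
    have h := hp.sum_eq
    have ht : p s.tip = 0 := hp.tip
    rw [s.sum_labels, ht, h0] at h
    linarith
  have h₂ : q (τ.across s).label = 0 := (hpq s.label).trans h0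
  have h₃ : q (τ.across s).next.label = p s.prev.label := by rw [label_across_next, hpq]
  have h₄ : q (τ.across s).prev.label = p s.next.label := by rw [label_across_prev, hpq]
  have h₅ : (p s.next.label : ℂ) = 1 - p s.prev.label := by
    rw [eq_sub_iff_add_eq]; exact_mod_cast h₁
  rw [Corner.place, Corner.place, jump, h0, h₂, h₃, h₄, h₅]
  push_cast
  linear_combination -(1 - (p s.prev.label : ℂ)) * hP s

/-- The directions of the sides at which an arc enters and leaves, relative to that of the arc. -/
theorem _root_.Arc.arg_sub_arg {P : Corner T → ℂ} (hpos : ∀ c, 0 < (Corner.shape P c).im)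
    {a : Arc T} {x y : Fin 4 → ℝ} (hx : IsPointOfSide a.enter x) (hy : IsPointOfSide a.leave y)
    {v : ℂ} (hv : v = a.corner.place P y - a.corner.place P x) :
    v ≠ 0 ∧ 0 < ((P a.leave.prev - P a.leave.next) / v).im ∧
      0 < ((P a.enter.next - P a.enter.prev) / v).im ∧
      ((P a.leave.prev - P a.leave.next) / v).arg - ((P a.enter.next - P a.enter.prev) / v).arg =
        a.signed fun c => (Corner.shape P c).arg := by
  set c := a.corner with hc
  set κ := c.shape P with hκ
  have hκ0 := hpos c
  set d := P c.next - P c with hd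
  have hd0 : d ≠ 0 := fun h => by
    rw [Corner.shape, ← hd, h, div_zero, Complex.zero_im] at hκ0
    exact lt_irrefl _ hκ0
  have hdκ : P c.prev - P c = d * κ := by rw [hκ, Corner.shape, ← hd, mul_div_cancel₀ _ hd0]
  cases hl : a.left
  · rw [Arc.enter_of_right hl] at hx ⊢
    rw [Arc.leave_of_right hl] at hy ⊢
    rw [Arc.signed_of_right hl, ← hc, ← hκ]
    simp only [Corner.next_prev, Corner.next_next, Corner.prev_prev, Corner.prev_next]
    have sx := hx.sum_eq_one
    have sy := hy.sum_eq_one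
    have px := hx.next_pos
    have py := hy.prev_pos
    simp only [Corner.next_prev, Corner.next_next, Corner.prev_prev, Corner.prev_next] at sx sy px py
    obtain ⟨h₀, h₁, h₂, h₃⟩ := Complex.arg_secant hκ0 py px
    set δ : ℂ := (y c.next.label : ℝ) - (x c.prev.label : ℝ) * κ
    have hvδ : v = d * δ := by
      have e₁ : (x c.label : ℂ) = 1 - x c.prev.label := by
        rw [eq_sub_iff_add_eq]; exact_mod_cast (add_comm _ _).trans sx
      have e₂ : (y c.label : ℂ) = 1 - y c.next.label := by
        rw [eq_sub_iff_add_eq]; exact_mod_cast sy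
      rw [hv, Corner.place, Corner.place, hx.2.1, hy.2.1, e₁, e₂]
      push_cast
      linear_combination -(x c.prev.label : ℂ) * hdκ - (y c.next.label : ℂ) * hd
    rw [← hd, hdκ, hvδ, mul_div_mul_left _ _ hd0, div_mul_cancel_left₀ hd0, ← one_div]
    exact ⟨mul_ne_zero hd0 h₀, h₂, h₁, by rw [← h₃]; ring⟩
  · rw [Arc.enter_of_left hl] at hx ⊢
    rw [Arc.leave_of_left hl] at hy ⊢
    rw [Arc.signed_of_left hl, ← hc, ← hκ]
    simp only [Corner.next_prev, Corner.next_next, Corner.prev_prev, Corner.prev_next]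
    have sx := hx.sum_eq_one
    have sy := hy.sum_eq_one
    have px := hx.prev_pos
    have py := hy.next_pos
    simp only [Corner.next_prev, Corner.next_next, Corner.prev_prev, Corner.prev_next] at sx sy px py
    obtain ⟨h₀, h₁, h₂, h₃⟩ := Complex.arg_secant hκ0 px py
    set δ : ℂ := (x c.next.label : ℝ) - (y c.prev.label : ℝ) * κ
    have hvδ : v = -d * δ := by
      have e₁ : (x c.label : ℂ) = 1 - x c.next.label := by
        rw [eq_sub_iff_add_eq]; exact_mod_cast sx
      have e₂ : (y c.label : ℂ) = 1 - y c.prev.label := by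
        rw [eq_sub_iff_add_eq]; exact_mod_cast (add_comm _ _).trans sy
      rw [hv, Corner.place, Corner.place, hx.2.1, hy.2.1, e₁, e₂]
      push_cast
      linear_combination (y c.prev.label : ℂ) * hdκ + (x c.next.label : ℂ) * hd
    have hd0' := neg_ne_zero.2 hd0
    rw [show P c - P c.prev = -d * κ by linear_combination -hdκ,
      show P c - P c.next = -d by rw [hd]; ring, hvδ, mul_div_mul_left _ _ hd0',
      div_mul_cancel_left₀ hd0', ← one_div]
    exact ⟨mul_ne_zero hd0' h₀, h₁, h₂, h₃⟩

namespace NormalCurve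

/-- The translation between the placements of the initial triangle and of the `k`-th one. -/
def shift {A : Type*} [AddCommGroup A] (γ : τ.NormalCurve) (P : Corner T → A) (k : ℕ) : A :=
  ∑ i ∈ Finset.range k, τ.jump P (γ.arc (Fin.ofNat (γ.n + 1) i)).leave

theorem shift_succ {A : Type*} [AddCommGroup A] (γ : τ.NormalCurve) (P : Corner T → A) (k : ℕ) :
    γ.shift P (k + 1) = γ.shift P k + τ.jump P (γ.arc (Fin.ofNat (γ.n + 1) k)).leave :=
  Finset.sum_range_succ _ _

theorem ofNat_add_period (n k : ℕ) : Fin.ofNat (n + 1) (k + (n + 1)) = Fin.ofNat (n + 1) k := by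
  ext; simp

theorem sum_ofNat {A : Type*} [AddCommMonoid A] {n : ℕ} (f : Fin (n + 1) → A) :
    ∑ i ∈ Finset.range (n + 1), f (Fin.ofNat (n + 1) i) = ∑ i, f i := by
  rw [Finset.sum_range]
  exact Finset.sum_congr rfl fun i _ => congrArg f (by ext; simp)

theorem shift_add_period {A : Type*} [AddCommGroup A] (γ : τ.NormalCurve) (P : Corner T → A)
    (k : ℕ) : γ.shift P (k + (γ.n + 1)) = γ.shift P k + γ.shift P (γ.n + 1) := by
  induction k with
  | zero => simp [shift]
  | succ k ih =>
    rw [show k + 1 + (γ.n + 1) = k + (γ.n + 1) + 1 by ring, shift_succ, ih, shift_succ γ P k,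
      ofNat_add_period, add_right_comm]

/-- The translation along a closed curve. -/
theorem two_mul_shift_period (γ : τ.NormalCurve) {P : Corner T → ℝ}
    (hP : ∀ s, P (τ.across s).prev - P (τ.across s).next = P s.next - P s.prev) :
    2 * γ.shift P (γ.n + 1) = γ.turn fun c => P c.prev - P c.next := by
  have h₁ : γ.shift P (γ.n + 1) = ∑ i, τ.jump P (γ.arc i).leave :=
    sum_ofNat fun i => τ.jump P (γ.arc i).leave
  have h₂ : γ.turn (fun c => P c.prev - P c.next) =
      ∑ i, ((P (γ.arc i).leave.prev + P (γ.arc i).leave.next) -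
        (P (γ.arc i).enter.prev + P (γ.arc i).enter.next)) :=
    Finset.sum_congr rfl fun i _ => Arc.signed_eq_of_sub (g := fun s => P s.prev + P s.next)
      (fun c => by simp; ring) _
  rw [h₂, Finset.sum_sub_distrib, γ.sum_enter fun s => P s.prev + P s.next,
    ← Finset.sum_sub_distrib, h₁, Finset.mul_sum]
  refine Finset.sum_congr rfl fun i _ => ?_
  rw [jump]
  linarith [hP (γ.arc i).leave]

/-- If a simple closed curve develops to a simple periodic line in the plane, its total turning
vanishes. -/
theorem turn_arg_shape_eq_zero (γ : τ.NormalCurve) {P : Corner T → ℂ}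
    (hP : ∀ s, P (τ.across s).prev - P (τ.across s).next = P s.next - P s.prev)
    (hpos : ∀ c, 0 < (Corner.shape P c).im) {x y : Fin (γ.n + 1) → Fin 4 → ℝ}
    (hx : ∀ i, IsPointOfSide (γ.arc i).enter (x i)) (hy : ∀ i, IsPointOfSide (γ.arc i).leave (y i))
    (hxy : ∀ i k, x (i + 1) (τ.glue (γ.arc i).leave.tet (γ.arc i).leave.label k) = y i k)
    (hdis : ∀ i j, i ≠ j → (γ.arc i).corner.triangle = (γ.arc j).corner.triangle →
      Disjoint (segment ℝ (x i) (y i)) (segment ℝ (x j) (y j)))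
    (hinj : ∀ (i j : ℕ), ∀ p ∈ segment ℝ (x (Fin.ofNat _ i)) (y (Fin.ofNat _ i)),
      ∀ q ∈ segment ℝ (x (Fin.ofNat _ j)) (y (Fin.ofNat _ j)),
      γ.shift P i + (γ.arc (Fin.ofNat _ i)).corner.place P p =
        γ.shift P j + (γ.arc (Fin.ofNat _ j)).corner.place P q →
      τ.SamePoint (γ.arc (Fin.ofNat _ i)).corner.triangle p
        (γ.arc (Fin.ofNat _ j)).corner.triangle q)
    (hperiod : γ.shift P (γ.n + 1) ≠ 0) :
    γ.turn (fun c => (Corner.shape P c).arg) = 0 := by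
  set cyc : ℕ → Fin (γ.n + 1) := fun i => Fin.ofNat (γ.n + 1) i with hcyc
  have cyc_succ : ∀ i, cyc (i + 1) = cyc i + 1 := ofNat_succ γ.n
  have cyc_period : ∀ i, cyc (i + (γ.n + 1)) = cyc i := ofNat_add_period γ.n
  have cyc_ne : ∀ i m, 0 < m → m < γ.n + 1 → cyc i ≠ cyc (i + m) := by
    intro i m h0 hm h
    have h₁ : i % (γ.n + 1) = (i + m) % (γ.n + 1) := congrArg Fin.val h
    have h₂ : (i + 0) ≡ (i + m) [MOD (γ.n + 1)] := h₁
    have h₃ := Nat.ModEq.add_left_cancel' i h₂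
    rw [Nat.ModEq, Nat.zero_mod, Nat.mod_eq_of_lt hm] at h₃
    omega
  have htri : ∀ i, (τ.across (γ.arc (cyc i)).leave).triangle =
      (γ.arc (cyc (i + 1))).corner.triangle := fun i => by
    rw [cyc_succ, γ.triangle_across_leave]; rfl
  have hxmem : ∀ i, x i ∈ segment ℝ (x i) (y i) := fun i => left_mem_segment ℝ _ _
  have hymem : ∀ i, y i ∈ segment ℝ (x i) (y i) := fun i => right_mem_segment ℝ _ _
  set Z : ℕ → ℂ := fun i => γ.shift P i + (γ.arc (cyc i)).corner.place P (x (cyc i)) with hZ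
  have hZy : ∀ i, Z (i + 1) = γ.shift P i + (γ.arc (cyc i)).corner.place P (y (cyc i)) := by
    intro i
    have h := place_across hP (s := (γ.arc (cyc i)).leave)
      (by rw [Arc.triangle_leave]; exact Arc.isPointOfTriangle (hx _) (hy _) (hymem _))
      (hy (cyc i)).2.1 (hxy (cyc i))
    rw [Corner.place_eq_of_triangle P (Arc.triangle_leave _),
      Corner.place_eq_of_triangle P (htri i)] at h
    simp only [hZ]
    rw [h, γ.shift_succ, cyc_succ, add_assoc]
  have hv : ∀ i, Z (i + 1) - Z i = (γ.arc (cyc i)).corner.place P (y (cyc i)) -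
      (γ.arc (cyc i)).corner.place P (x (cyc i)) := fun i => by
    rw [hZy]; simp only [hZ]; ring
  have hseg : ∀ i, ∀ z ∈ segment ℝ (Z i) (Z (i + 1)), ∃ p ∈ segment ℝ (x (cyc i)) (y (cyc i)),
      z = γ.shift P i + (γ.arc (cyc i)).corner.place P p := by
    rintro i z ⟨u, v, hu, hv, huv, rfl⟩
    refine ⟨_, ⟨u, v, hu, hv, huv, rfl⟩, ?_⟩
    rw [Corner.place_combo, hZy, Complex.real_smul, Complex.real_smul]
    simp only [hZ]
    have : (u : ℂ) + v = 1 := by exact_mod_cast huv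
    linear_combination γ.shift P i * this
  have hper : ∀ i, Z (i + (γ.n + 1)) = Z i + γ.shift P (γ.n + 1) := fun i => by
    simp only [hZ]; rw [shift_add_period, cyc_period]; ring
  have harc := fun i => Arc.arg_sub_arg hpos (hx (cyc i)) (hy (cyc i)) (hv i)
  -- the directions of the sides at which the curve enters and leaves
  set inn : ℕ → ℝ := fun i => ((P (γ.arc (cyc i)).enter.next - P (γ.arc (cyc i)).enter.prev) /
    (Z (i + 1) - Z i)).arg with hinn
  set out : ℕ → ℝ := fun i => ((P (γ.arc (cyc i)).leave.prev - P (γ.arc (cyc i)).leave.next) /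
    (Z (i + 1) - Z i)).arg with hout
  have hside : ∀ i, P (γ.arc (cyc (i + 1))).enter.next - P (γ.arc (cyc (i + 1))).enter.prev =
      P (γ.arc (cyc i)).leave.prev - P (γ.arc (cyc i)).leave.next := fun i => by
    rw [cyc_succ, γ.closed]
    linear_combination -hP (γ.arc (cyc i)).leave
  have hdir : ∀ i, P (γ.arc (cyc i)).leave.prev - P (γ.arc (cyc i)).leave.next ≠ 0 := fun i h => by
    have := (harc i).2.1
    rw [h, zero_div, Complex.zero_im] at this
    exact lt_irrefl _ this
  -- The direction of the common side, measured from each of the two arcs that meet on it, has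
  -- argument in `(0, π)`; the exterior angle is the difference.
  have hturn : ∀ i, ((Z (i + 2) - Z (i + 1)) / (Z (i + 1) - Z i)).arg = out i - inn (i + 1) := by
    intro i
    have h₁ := (harc i).2.1
    have h₂ := (harc (i + 1)).2.2.1
    rw [hside] at h₂
    simp only [hout, hinn]
    rw [hside, ← Complex.arg_div_eq_sub_of_im_pos h₁ h₂, div_div_div_cancel_left' _ _ (hdir i)]
  have hsum := sum_arg_eq_zero_of_simple (n := γ.n + 1) (Nat.succ_pos _) hperiod hper
    (fun i => sub_ne_zero.1 (harc i).1)
    (fun i => by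
      have h₁ := Complex.arg_pos_of_im_pos (harc i).2.1
      have h₂ := (harc (i + 1)).2.2.1
      have h₂ := Complex.arg_pos_of_im_pos h₂
      rw [hturn]
      simp only [hout, hinn]
      linarith [h₁.2, h₂.1])
    (fun i m hm hmn => by
      rw [Set.disjoint_left]
      intro z hz₁ hz₂
      obtain ⟨p, hp, rfl⟩ := hseg i z hz₁
      obtain ⟨q, hq, hpq⟩ := hseg (i + m) _ hz₂
      have hno : ∀ i' j' r, cyc i' ≠ cyc j' →
          (γ.arc (cyc i')).corner.triangle = (γ.arc (cyc j')).corner.triangle →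
          r ∈ segment ℝ (x (cyc i')) (y (cyc i')) → r ∉ segment ℝ (x (cyc j')) (y (cyc j')) :=
        fun i' j' r hne ht hr => Set.disjoint_left.1 (hdis _ _ hne ht) hr
      -- Injectivity of the development brings an intersection of the lifts back to the surface. In
      -- a common triangle it contradicts simplicity at once; on a side, `p` is an end of its arc,
      -- and `q` is also an end of the preceding or following arc.
      rcases hinj i (i + m) p hp q hq hpq with ⟨ht, rfl⟩ | ⟨s, hs, hs', h0, hqp⟩
      · exact hno i (i + m) p (cyc_ne i m (by omega) hmn) ht hp hq
      · rcases Arc.eq_end (hx _) (hy _) hp hs h0 with ⟨rfl, rfl⟩ | ⟨rfl, rfl⟩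
        · have hlast : cyc (i + γ.n) + 1 = cyc i := by rw [← cyc_succ, ← cyc_period i]; rfl
          have hlv : τ.across (γ.arc (cyc i)).enter = (γ.arc (cyc (i + γ.n))).leave := by
            rw [← hlast, γ.closed, across_across]
          have hq' : q = y (cyc (i + γ.n)) := by
            funext k
            rw [← hxy, hlast, ← hqp]
            congr 1
            have h := τ.glue_across (γ.arc (cyc (i + γ.n))).leave k
            rw [← hlv, across_across] at h
            rw [← hlv, h]
          have ht : (γ.arc (cyc (i + γ.n))).corner.triangle =
              (γ.arc (cyc (i + m))).corner.triangle := by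
            rw [← Arc.triangle_leave, ← hlv, hs']
          rcases (show m ≤ γ.n by omega).lt_or_eq with hlt | rfl
          · refine hno (i + γ.n) (i + m) q ?_ ht (by rw [hq']; exact hymem _) hq
            have := cyc_ne (i + m) (γ.n - m) (by omega) (by omega)
            rw [show i + m + (γ.n - m) = i + γ.n by omega] at this
            exact this.symm
          -- The remaining arc is the predecessor of arc `i` one period later. Its end is the
          -- translate of the beginning of arc `i`, so an intersection would mean period zero.
          · apply hperiod
            have h := hper i
            rw [← add_assoc, hZy, ← hq', ← hpq] at h
            simpa [hZ] using h
        · have hq' : q = x (cyc (i + 1)) := by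
            funext k
            obtain ⟨k, rfl⟩ := (τ.glue (γ.arc (cyc i)).leave.tet (γ.arc (cyc i)).leave.label).surjective k
            rw [hqp, cyc_succ, hxy]
          refine hno (i + 1) (i + m) q ?_ ((htri i).symm.trans hs') (by rw [hq']; exact hxmem _) hq
          have := cyc_ne (i + 1) (m - 1) (by omega) (by omega)
          rwa [show i + 1 + (m - 1) = i + m by omega] at this)
  -- A shift of index regroups the exterior angles `out i - inn (i + 1)` of the polygon into the
  -- angles `out i - inn i` cut off in each triangle.
  rw [Finset.sum_congr rfl fun i _ => hturn i, Finset.sum_sub_distrib,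
    sum_range_shift (f := inn) fun i => by
      simp only [hinn]
      rw [show i + (γ.n + 1) + 1 = i + 1 + (γ.n + 1) by ring, hper, hper, cyc_period,
        add_sub_add_right_eq_sub], ← Finset.sum_sub_distrib,
    Finset.sum_congr rfl fun i _ => (harc i).2.2.2] at hsum
  rw [turn, ← sum_ofNat]
  exact hsum

end NormalCurve

end OrientedGluing

/-! ### The flat structure -/

namespace OrientedGluing

variable {T : Type*} {τ : OrientedGluing T}

namespace VeeringColoring

variable (D : τ.VeeringColoring)

open Classical in
/-- A primitive of `z` on the corners of each triangle. -/
noncomputable def potential {A : Type*} [AddCommGroup A] (z : Corner T → A) (c : Corner T) : A :=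
  if c = D.wideCorner c.triangle then -z c.prev
  else if c = D.thinCorner false c.triangle then z c.next else 0

section potential

variable {A : Type*} [AddCommGroup A] (z : Corner T → A) (X : T × Fin 4)

theorem potential_wideCorner :
    D.potential z (D.wideCorner X) = -z (D.thinCorner false X) := by simp [potential]

@[simp] theorem potential_thinCorner_true : D.potential z (D.thinCorner true X) = 0 := by
  rw [potential, triangle_thinCorner, if_neg (D.thinCorner_ne_wideCorner _ _ _), if_neg]
  exact fun h => by simpa using D.thinCorner_inj h

@[simp] theorem potential_thinCorner_false :
    D.potential z (D.thinCorner false X) = z (D.wideCorner X) := by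
  rw [potential, triangle_thinCorner, if_neg (D.thinCorner_ne_wideCorner _ _ _), if_pos rfl,
    thinCorner_false, Corner.prev_next]

variable {z}

theorem potential_prev_sub_next (hz : ∀ c, z c + z c.next + z c.prev = 0) (s : Corner T) :
    D.potential z s.prev - D.potential z s.next = z s := by
  have hw := D.potential_wideCorner z s.triangle
  have ha := D.potential_thinCorner_true z s.triangle
  have hb := D.potential_thinCorner_false z s.triangle
  rw [thinCorner_true] at ha
  rw [thinCorner_false] at hw hb
  have hs := hz (D.wideCorner s.triangle)
  rcases Corner.eq_or_eq_next_or_eq_prev (c := D.wideCorner s.triangle) (d := s) rfl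
    with h | h | h
  · rw [h, ha, hb, sub_zero]
  · rw [h, Corner.next_prev, Corner.next_next, hw, hb, ← sub_eq_zero, ← neg_eq_zero, ← hs]; abel
  · rw [h, Corner.prev_prev, Corner.prev_next, ha, hw]; abel

end potential

namespace Transversal

variable {D} (R : D.Transversal) (X : T × Fin 4)

/-- The direction of the ladder of a triangle, as a sign. -/
def sgn : ℤ := if R.sign (D.ladder X) then 1 else -1

@[simp] theorem sgn_pass : R.sgn (D.pass X) = -R.sgn X := by
  unfold sgn; rw [R.sign_pass]; cases R.sign (D.ladder X) <;> simp

@[simp] theorem sgn_up : R.sgn (D.up X) = R.sgn X := by unfold sgn; rw [ladder_up]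

@[simp] theorem sgn_up_symm : R.sgn (D.up.symm X) = R.sgn X := by unfold sgn; rw [ladder_up_symm]

theorem sgn_eq : R.sgn X = 1 ∨ R.sgn X = -1 := by unfold sgn; split <;> simp

theorem sgn_mul_self : R.sgn X * R.sgn X = 1 := by rcases R.sgn_eq X with h | h <;> simp [h]

theorem sgn_mul_self_real : (R.sgn X : ℝ) * R.sgn X = 1 := by exact_mod_cast R.sgn_mul_self X

/-- The widths of the sides. -/
noncomputable def width : Corner T → ℤ := D.rungFlow (fun X => -R.sgn X) fun _ => 0

theorem isCocycle_width : τ.IsCocycle R.width :=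
  D.isCocycle_rungFlow (fun _ => rfl) fun X => by simp

@[simp] theorem width_wideCorner : R.width (D.wideCorner X) = R.sgn X := by simp [width]
@[simp] theorem width_top : R.width (D.top X) = -R.sgn X := by simp [width]
@[simp] theorem width_pole : R.width (D.pole X) = 0 := by simp [width]

/-- The horizontal positions of the corners of a triangle. -/
noncomputable def col : Corner T → ℤ := D.potential R.width

@[simp] theorem col_thinCorner_true : R.col (D.thinCorner true X) = 0 := D.potential_thinCorner_true _ _
@[simp] theorem col_thinCorner_false : R.col (D.thinCorner false X) = R.sgn X := by
  rw [col, potential_thinCorner_false, width_wideCorner]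

theorem col_wideCorner : R.col (D.wideCorner X) = if D.type X then 0 else R.sgn X := by
  rw [col, potential_wideCorner]
  cases h : D.type X
  · have : D.thinCorner false X = D.top X := by rw [top, h]
    simp [this]
  · have : D.thinCorner false X = D.pole X := by rw [pole, h]; rfl
    simp [this]

/-- Left-veering ladderpoles are placed at column 0 and right-veering ones at column `±1`, so each
triangle spans a strip of width 1. -/
theorem col_eq (c : Corner T) :
    R.col c = if D.color (τ.vertex c) then 0 else R.sgn c.triangle := by
  rcases Corner.eq_or_eq_next_or_eq_prev (c := D.wideCorner c.triangle) (d := c) rfl with h | h | h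
  · rw [h, col_wideCorner]; rfl
  · have h' : c = D.thinCorner true c.triangle := h
    rw [h', col_thinCorner_true, color_thinCorner, if_pos rfl]
  · have h' : c = D.thinCorner false c.triangle := h
    rw [h', col_thinCorner_false, color_thinCorner, triangle_thinCorner]; rfl

/-- The triangles at which the transversal crosses a ladderpole. -/
def IsSpecial : Prop := R.IsEntry X ∨ R.IsEntry (D.pass X)

theorem isSpecial_pass : R.IsSpecial (D.pass X) ↔ R.IsSpecial X := by
  rw [IsSpecial, IsSpecial, pass_pass, or_comm]

variable [Finite T]

/-- The integral parts of the vertical positions of the corners of a triangle. -/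
noncomputable def row : Corner T → ℤ := D.potential R.flow

/-- The vertical positions of the corners of a triangle. -/
noncomputable def height (Y : τ.Vertex → ℝ) (c : Corner T) : ℝ := R.row c + Y (τ.vertex c)

/-- The oriented length of the ladderpole segment of a triangle. -/
noncomputable def rise (Y : τ.Vertex → ℝ) : ℝ :=
  R.sgn X * (R.height Y (D.wideCorner X) - R.height Y (D.thinCorner (D.type X) X))

theorem exists_isSpecial (O : D.Ladder) (e : Bool) :
    ∃ Z, R.IsSpecial Z ∧ D.ladder Z = O ∧ D.type Z = e := by
  by_cases h : e = R.sign O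
  · refine ⟨R.hinge O, .inl ?_, R.ladder_hinge _, (R.type_hinge _).trans h.symm⟩
    rw [IsEntry, R.ladder_hinge]
  · refine ⟨R.exit O, .inr ?_, R.ladder_exit _, (R.type_exit _).trans ?_⟩
    · rw [isEntry_pass_iff, R.ladder_exit]
    · cases e <;> simp_all

variable {X} in
theorem IsSpecial.eq (h : R.IsSpecial X) : X =
    if D.type X = R.sign (D.ladder X) then R.hinge (D.ladder X) else R.exit (D.ladder X) := by
  rcases h with h | h
  · have ht : D.type X = R.sign (D.ladder X) := by
      conv_lhs => rw [h]
      exact R.type_hinge _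
    rw [if_pos ht]; exact h
  · have hX := (R.isEntry_pass_iff X).1 h
    have ht : D.type X = !R.sign (D.ladder X) := by
      conv_lhs => rw [hX]
      exact R.type_exit _
    rw [if_neg (by rw [ht]; simp)]; exact hX

-- The rows alone give ladderpole segments length 1 where the transversal crosses and length 0
-- elsewhere. The degenerate segments are the reason for the real corrections in `exists_rise_pos`.
open Classical in
theorem sgn_mul_row_sub : R.sgn X * (R.row (D.wideCorner X) - R.row (D.thinCorner (D.type X) X)) =
    if R.IsSpecial X then 1 else 0 := by
  have h₀ : R.row (D.wideCorner X) - R.row (D.thinCorner (D.type X) X) =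
      if D.type X then -R.crossing X else R.crossing X := by
    rw [← flow_pole]
    cases h : D.type X
    · have hp : D.pole X = (D.wideCorner X).next := by simp [pole, h]
      have := D.potential_prev_sub_next R.isCocycle_flow.sum_eq (D.pole X)
      rw [← this, hp, Corner.next_prev]; rfl
    · have hp : D.pole X = (D.wideCorner X).prev := by simp [pole, h]
      have := D.potential_prev_sub_next R.isCocycle_flow.sum_eq (D.pole X)
      rw [← this, hp, Corner.prev_prev, Corner.prev_next, if_pos rfl, neg_sub]; rfl
  have h₁ : R.IsEntry X → D.type X = R.sign (D.ladder X) := fun h => by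
    conv_lhs => rw [h]
    exact R.type_hinge _
  have h₂ : R.IsEntry (D.pass X) → D.type X = !R.sign (D.ladder X) := fun h => by
    conv_lhs => rw [(R.isEntry_pass_iff X).1 h]
    exact R.type_exit _
  rw [h₀, crossing, sgn]
  by_cases e₁ : R.IsEntry X <;> by_cases e₂ : R.IsEntry (D.pass X)
  · have := (h₁ e₁).symm.trans (h₂ e₂)
    simp at this
  · have := h₁ e₁
    cases h : D.type X <;> simp_all [IsSpecial]
  · have := h₂ e₂
    cases h : D.type X <;> simp_all [IsSpecial]
  · simp [IsSpecial, e₁, e₂]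

/-- The vertices can be given heights such that all ladderpoles are monotone. -/
theorem exists_rise_pos : ∃ Y : τ.Vertex → ℝ, ∀ X, 0 < R.rise X Y := by
  classical
  set ρ : T × Fin 4 → T × Fin 4 := fun Z => D.pass (D.other Z) with hρ
  have hex : ∀ X, ∃ j : ℕ, R.IsSpecial (ρ^[j + 1] X) := fun X => by
    obtain ⟨Z, hZ, hZX, hZt⟩ := R.exists_isSpecial (D.ladder X) (D.type X)
    obtain ⟨j, hj⟩ := D.exists_iterate_of_ladder_eq (X := ρ X) (Y := Z)
      (by rw [hZX]; exact D.ladder_pass_other X) (by simp [hρ, hZt])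
    exact ⟨j, by rw [Function.iterate_succ_apply]; exact hj ▸ hZ⟩
  -- The number of segments to be passed along the ladderpole before the next special one.
  set d : T × Fin 4 → ℕ := fun X => Nat.find (hex X) with hd
  have hdlt : ∀ X, ¬ R.IsSpecial X → d X < d (D.other (D.pass X)) := fun X hX => by
    have h := Nat.find_spec (hex (D.other (D.pass X)))
    rw [Function.iterate_succ_apply] at h
    have hback : ρ (D.other (D.pass X)) = X := by simp [hρ]
    rw [hback] at h
    change d X < Nat.find (hex (D.other (D.pass X)))
    generalize Nat.find (hex (D.other (D.pass X))) = e at h ⊢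
    rcases e with _ | k
    · exact absurd h hX
    · exact Nat.lt_succ_of_le (Nat.find_min' _ h)
  obtain ⟨M, hM⟩ := (Set.finite_range d).bddAbove
  have hplus : ∀ q, ∃ X, τ.vertex (D.wideCorner X) = q ∧ R.sgn X = 1 := fun q => by
    obtain ⟨X, _, _, hX⟩ := D.two_wide q
    have hX := (hX X).2 (.inl rfl)
    rcases R.sgn_eq X with h | h
    · exact ⟨X, hX, h⟩
    · refine ⟨D.other X, (D.vertex_other X).trans hX, ?_⟩
      unfold sgn at h ⊢
      rw [ladder_other, R.sign_pass]
      cases h' : R.sign (D.ladder X) <;> simp_all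
  choose plus hplus₁ hplus₂ using hplus
  have huniq : ∀ X, R.sgn X = 1 → plus (τ.vertex (D.wideCorner X)) = X := fun X hX => by
    rcases D.vertex_wideCorner_eq_iff.1 (hplus₁ (τ.vertex (D.wideCorner X))) with h | h
    · exact h
    · exfalso
      have h₁ := hplus₂ (τ.vertex (D.wideCorner X))
      rw [h] at h₁
      unfold sgn at h₁ hX
      rw [ladder_other, R.sign_pass] at h₁
      cases h' : R.sign (D.ladder X) <;> simp_all
  have hpos : (0 : ℝ) < M + 1 := by positivity
  -- The height grows as the next special segment comes nearer. After division by `M + 1` the drop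
  -- at a special segment is less than 1, so the unit contributed by the row outweighs it.
  refine ⟨fun q => -(d (plus q) : ℝ) / (M + 1), ?_⟩
  have key : ∀ X, R.sgn X = 1 → 0 < -(d (plus (τ.vertex (D.wideCorner X))) : ℝ) / (M + 1) -
      -(d (plus (τ.vertex (D.thinCorner (D.type X) X))) : ℝ) / (M + 1) +
      if R.IsSpecial X then 1 else 0 := fun X hX => by
    have hZ : R.sgn (D.other (D.pass X)) = 1 := by
      rw [← hX]; unfold sgn; rw [ladder_other, pass_pass]
    rw [← D.vertex_wideCorner_pass rfl, ← D.vertex_other (D.pass X), huniq _ hX, huniq _ hZ]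
    have h₁ : (d X : ℝ) < M + 1 := by
      have : d X ≤ M := hM ⟨X, rfl⟩
      exact_mod_cast Nat.lt_succ_of_le this
    rw [← sub_div]
    split
    · have : -1 < (-(d X : ℝ) - -d (D.other (D.pass X))) / (M + 1) := by
        rw [lt_div_iff₀ hpos]
        have : (0 : ℝ) ≤ d (D.other (D.pass X)) := Nat.cast_nonneg _
        linarith
      linarith
    · rename_i hs
      have h₂ : (d X : ℝ) < d (D.other (D.pass X)) := by exact_mod_cast hdlt X hs
      rw [add_zero]
      exact div_pos (by linarith) hpos
  intro X
  have hrow : (R.sgn X : ℝ) * (R.row (D.wideCorner X) - R.row (D.thinCorner (D.type X) X)) =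
      if R.IsSpecial X then 1 else 0 := by exact_mod_cast R.sgn_mul_row_sub X
  have hsplit : ∀ a b y z s : ℝ, s * (a + y - (b + z)) = s * (y - z) + s * (a - b) := by
    intros; ring
  rw [rise, height, height, hsplit, hrow]
  rcases R.sgn_eq X with h | h
  · rw [h, Int.cast_one, one_mul]; exact key X h
  · have hX : R.sgn (D.pass X) = 1 := by rw [sgn_pass, h]; rfl
    have := key _ hX
    have h₁ : τ.vertex (D.wideCorner X) = τ.vertex (D.thinCorner (D.type (D.pass X)) (D.pass X)) := by
      rw [← D.vertex_wideCorner_pass rfl, pass_pass]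
    rw [D.vertex_wideCorner_pass rfl, ← h₁] at this
    simp only [isSpecial_pass] at this
    rw [h]
    push_cast
    linarith

end Transversal

end VeeringColoring

end OrientedGluing

/-! ### Euclidean triangles and comparison with the taut angles -/

theorem Complex.arg_div_eq_sub_of_re_nonneg {a b : ℂ} (ha : 0 ≤ a.re) (hb : 0 ≤ b.re)
    (h : (a / b).im ≠ 0) : (a / b).arg = a.arg - b.arg := by
  have ha0 : a ≠ 0 := fun h' => by simp [h'] at h
  have hb0 : b ≠ 0 := fun h' => by simp [h'] at h
  have h₁ := abs_le.1 (Complex.abs_arg_le_pi_div_two_iff.2 ha)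
  have h₂ := abs_le.1 (Complex.abs_arg_le_pi_div_two_iff.2 hb)
  refine Complex.arg_div_eq_sub_of_mem ha0 hb0 ⟨lt_of_le_of_ne (by linarith) fun h' => h ?_,
    by linarith⟩
  have ha' := (Complex.arg_eq_neg_pi_div_two_iff.1 (by linarith : a.arg = -(π / 2))).1
  have hb' := (Complex.arg_eq_pi_div_two_iff.1 (by linarith : b.arg = π / 2)).1
  rw [Complex.div_im, ha', hb']
  simp

theorem Complex.div_im_pos_iff {a b : ℂ} (hb : b ≠ 0) :
    0 < (a / b).im ↔ 0 < b.re * a.im - b.im * a.re := by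
  rw [Complex.div_im, ← sub_div, div_pos_iff_of_pos_right (Complex.normSq_pos.2 hb),
    mul_comm b.re, mul_comm b.im]

namespace OrientedGluing

variable {T : Type*} {τ : OrientedGluing T}

theorem jump_sub {A : Type*} [AddCommGroup A] {P : Corner T → A}
    (hP : ∀ s, P (τ.across s).prev - P (τ.across s).next = P s.next - P s.prev) (s : Corner T) :
    τ.jump P s = P s.next - P (τ.across s).prev := by
  rw [jump, sub_eq_sub_iff_add_eq_add, ← sub_eq_sub_iff_add_eq_add.1 (hP s)]
  abel

namespace VeeringColoring

variable {D : τ.VeeringColoring}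

theorem potential_across {A : Type*} [AddCommGroup A] {z : Corner T → A} (hz : τ.IsCocycle z)
    (s : Corner T) : D.potential z (τ.across s).prev - D.potential z (τ.across s).next =
      D.potential z s.next - D.potential z s.prev := by
  rw [D.potential_prev_sub_next hz.sum_eq, hz.across, ← D.potential_prev_sub_next hz.sum_eq s,
    neg_sub]

namespace Transversal

variable (R : D.Transversal) [Finite T] (Y : τ.Vertex → ℝ) (X : T × Fin 4)

/-- The position of a corner in the plane, up to a translation of its triangle. -/
noncomputable def position (c : Corner T) : ℂ := ⟨R.col c, R.height Y c⟩

@[simp] theorem re_position (c : Corner T) : (R.position Y c).re = R.col c := rfl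
@[simp] theorem im_position (c : Corner T) : (R.position Y c).im = R.height Y c := rfl

theorem height_across (s : Corner T) : R.height Y (τ.across s).prev - R.height Y (τ.across s).next =
    R.height Y s.next - R.height Y s.prev := by
  have h : R.row (τ.across s).prev - R.row (τ.across s).next = R.row s.next - R.row s.prev :=
    potential_across R.isCocycle_flow s
  have h' : (R.row (τ.across s).prev : ℝ) - R.row (τ.across s).next = R.row s.next - R.row s.prev :=
    by exact_mod_cast h
  rw [height, height, height, height, vertex_across_next, vertex_across_prev]
  linarith

omit [Finite T] in
theorem col_across (s : Corner T) : R.col (τ.across s).prev - R.col (τ.across s).next =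
    R.col s.next - R.col s.prev := potential_across R.isCocycle_width s

theorem position_across (s : Corner T) :
    R.position Y (τ.across s).prev - R.position Y (τ.across s).next =
      R.position Y s.next - R.position Y s.prev := by
  refine Complex.ext ?_ (R.height_across Y s)
  have := R.col_across s
  simp only [Complex.sub_re, re_position]
  exact_mod_cast this

theorem jump_position (s : Corner T) :
    τ.jump (R.position Y) s = (τ.jump R.col s : ℤ) + (τ.jump R.row s : ℤ) * Complex.I := by
  apply Complex.ext
  · simp [jump]
  · simp only [jump, Complex.sub_im, im_position, height, vertex_across_next]
    simp

variable {Y}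

/-- This is twice the signed area, the same from each corner: the triangle has a vertical side of
length `rise` and width 1. -/
theorem cross_position (hY : ∀ X, 0 < R.rise X Y) (c : Corner T) :
    0 < (R.position Y c.next - R.position Y c).re * (R.position Y c.prev - R.position Y c).im -
      (R.position Y c.next - R.position Y c).im * (R.position Y c.prev - R.position Y c).re := by
  set P := R.position Y with hP
  have hrot : ∀ c : Corner T,
      (P c.next.next - P c.next).re * (P c.next.prev - P c.next).im -
        (P c.next.next - P c.next).im * (P c.next.prev - P c.next).re =
      (P c.next - P c).re * (P c.prev - P c).im - (P c.next - P c).im * (P c.prev - P c).re :=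
    fun c => by
      rw [Corner.next_next, Corner.next_prev]
      simp only [Complex.sub_re, Complex.sub_im]; ring
  have hwide : ∀ X, 0 < (P (D.wideCorner X).next - P (D.wideCorner X)).re *
        (P (D.wideCorner X).prev - P (D.wideCorner X)).im -
      (P (D.wideCorner X).next - P (D.wideCorner X)).im *
        (P (D.wideCorner X).prev - P (D.wideCorner X)).re := fun X => by
    have h := hY X
    have ha := R.col_thinCorner_true X
    have hb := R.col_thinCorner_false X
    rw [thinCorner_true] at ha
    rw [thinCorner_false] at hb
    rw [rise] at h
    simp only [hP, Complex.sub_re, Complex.sub_im, re_position, im_position, ha, hb, col_wideCorner]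
    cases ht : D.type X
    · rw [ht, thinCorner_false] at h
      simp only [Bool.false_eq_true, if_false]
      push_cast
      linarith
    · rw [ht, thinCorner_true] at h
      simp only [if_true]
      push_cast
      linarith
  rcases Corner.eq_or_eq_next_or_eq_prev (c := D.wideCorner c.triangle) (d := c) rfl with h | h | h
  · rw [h]; exact hwide _
  · rw [h, hrot]; exact hwide _
  · rw [h, ← Corner.next_next, hrot, hrot]; exact hwide _

theorem shape_position (hY : ∀ X, 0 < R.rise X Y) (c : Corner T) :
    0 < (Corner.shape (R.position Y) c).im := by
  have h := R.cross_position hY c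
  rwa [Corner.shape, Complex.div_im_pos_iff]
  intro h0
  rw [h0] at h
  simp at h

/-- The total turning in the flat structure is the one given by the taut structure. -/
theorem turn_arg_shape (hY : ∀ X, 0 < R.rise X Y) {α : T → Fin 3 → ℝ}
    (hD : ∀ t j, α t j = if j = D.wide t then π else 0) (γ : τ.NormalCurve) :
    γ.turn (fun c => (Corner.shape (R.position Y) c).arg) = γ.turningAngle α := by
  classical
  set P := R.position Y with hP
  set E : Corner T → ℂ := fun s => P s.prev - P s.next with hE
  -- The sign turns each side into the closed right half plane and reverses under the gluing, so
  -- that `F` is a direction attached to the unoriented edge.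
  set ε : Corner T → ℤ := fun s =>
    if s = D.wideCorner s.triangle then R.sgn s.triangle else -R.sgn s.triangle with hε
  set F : Corner T → ℂ := fun s => ε s * E s with hF
  have hEacross : ∀ s, E (τ.across s) = -E s := fun s => by
    simp only [hE]; rw [R.position_across]; ring
  have hFacross : ∀ s, F (τ.across s) = F s := fun s => by
    have : ε (τ.across s) = -ε s := by
      simp only [hε]
      rcases D.corner_cases (c := s) rfl with h | h | h
      · rw [h, across_wideCorner]; simp [top_ne_wideCorner]
      · rw [h, across_top]; simp [top_ne_wideCorner]
      · rw [h, across_pole]; simp [pole_ne_wideCorner]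
    simp only [hF]
    rw [hEacross, this]; push_cast; ring
  have hwidth : ∀ s, (E s).re = R.width s := fun s => by
    have h : R.col s.prev - R.col s.next = R.width s :=
      D.potential_prev_sub_next R.isCocycle_width.sum_eq s
    simp only [hE, hP, Complex.sub_re, re_position]
    exact_mod_cast h
  have hFre : ∀ s, 0 ≤ (F s).re := fun s => by
    simp only [hF]
    have : ((ε s : ℂ) * E s).re = ((ε s * R.width s : ℤ) : ℝ) := by
      rw [Complex.mul_re, hwidth]; simp
    rw [this]
    have : 0 ≤ ε s * R.width s := by
      simp only [hε]
      rcases D.corner_cases (c := s) rfl with h | h | h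
      · rw [h]; simp [R.sgn_mul_self]
      · rw [h]; simp [top_ne_wideCorner, R.sgn_mul_self]
      · rw [h]; simp
    exact_mod_cast this
  have hshape : ∀ c, Corner.shape P c = -(E c.next / E c.prev) := fun c => by
    simp only [hE, Corner.shape, Corner.next_prev, Corner.next_next, Corner.prev_prev,
      Corner.prev_next]
    rw [← neg_div, neg_sub]
  have hpos := R.shape_position hY
  have hε2 : ∀ s, (ε s : ℂ) = R.sgn s.triangle ∨ (ε s : ℂ) = -R.sgn s.triangle := fun s => by
    simp only [hε]; split
    · exact .inl rfl
    · right; push_cast; rfl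
  have hsgn : ∀ X, (R.sgn X : ℂ) ≠ 0 := fun X => by
    rcases R.sgn_eq X with h | h <;> simp [h]
  -- At a thin corner the two sides get opposite signs, and the Euclidean angle is the difference of
  -- their directions in the half plane. At the wide corner the signs agree, and `π` has to be
  -- added; this is the taut angle.
  have harg : ∀ c, (Corner.shape P c).arg - angleAt α c = (F c.next).arg - (F c.prev).arg := by
    intro c
    have hc := hpos c
    rw [← hP, hshape] at hc
    rw [hshape, Corner.angleAt_eq, hD]
    by_cases hw : c = D.wideCorner c.triangle
    · have hpair : c.pair = D.wide c.tet := by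
        conv_lhs => rw [hw]
        exact Corner.pair_ofPair _ _
      have hn : ε c.next = -R.sgn c.triangle := if_neg fun h => c.next_ne (h.trans hw.symm)
      have hp : ε c.prev = -R.sgn c.triangle := if_neg fun h => c.prev_ne (h.trans hw.symm)
      have hq : F c.next / F c.prev = E c.next / E c.prev := by
        simp only [hF, hn, hp]
        rw [mul_div_mul_left _ _ (by push_cast; exact neg_ne_zero.2 (hsgn _))]
      rw [Complex.neg_im] at hc
      rw [if_pos hpair, Complex.arg_neg_eq_arg_add_pi_of_im_neg (by linarith), ← hq,
        Complex.arg_div_eq_sub_of_re_nonneg (hFre _) (hFre _) (by rw [hq]; linarith)]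
      ring
    · have hpair : c.pair ≠ D.wide c.tet := fun h => hw (by
        conv_lhs => rw [← c.ofPair_pair, h]
        rfl)
      have hnp : (ε c.next : ℂ) = R.sgn c.triangle ∧ (ε c.prev : ℂ) = -R.sgn c.triangle ∨
          (ε c.next : ℂ) = -R.sgn c.triangle ∧ (ε c.prev : ℂ) = R.sgn c.triangle := by
        simp only [hε]
        rcases Corner.eq_or_eq_next_or_eq_prev (c := c) (d := D.wideCorner c.triangle) rfl
          with h | h | h
        · exact absurd h.symm hw
        · left
          rw [if_pos, if_neg]
          · simp
          · rw [Corner.triangle_prev, h]; exact c.prev_ne_next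
          · rw [Corner.triangle_next, h]
        · right
          rw [if_neg, if_pos]
          · simp
          · rw [Corner.triangle_prev, h]
          · rw [Corner.triangle_next, h]; exact c.prev_ne_next.symm
      have hq : F c.next / F c.prev = -(E c.next / E c.prev) := by
        simp only [hF]
        have := hsgn c.triangle
        rcases hnp with ⟨h₁, h₂⟩ | ⟨h₁, h₂⟩ <;> rw [h₁, h₂]
        · rw [neg_mul, div_neg, mul_div_mul_left _ _ this]
        · rw [neg_mul, neg_div, mul_div_mul_left _ _ this]
      rw [if_neg hpair, ← hq, sub_zero,
        Complex.arg_div_eq_sub_of_re_nonneg (hFre _) (hFre _) (by rw [hq]; linarith)]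
  have h0 := γ.turn_eq_zero_of_sub (g := fun s => (F s).arg) harg fun s => by rw [hFacross]
  rw [NormalCurve.turningAngle_eq_turn, ← add_zero (γ.turn (angleAt α)), ← h0,
    ← NormalCurve.turn_add]
  simp

end Transversal

end VeeringColoring

end OrientedGluing

/-! ### The flat structure is the quotient of the plane -/

/-- A skew product with a single unit on each cycle has one cycle for each cycle of the base. -/
theorem sameCycle_prodShear {S : Type*} [Finite S] (N : Equiv.Perm S) (d : S → ℤ) {x₀ : S}
    (h₀ : d x₀ = 1 ∨ d x₀ = -1) (h : ∀ x, N.SameCycle x₀ x → x ≠ x₀ → d x = 0) {x : S}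
    (hx : N.SameCycle x₀ x) (n m : ℤ) :
    Equiv.Perm.SameCycle (Equiv.prodShear N fun x => Equiv.addRight (d x)) (x₀, n) (x, m) := by
  set F : Equiv.Perm (S × ℤ) := Equiv.prodShear N fun x => Equiv.addRight (d x) with hF
  have happ : ∀ p : S × ℤ, F p = (N p.1, p.2 + d p.1) := fun p => rfl
  have hpow : ∀ (i : ℕ) (p : S × ℤ), F.SameCycle p ((F ^ i) p) := fun i p => ⟨i, by simp⟩
  have hfst : ∀ (i : ℕ) (p : S × ℤ), ((F ^ i) p).1 = (N ^ i) p.1 := fun i p => by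
    induction i with
    | zero => rfl
    | succ i ih => rw [pow_succ', pow_succ', Equiv.Perm.mul_apply, happ, Equiv.Perm.mul_apply, ih]
  have hN : N.SameCycle x₀ (N x₀) := ⟨1, by simp⟩
  -- From `N x₀` back to `x₀` the second coordinate does not change, so one turn around the cycle
  -- moves it exactly by the unit at `x₀`.
  have hret : ∀ n, F.SameCycle (N x₀, n) (x₀, n) := fun n => by
    obtain ⟨i, _, hi⟩ := hN.symm.exists_pow_eq'
    obtain ⟨i, hi, hmin⟩ := exists_first (p := fun i => (N ^ i) (N x₀) = x₀) ⟨i, hi⟩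
    have key : ∀ j ≤ i, (F ^ j) (N x₀, n) = ((N ^ j) (N x₀), n) := fun j => by
      induction j with
      | zero => intro _; rfl
      | succ j ih =>
        intro hj
        rw [pow_succ', Equiv.Perm.mul_apply, ih (by omega), happ, pow_succ', Equiv.Perm.mul_apply,
          h _ (hN.trans ⟨j, by simp⟩) (hmin j (by omega)), add_zero]
    have := hpow i (N x₀, n)
    rwa [key i le_rfl, hi] at this
  have hstep : ∀ n, F.SameCycle (x₀, n) (x₀, n + d x₀) := fun n => by
    have := hpow 1 (x₀, n)
    rw [pow_one, happ] at this
    exact this.trans (hret _)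
  have hone : ∀ n, F.SameCycle (x₀, n) (x₀, n + 1) := fun n => by
    rcases h₀ with h₀ | h₀
    · have := hstep n
      rwa [h₀] at this
    · have := hstep (n + 1)
      rw [h₀, add_neg_cancel_right] at this
      exact this.symm
  have hall : ∀ k : ℤ, F.SameCycle (x₀, n) (x₀, n + k) := fun k => by
    induction k using Int.induction_on with
    | zero => rw [add_zero]
    | succ k ih => rw [← add_assoc]; exact ih.trans (hone _)
    | pred k ih =>
      refine ih.trans ?_
      have := hone (n + (-k - 1))
      rw [show n + (-(k : ℤ) - 1) + 1 = n + -k by ring] at this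
      exact this.symm
  obtain ⟨i, _, hi⟩ := hx.symm.exists_pow_eq'
  have h₁ := hpow i (x, m)
  have h₂ : (F ^ i) (x, m) = (x₀, n + (((F ^ i) (x, m)).2 - n)) :=
    Prod.ext ((hfst i _).trans hi) (by simp)
  rw [h₂] at h₁
  exact (hall _).trans h₁.symm

namespace OrientedGluing

variable {T : Type*} {τ : OrientedGluing T}

theorem IsPointOfTriangle.sum_corners {c : Corner T} {p : Fin 4 → ℝ}
    (hp : IsPointOfTriangle c.triangle p) : p c.label + p c.next.label + p c.prev.label = 1 := by
  have h := hp.sum_eq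
  have ht : p c.tip = 0 := hp.tip
  rw [c.sum_labels, ht] at h
  linarith

theorem IsPointOfTriangle.pos_of_eq_zero {c c' : Corner T} {p : Fin 4 → ℝ}
    (hp : IsPointOfTriangle c.triangle p) (h : c'.triangle = c.triangle) (hne : c ≠ c')
    (h0 : p c.label = 0) : 0 < p c'.label :=
  lt_of_le_of_ne (hp.nonneg _) fun h' => hne (hp.eq_of_eq_zero c c' rfl h h0 h'.symm)

theorem samePoint_of_side {s : Corner T} {p q : Fin 4 → ℝ} (hp : IsPointOfTriangle s.triangle p)
    (hq : IsPointOfTriangle (τ.across s).triangle q) (h₀ : p s.label = 0)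
    (h₁ : q (τ.across s).label = 0) (h₂ : q (τ.across s).prev.label = p s.next.label) :
    τ.SamePoint s.triangle p (τ.across s).triangle q := by
  refine .inr ⟨s, rfl, rfl, h₀, fun k => ?_⟩
  have hp' := hp.sum_corners
  have hq' := hq.sum_corners
  rcases Corner.univ_labels s.tip s.label k s.2.2 with rfl | rfl | rfl | rfl
  · exact hq.tip.trans hp.tip.symm
  · exact h₁.trans h₀.symm
  · exact (congrArg q (τ.label_across_prev s).symm).trans h₂
  · refine (congrArg q (τ.label_across_next s).symm).trans ?_
    change _ = p s.prev.label
    linarith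

theorem SamePoint.symm {X Y : T × Fin 4} {p q : Fin 4 → ℝ} (h : τ.SamePoint X p Y q) :
    τ.SamePoint Y q X p := by
  rcases h with ⟨rfl, rfl⟩ | ⟨s, rfl, rfl, h₀, h⟩
  · exact .inl ⟨rfl, rfl⟩
  · refine .inr ⟨τ.across s, rfl, by rw [across_across], (h _).trans h₀, fun k => ?_⟩
    obtain ⟨k, rfl⟩ := (τ.glue s.tet s.label).surjective k
    rw [glue_across, h]

theorem isPointOfTriangle_across {s : Corner T} {p : Fin 4 → ℝ}
    (hp : IsPointOfTriangle s.triangle p) :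
    IsPointOfTriangle (τ.across s).triangle fun k => p ((τ.glue s.tet s.label).symm k) where
  tip := by
    change p ((τ.glue s.tet s.label).symm (τ.glue s.tet s.label s.tip)) = 0
    rw [Equiv.symm_apply_apply]; exact hp.tip
  nonneg k := hp.nonneg _
  sum_eq := (Equiv.sum_comp _ _).trans hp.sum_eq
  eq_of_eq_zero := by
    have hl : ∀ c : Corner T, c.triangle = (τ.across s).triangle → ∃ c' : Corner T,
        c'.triangle = s.triangle ∧ c'.label = (τ.glue s.tet s.label).symm c.label := by
      intro c hc
      rcases Corner.eq_or_eq_next_or_eq_prev hc with rfl | rfl | rfl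
      · exact ⟨s, rfl, by rw [label_across, Equiv.symm_apply_apply]⟩
      · exact ⟨s.prev, rfl, by rw [label_across_next, Equiv.symm_apply_apply]⟩
      · exact ⟨s.next, rfl, by rw [label_across_prev, Equiv.symm_apply_apply]⟩
    intro c d hc hd hc0 hd0
    obtain ⟨c', hc', hcl⟩ := hl c hc
    obtain ⟨d', hd', hdl⟩ := hl d hd
    have h := hp.eq_of_eq_zero c' d' hc' hd' (by rw [hcl]; exact hc0) (by rw [hdl]; exact hd0)
    have hcd := hc.trans hd.symm
    refine Corner.eq_of_labels (congrArg (fun X : T × Fin 4 => X.1) hcd)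
      (congrArg (fun X : T × Fin 4 => X.2) hcd) ((τ.glue s.tet s.label).symm.injective ?_)
    rw [← hcl, ← hdl, h]

namespace VeeringColoring.Transversal

variable {D : τ.VeeringColoring} (R : D.Transversal) [Finite T] {Y : τ.Vertex → ℝ}

/-- The ladder itself if it is directed upwards, otherwise its neighbour on the right. -/
noncomputable def base (X : T × Fin 4) : D.Ladder :=
  if R.sign (D.ladder X) then D.ladder X else D.neighbor true (D.ladder X)

variable (D) in
/-- The passage to the next ladder of the same direction. -/
noncomputable def _root_.OrientedGluing.VeeringColoring.strip : Equiv.Perm D.Ladder :=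
  (Function.Involutive.toPerm _ (D.neighbor_neighbor false)).trans
    (Function.Involutive.toPerm _ (D.neighbor_neighbor true))

theorem _root_.OrientedGluing.VeeringColoring.strip_apply (O : D.Ladder) :
    D.strip O = D.neighbor true (D.neighbor false O) := rfl

theorem ladder_eq_of_base_eq {X X' : T × Fin 4} (h : R.base X = R.base X')
    (hs : R.sgn X = R.sgn X') : D.ladder X = D.ladder X' := by
  unfold base at h
  unfold sgn at hs
  cases h₁ : R.sign (D.ladder X) <;> cases h₂ : R.sign (D.ladder X') <;> simp [h₁, h₂] at h hs
  · rw [← D.neighbor_neighbor true (D.ladder X), h, D.neighbor_neighbor]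
  · exact h

/-- Two ladders joined along a left-veering ladderpole form a strip of columns from -1 to 1. Only
the passage of a right-veering ladderpole changes the strip, and it translates by `±2`. -/
theorem exists_base_across (s : Corner T) : ∃ m : ℤ, τ.jump R.col s = 2 * m ∧
    R.base (τ.across s).triangle = (D.strip ^ m) (R.base s.triangle) := by
  have hj : τ.jump R.col s = if D.color (τ.vertex s.prev) then 0 else
      R.sgn s.triangle - R.sgn (τ.across s).triangle := by
    rw [jump, col_eq, col_eq, vertex_across_next]
    split <;> simp
  generalize hX : s.triangle = X at hj ⊢
  rcases D.corner_cases hX with h | h | h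
  · refine ⟨0, ?_, ?_⟩
    · rw [hj, h, across_wideCorner]; simp
    · rw [h, across_wideCorner]; simp [base]
  · refine ⟨0, ?_, ?_⟩
    · rw [hj, h, across_top]; simp
    · rw [h, across_top]; simp [base]
  · have hc : D.color (τ.vertex s.prev) = D.type X := by
      rw [h]; exact congrArg Prod.snd (D.ends_pole X)
    rw [hj, hc, h, across_pole, triangle_pole]
    have hn := D.neighbor_ladder (X := X) rfl
    cases ht : D.type X
    · refine ⟨R.sgn X, ?_, ?_⟩
      · simp; ring
      · rw [ht] at hn
        unfold base sgn
        rw [R.sign_pass, ← hn]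
        cases hs : R.sign (D.ladder X)
        · simp [Equiv.eq_symm_apply, strip_apply, neighbor_neighbor]
        · simp [strip_apply]
    · refine ⟨0, by simp, ?_⟩
      rw [ht] at hn
      unfold base
      rw [R.sign_pass, ← hn]
      cases hs : R.sign (D.ladder X) <;> simp [neighbor_neighbor]

/-- The passage to the next triangle in a developed ladder. -/
noncomputable def advance : Equiv.Perm ((T × Fin 4) × ℤ) :=
  Equiv.prodShear D.up fun X => Equiv.addRight (τ.jump R.row (D.top X))

theorem advance_apply (σ : (T × Fin 4) × ℤ) :
    R.advance σ = (D.up σ.1, σ.2 + τ.jump R.row (D.top σ.1)) := rfl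

open Classical in
theorem jump_row_top (X : T × Fin 4) : τ.jump R.row (D.top X) =
    if D.type X = true ∧ R.IsSpecial X then R.sgn X else 0 := by
  have h₀ : τ.jump R.row (D.top X) = R.row (D.topCorner X true) := by
    rw [jump, prev_topCorner_true, across_top]
    have : R.row (D.wideCorner (D.up X)).next = 0 := D.potential_thinCorner_true _ _
    rw [this, sub_zero]
  rw [h₀]
  cases ht : D.type X
  · rw [D.topCorner_of_type_ne (by simp [ht])]
    have : R.row (D.thinCorner true X) = 0 := D.potential_thinCorner_true _ _
    rw [this]; simp
  · rw [D.topCorner_of_type_eq ht]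
    have h := R.sgn_mul_row_sub X
    have h' : R.row (D.thinCorner (D.type X) X) = 0 := by
      rw [ht]; exact D.potential_thinCorner_true _ _
    rw [h', sub_zero] at h
    have h₂ := congrArg (R.sgn X * ·) h
    simp only [← mul_assoc, R.sgn_mul_self, one_mul] at h₂
    rw [h₂]; simp

/-- Exactly one special triangle of type `true` lies in each ladder, so its vertical holonomy is
`±1`. All integral translates of its triangles thus belong to a single developed ladder and are
linearly ordered. -/
theorem sameCycle_advance {X X' : T × Fin 4} (h : D.ladder X = D.ladder X') (n n' : ℤ) :
    R.advance.SameCycle (X, n) (X', n') := by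
  classical
  obtain ⟨Z, hZ, hZX, hZt⟩ := R.exists_isSpecial (D.ladder X) true
  have key : ∀ X' : T × Fin 4, D.ladder Z = D.ladder X' → ∀ n n',
      R.advance.SameCycle (Z, n) (X', n') := fun X' hX' n n' =>
    sameCycle_prodShear D.up _ (by
      rw [jump_row_top, if_pos ⟨hZt, hZ⟩]; exact R.sgn_eq Z)
      (fun W hW hne => by
        rw [jump_row_top, if_neg]
        rintro ⟨ht, hs⟩
        apply hne
        rw [hs.eq, hZ.eq, ht, hZt, D.ladder_eq_iff.2 hW])
      (D.ladder_eq_iff.1 hX') n n'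
  exact (key X hZX 0 n).symm.trans (key X' (hZX.trans h) 0 n')

variable (Y) in
/-- The level of the lower rung of a triangle of a developed ladder, at distance `u` from its left
side. -/
noncomputable def level (u : ℝ) (σ : (T × Fin 4) × ℤ) : ℝ :=
  R.sgn σ.1 * (σ.2 + (1 - u) * R.height Y (D.thinCorner true σ.1) +
    u * R.height Y (D.thinCorner false σ.1))

/-- Each triangle has one side of length `rise` on a ladderpole and shrinks to a point on the other
one; in between its vertical thickness is proportional to the distance from that point. -/
theorem level_advance (u : ℝ) (σ : (T × Fin 4) × ℤ) : R.level Y u (R.advance σ) =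
    R.level Y u σ + (if D.type σ.1 then 1 - u else u) * R.rise σ.1 Y := by
  obtain ⟨X, n⟩ := σ
  have ha : R.height Y (D.thinCorner true (D.up X)) + (τ.jump R.row (D.top X) : ℤ) =
      R.height Y (D.topCorner X true) := by
    have : R.row (D.thinCorner true (D.up X)) + τ.jump R.row (D.top X) =
        R.row (D.topCorner X true) := by
      rw [jump, prev_topCorner_true, across_top]
      exact add_sub_cancel _ _
    rw [height, height, vertex_thinCorner_up, ← this]; push_cast; ring
  have hb : R.height Y (D.thinCorner false (D.up X)) + (τ.jump R.row (D.top X) : ℤ) =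
      R.height Y (D.topCorner X false) := by
    have : R.row (D.thinCorner false (D.up X)) + τ.jump R.row (D.top X) =
        R.row (D.topCorner X false) := by
      rw [jump_sub (P := R.row) (potential_across R.isCocycle_flow), next_topCorner_false, across_top]
      exact add_sub_cancel _ _
    rw [height, height, vertex_thinCorner_up, ← this]; push_cast; ring
  have hcalc : R.level Y u (R.advance (X, n)) = R.sgn X * (n +
      (1 - u) * R.height Y (D.topCorner X true) + u * R.height Y (D.topCorner X false)) := by
    rw [← ha, ← hb, level, advance_apply, sgn_up]; push_cast; ring
  rw [hcalc, level, rise]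
  cases ht : D.type X
  · rw [D.topCorner_of_type_ne (by simp [ht]), D.topCorner_of_type_eq ht]
    simp only [Bool.false_eq_true, if_false]; ring
  · rw [D.topCorner_of_type_eq ht, D.topCorner_of_type_ne (by simp [ht])]
    simp only [if_true]; ring

theorem level_le_pow (hY : ∀ X, 0 < R.rise X Y) {u : ℝ} (hu₀ : 0 ≤ u) (hu₁ : u ≤ 1) (k : ℕ)
    (σ : (T × Fin 4) × ℤ) : R.level Y u σ ≤ R.level Y u ((R.advance ^ k) σ) := by
  induction k with
  | zero => exact le_rfl
  | succ k ih =>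
    rw [pow_succ', Equiv.Perm.mul_apply, level_advance]
    refine ih.trans (le_add_of_nonneg_right (mul_nonneg ?_ (hY _).le))
    split <;> linarith

theorem level_lt_advance (hY : ∀ X, 0 < R.rise X Y) {u : ℝ} (hu₀ : 0 < u) (hu₁ : u < 1)
    (σ : (T × Fin 4) × ℤ) : R.level Y u σ < R.level Y u (R.advance σ) := by
  rw [level_advance]
  refine lt_add_of_pos_right _ (mul_pos ?_ (hY _))
  split <;> linarith

variable (D) in
/-- The distance of a point of a triangle from the left side of the ladder. -/
noncomputable def _root_.OrientedGluing.VeeringColoring.frac (X : T × Fin 4) (p : Fin 4 → ℝ) : ℝ :=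
  p (D.wideCorner X).prev.label + if D.type X then 0 else p (D.wideCorner X).label

section points

variable {X X' : T × Fin 4} {p p' : Fin 4 → ℝ}

omit [Finite T] in
theorem frac_nonneg (hp : IsPointOfTriangle X p) : 0 ≤ D.frac X p := by
  refine add_nonneg (hp.nonneg _) ?_
  split
  exacts [le_rfl, hp.nonneg _]

omit [Finite T] in
theorem frac_eq (hp : IsPointOfTriangle X p) : D.frac X p =
    1 - (p (D.wideCorner X).next.label + if D.type X then p (D.wideCorner X).label else 0) := by
  have h := hp.sum_corners (c := D.wideCorner X)
  unfold frac
  split <;> linarith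

omit [Finite T] in
theorem frac_le_one (hp : IsPointOfTriangle X p) : D.frac X p ≤ 1 := by
  rw [frac_eq hp, sub_le_self_iff]
  refine add_nonneg (hp.nonneg _) ?_
  split
  exacts [hp.nonneg _, le_rfl]

omit [Finite T] in
theorem pole_eq_zero_of_frac (hp : IsPointOfTriangle X p) (h : D.frac X p = 0 ∨ D.frac X p = 1) :
    p (D.pole X).label = 0 := by
  have hn := hp.nonneg
  rcases h with h | h
  · unfold frac at h
    cases ht : D.type X
    · simp only [ht, Bool.false_eq_true, if_false] at h
      have h₁ : p (D.wideCorner X).prev.label = 0 := by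
        linarith [hn (D.wideCorner X).label, hn (D.wideCorner X).prev.label]
      have h₂ := hp.pos_of_eq_zero (c := (D.wideCorner X).prev) (c' := D.wideCorner X) rfl
        (Corner.prev_ne _) h₁
      linarith
    · simp only [ht, if_true, add_zero] at h
      simpa [pole, ht] using h
  · rw [frac_eq hp] at h
    cases ht : D.type X
    · simp only [ht, Bool.false_eq_true, if_false, add_zero] at h
      have h₁ : p (D.wideCorner X).next.label = 0 := by linarith
      simpa [pole, ht] using h₁
    · simp only [ht, if_true] at h
      have h₁ : p (D.wideCorner X).next.label = 0 := by
        linarith [hn (D.wideCorner X).label, hn (D.wideCorner X).next.label]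
      have h₂ := hp.pos_of_eq_zero (c := (D.wideCorner X).next) (c' := D.wideCorner X) rfl
        (Corner.next_ne _) h₁
      linarith

omit [Finite T] in
theorem frac_eq_of_pole (hp : IsPointOfTriangle X p) (h : p (D.pole X).label = 0) :
    D.frac X p = 0 ∨ D.frac X p = 1 := by
  cases ht : D.type X
  · right
    rw [frac_eq hp]
    have : p (D.wideCorner X).next.label = 0 := by simpa [pole, ht] using h
    simp [ht, this]
  · left
    have : p (D.wideCorner X).prev.label = 0 := by simpa [pole, ht] using h
    simp [frac, ht, this]

theorem re_place (p : Fin 4 → ℝ) :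
    ((D.wideCorner X).place (R.position Y) p).re = R.sgn X * D.frac X p := by
  have ha : R.col (D.wideCorner X).next = 0 := R.col_thinCorner_true X
  have hb : R.col (D.wideCorner X).prev = R.sgn X := R.col_thinCorner_false X
  simp only [Corner.place, Complex.add_re, Complex.re_ofReal_mul, re_position, ha, hb,
    col_wideCorner, frac]
  cases D.type X <;> simp <;> ring

theorem im_place (hp : IsPointOfTriangle X p) (n : ℤ) :
    R.sgn X * (n + ((D.wideCorner X).place (R.position Y) p).im) =
      R.level Y (D.frac X p) (X, n) + p (D.wideCorner X).label * R.rise X Y := by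
  have h := hp.sum_corners (c := D.wideCorner X)
  have h' : p (D.wideCorner X).next.label =
    1 - p (D.wideCorner X).label - p (D.wideCorner X).prev.label := by linarith
  simp only [Corner.place, Complex.add_im, Complex.im_ofReal_mul, im_position, level, frac, rise,
    thinCorner_true, thinCorner_false, h']
  cases ht : D.type X
  · simp only [Bool.false_eq_true, if_false, thinCorner_false]; ring
  · simp only [if_true, thinCorner_true]; ring

omit [Finite T] in
theorem top_add_wide (hp : IsPointOfTriangle X p) :
    p (D.top X).label + p (D.wideCorner X).label =
      if D.type X then 1 - D.frac X p else D.frac X p := by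
  have h := hp.sum_corners (c := D.wideCorner X)
  unfold frac
  cases ht : D.type X
  · simp [top, ht]
  · simp [top, ht]; linarith

/-- Levels increase along a developed ladder, so a point of `X` is at most as high as the upper rung
of `X` and a point of a later `X'` at least as high as its lower rung. Equality forces both points
onto these rungs. As vertices are excluded, the increase is strict there, so `X'` is the next
triangle. -/
theorem samePoint_of_pow (hY : ∀ X, 0 < R.rise X Y) (hp : IsPointOfTriangle X p)
    (hp' : IsPointOfTriangle X' p') {n n' : ℤ} {k : ℕ} (hk : (R.advance ^ k) (X, n) = (X', n'))
    (hfrac : D.frac X p = D.frac X' p')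
    (hlevel : R.level Y (D.frac X p) (X, n) + p (D.wideCorner X).label * R.rise X Y =
      R.level Y (D.frac X p) (X', n') + p' (D.wideCorner X').label * R.rise X' Y) :
    (X = X' ∧ p = p') ∨ τ.SamePoint X p X' p' ∧ 0 < D.frac X p ∧ D.frac X p < 1 := by
  rcases k with _ | k
  · left
    obtain ⟨rfl, rfl⟩ := Prod.mk.inj hk
    refine ⟨rfl, ?_⟩
    have hw : p (D.wideCorner X).label = p' (D.wideCorner X).label :=
      mul_right_cancel₀ (hY X).ne' (add_left_cancel hlevel)
    have hb : p (D.wideCorner X).prev.label = p' (D.wideCorner X).prev.label := by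
      unfold frac at hfrac
      rw [hw] at hfrac
      exact add_right_cancel hfrac
    have h₁ := hp.sum_corners (c := D.wideCorner X)
    have h₂ := hp'.sum_corners (c := D.wideCorner X)
    funext j
    rcases Corner.univ_labels (D.wideCorner X).tip (D.wideCorner X).label j (D.wideCorner X).2.2
      with rfl | rfl | rfl | rfl
    · exact hp.tip.trans hp'.tip.symm
    · exact hw
    · change p (D.wideCorner X).next.label = p' (D.wideCorner X).next.label
      linarith
    · exact hb
  · right
    have hu₀ := frac_nonneg (D := D) hp
    have hu₁ := frac_le_one (D := D) hp
    have hle := R.level_le_pow hY hu₀ hu₁ k (R.advance (X, n))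
    rw [← Equiv.Perm.mul_apply, ← pow_succ, hk] at hle
    have hadv := R.level_advance (Y := Y) (D.frac X p) (X, n)
    rw [← top_add_wide hp, add_mul] at hadv
    have h₁ := mul_nonneg (hp.nonneg (D.top X).label) (hY X).le
    have h₂ := mul_nonneg (hp'.nonneg (D.wideCorner X').label) (hY X').le
    have htop : p (D.top X).label = 0 :=
      (mul_eq_zero.1 (by linarith : p (D.top X).label * R.rise X Y = 0)).resolve_right (hY X).ne'
    have hwide : p' (D.wideCorner X').label = 0 :=
      (mul_eq_zero.1 (by linarith : p' (D.wideCorner X').label * R.rise X' Y = 0)).resolve_right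
        (hY X').ne'
    have heq : R.level Y (D.frac X p) (X', n') = R.level Y (D.frac X p) (R.advance (X, n)) := by
      linarith
    have hb' := hp'.pos_of_eq_zero (c := D.wideCorner X') (c' := (D.wideCorner X').prev) rfl
      (Corner.prev_ne _).symm hwide
    have ha' := hp'.pos_of_eq_zero (c := D.wideCorner X') (c' := (D.wideCorner X').next) rfl
      (Corner.next_ne _).symm hwide
    have hsum := hp'.sum_corners (c := D.wideCorner X')
    have hu : D.frac X p = p' (D.wideCorner X').prev.label := by
      rw [hfrac, frac, hwide]; simp
    have h0 : 0 < D.frac X p := by rw [hu]; exact hb'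
    have h1 : D.frac X p < 1 := by rw [hu]; linarith
    refine ⟨?_, h0, h1⟩
    obtain rfl : k = 0 := by
      by_contra hk0
      obtain ⟨j, rfl⟩ := Nat.exists_eq_succ_of_ne_zero hk0
      have hlt := R.level_lt_advance hY h0 h1 (R.advance (X, n))
      have hle' := R.level_le_pow hY hu₀ hu₁ j (R.advance (R.advance (X, n)))
      have hk' : (R.advance ^ j) (R.advance (R.advance (X, n))) = (X', n') := by
        rw [← hk, pow_succ, pow_succ]; rfl
      rw [hk'] at hle'
      linarith
    rw [zero_add, pow_one, advance_apply] at hk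
    obtain ⟨rfl, -⟩ := Prod.mk.inj hk
    have hac : (τ.across (D.top X)).triangle = D.up X := rfl
    have := samePoint_of_side (τ := τ) (s := D.top X) (p := p) (q := p')
      (by rw [triangle_top]; exact hp) hp' htop (by rw [across_top]; exact hwide) (by
        rw [across_top, ← hu, next_topCorner_false]
        have ht := top_add_wide (D := D) hp
        rw [htop, zero_add] at ht
        cases h : D.type X
        · rw [D.topCorner_of_type_eq h, ht, h]; simp
        · rw [D.topCorner_of_type_ne (by simp [h]), frac, h]; simp)
    rwa [triangle_top, hac] at this

theorem samePoint_of_ladder_eq (hY : ∀ X, 0 < R.rise X Y) (hp : IsPointOfTriangle X p)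
    (hp' : IsPointOfTriangle X' p') (hl : D.ladder X = D.ladder X') {n n' : ℤ}
    (h : n * Complex.I + (D.wideCorner X).place (R.position Y) p =
      n' * Complex.I + (D.wideCorner X').place (R.position Y) p') :
    (X = X' ∧ p = p') ∨ τ.SamePoint X p X' p' ∧ 0 < D.frac X p ∧ D.frac X p < 1 := by
  have hs : R.sgn X' = R.sgn X := by unfold sgn; rw [hl]
  have hs0 : (R.sgn X : ℝ) ≠ 0 := fun h0 => by
    have := R.sgn_mul_self_real X
    simp [h0] at this
  have hfrac : D.frac X p = D.frac X' p' := by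
    have := congrArg Complex.re h
    simp only [Complex.add_re, re_place, hs] at this
    simpa [hs0] using this
  have hlevel := congrArg (fun z : ℂ => R.sgn X * z.im) h
  have e : ∀ (n : ℤ) (z : ℂ), ((n : ℂ) * Complex.I + z).im = n + z.im := fun n z => by simp
  simp only [e] at hlevel
  rw [R.im_place hp, ← hs, R.im_place hp', ← hfrac] at hlevel
  obtain ⟨k, hk⟩ := R.sameCycle_advance hl n n'
  rcases Int.eq_nat_or_neg k with ⟨k, rfl | rfl⟩
  · exact R.samePoint_of_pow hY hp hp' (by simpa using hk) hfrac hlevel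
  · have hk' : (R.advance ^ k) (X', n') = (X, n) := by
      rw [← hk]; simp
    rcases R.samePoint_of_pow hY hp' hp hk' hfrac.symm (by rw [← hfrac]; exact hlevel.symm)
      with ⟨h₁, h₂⟩ | ⟨h₁, h₂⟩
    · exact .inl ⟨h₁.symm, h₂.symm⟩
    · rw [← hfrac] at h₂
      exact .inr ⟨h₁.symm, h₂⟩

/-- The development is injective. -/
theorem samePoint_of_place_eq (hY : ∀ X, 0 < R.rise X Y) (hp : IsPointOfTriangle X p)
    (hp' : IsPointOfTriangle X' p') {O : D.Ladder} {m m' n n' : ℤ}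
    (hX : R.base X = (D.strip ^ m) O) (hX' : R.base X' = (D.strip ^ m') O)
    (h : (2 * m : ℤ) + n * Complex.I + (D.wideCorner X).place (R.position Y) p =
      (2 * m' : ℤ) + n' * Complex.I + (D.wideCorner X').place (R.position Y) p') :
    τ.SamePoint X p X' p' := by
  have hre : ∀ {X p X' p'} {m m' n n' : ℤ},
      (2 * m : ℤ) + n * Complex.I + (D.wideCorner X).place (R.position Y) p =
        (2 * m' : ℤ) + n' * Complex.I + (D.wideCorner X').place (R.position Y) p' →
      2 * (m : ℝ) + R.sgn X * D.frac X p = 2 * m' + R.sgn X' * D.frac X' p' := by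
    intro X p X' p' m m' n n' h
    have := congrArg Complex.re h
    simpa [re_place] using this
  have same : ∀ {X p} {m n : ℤ}, IsPointOfTriangle X p → R.base X = (D.strip ^ m) O →
      R.sgn X = R.sgn X' → (2 * m : ℤ) + n * Complex.I + (D.wideCorner X).place (R.position Y) p =
        (2 * m' : ℤ) + n' * Complex.I + (D.wideCorner X').place (R.position Y) p' →
      (X = X' ∧ p = p') ∨ τ.SamePoint X p X' p' ∧ 0 < D.frac X p ∧ D.frac X p < 1 := by
    intro X p m n hp hX hs h
    -- For equal signs the real parts lie in the same unit interval modulo 2, so they determine the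
    -- strip.
    have hmm : m = m' := by
      have h₁ := hre h
      have h₂ := frac_nonneg (D := D) hp
      have h₃ := frac_le_one (D := D) hp
      have h₄ := frac_nonneg (D := D) hp'
      have h₅ := frac_le_one (D := D) hp'
      rw [hs] at h₁
      have : (m : ℝ) - m' < 1 ∧ (m' : ℝ) - m < 1 := by
        rcases R.sgn_eq X' with h' | h' <;> rw [h'] at h₁ <;> push_cast at h₁ <;>
          constructor <;> linarith
      obtain ⟨h₆, h₇⟩ := this
      have h₈ : m - m' < 1 := by exact_mod_cast h₆
      have h₉ : m' - m < 1 := by exact_mod_cast h₇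
      omega
    subst hmm
    refine R.samePoint_of_ladder_eq hY hp hp' (R.ladder_eq_of_base_eq (hX.trans hX'.symm) hs)
      (n := n) (n' := n') ?_
    rw [add_assoc, add_assoc] at h
    exact add_left_cancel h
  by_cases hs : R.sgn X = R.sgn X'
  · rcases same hp hX hs h with h | h
    exacts [.inl h, h.1]
  · have hs' : R.sgn X' = -R.sgn X := by
      rcases R.sgn_eq X with h₁ | h₁ <;> rcases R.sgn_eq X' with h₂ | h₂ <;> simp_all
    -- Strips of opposite sign meet only along ladderpoles, since `frac` of the two points must add
    -- up to 0 or 2.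
    have hpole : p (D.pole X).label = 0 := by
      apply pole_eq_zero_of_frac hp
      have h₁ := hre h
      have h₂ := frac_nonneg (D := D) hp
      have h₃ := frac_le_one (D := D) hp
      have h₄ := frac_nonneg (D := D) hp'
      have h₅ := frac_le_one (D := D) hp'
      rw [hs'] at h₁
      obtain ⟨j, hj⟩ : ∃ j : ℤ, D.frac X p + D.frac X' p' = 2 * j := by
        rcases R.sgn_eq X with h' | h' <;> rw [h'] at h₁ <;> push_cast at h₁
        · exact ⟨m' - m, by push_cast; linarith⟩
        · exact ⟨m - m', by push_cast; linarith⟩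
      have hj₀ : (-1 : ℝ) < j := by linarith
      have hj₂ : (j : ℝ) < 2 := by linarith
      have hj₀' : -1 < j := by exact_mod_cast hj₀
      have hj₂' : j < 2 := by exact_mod_cast hj₂
      obtain rfl | rfl : j = 0 ∨ j = 1 := by omega
      · left; push_cast at hj; linarith
      · right; push_cast at hj; linarith
    have hps : IsPointOfTriangle (D.pole X).triangle p := by rw [triangle_pole]; exact hp
    obtain ⟨m₂, hm₂, hb₂⟩ := R.exists_base_across (D.pole X)
    rw [across_pole, triangle_pole, triangle_pole, hX, ← Equiv.Perm.mul_apply, ← zpow_add] at hb₂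
    set q : Fin 4 → ℝ := fun k => p ((τ.glue (D.pole X).tet (D.pole X).label).symm k) with hq
    have hpq : ∀ k, q (τ.glue (D.pole X).tet (D.pole X).label k) = p k := fun k => by simp [hq]
    have hqp : IsPointOfTriangle (D.pass X) q := isPointOfTriangle_across hps
    have hplace := place_across (R.position_across Y) hps hpole hpq
    rw [jump_position, hm₂,
      Corner.place_eq_of_triangle _ (show (D.pole X).triangle = (D.wideCorner X).triangle by simp),
      Corner.place_eq_of_triangle _ (show (τ.across (D.pole X)).triangle =
        (D.wideCorner (D.pass X)).triangle from rfl)] at hplace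
    have hqpole : q (D.pole (D.pass X)).label = 0 := by
      rw [← across_pole]; exact (hpq _).trans hpole
    -- The point of `X` is replaced by its copy `q` across the ladderpole, which reduces to equal
    -- signs. The second alternative would put a point of the ladderpole into the interior of the
    -- strip.
    rcases same (m := m₂ + m) (n := τ.jump R.row (D.pole X) + n) hqp hb₂ (by rw [sgn_pass, hs']) (by
      rw [← h, hplace]; push_cast; ring) with ⟨h₁, h₂⟩ | ⟨-, h₁, h₂⟩
    · exact .inr ⟨D.pole X, D.triangle_pole X, h₁, hpole, fun k => by rw [← h₂, hpq]⟩
    · rcases frac_eq_of_pole hqp hqpole with h₃ | h₃ <;> linarith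

end points

end VeeringColoring.Transversal

end OrientedGluing

/-! ### Turning of simple closed curves and the main theorem -/

namespace OrientedGluing

variable {T : Type*} {τ : OrientedGluing T}

namespace VeeringColoring.Transversal

variable {D : τ.VeeringColoring} (R : D.Transversal) [Finite T] (Y : τ.Vertex → ℝ)

theorem isCocycle_height : τ.IsCocycle fun c => R.height Y c.prev - R.height Y c.next where
  across s := by rw [R.height_across, neg_sub]
  sum_eq c := by
    rw [Corner.next_prev, Corner.next_next, Corner.prev_prev, Corner.prev_next]; ring

theorem height_pole (X : T × Fin 4) :
    R.height Y (D.pole X).prev - R.height Y (D.pole X).next =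
      if D.type X then -(R.sgn X * R.rise X Y) else R.sgn X * R.rise X Y := by
  rw [rise, ← mul_assoc, R.sgn_mul_self_real, one_mul]
  cases h : D.type X
  · have hp : D.pole X = (D.wideCorner X).next := by simp [pole, h]
    rw [hp, Corner.next_prev, Corner.next_next]; rfl
  · have hp : D.pole X = (D.wideCorner X).prev := by simp [pole, h]
    rw [hp, Corner.prev_prev, Corner.prev_next, if_pos rfl, neg_sub]; rfl

theorem shift_position (γ : τ.NormalCurve) (k : ℕ) : γ.shift (R.position Y) k =
    (γ.shift R.col k : ℤ) + (γ.shift R.row k : ℤ) * Complex.I := by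
  simp only [NormalCurve.shift, jump_position]
  push_cast
  rw [Finset.sum_add_distrib, Finset.sum_mul]

theorem im_shift_position (γ : τ.NormalCurve) (k : ℕ) :
    (γ.shift (R.position Y) k).im = γ.shift (R.height Y) k := by
  simp only [NormalCurve.shift, Complex.im_sum]
  rfl

/-- The horizontal displacement records the strip reached by the lifted curve, even where strips
recur on the torus. -/
theorem exists_base_arc (γ : τ.NormalCurve) (k : ℕ) : ∃ m : ℤ, γ.shift R.col k = 2 * m ∧
    R.base (γ.arc (Fin.ofNat _ k)).corner.triangle =
      (D.strip ^ m) (R.base (γ.arc (Fin.ofNat _ 0)).corner.triangle) := by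
  induction k with
  | zero => exact ⟨0, by simp [NormalCurve.shift], rfl⟩
  | succ k ih =>
    obtain ⟨m, hm, hb⟩ := ih
    obtain ⟨m', hm', hb'⟩ := R.exists_base_across (γ.arc (Fin.ofNat _ k)).leave
    refine ⟨m' + m, by rw [γ.shift_succ, hm, hm']; ring, ?_⟩
    rw [γ.triangle_across_leave, Arc.triangle_leave, hb, ← Equiv.Perm.mul_apply, ← zpow_add] at hb'
    rw [NormalCurve.ofNat_succ]
    exact hb'

variable {Y}

/-- A curve along a ladder is not closed in the flat structure. -/
theorem turn_height_ne_zero (hY : ∀ X, 0 < R.rise X Y) {δ : τ.NormalCurve} {d : Bool}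
    (hδ : δ.RunsAlong D d) :
    δ.turn (fun c => R.height Y c.prev - R.height Y c.next) ≠ 0 := by
  have h : ∀ i, (δ.arc i).signed (fun c => R.height Y c.prev - R.height Y c.next) =
      (if d then (R.sgn (δ.tri 0) : ℝ) else -R.sgn (δ.tri 0)) * R.rise (δ.tri i) Y := fun i => by
    have hs : R.sgn (δ.tri i) = R.sgn (δ.tri 0) := by unfold sgn; rw [hδ.ladder_eq i 0]
    rw [hδ.signed, height_pole, hs]
    cases d <;> cases D.type (δ.tri i) <;> simp
  rw [NormalCurve.turn, Finset.sum_congr rfl fun i _ => h i, ← Finset.mul_sum]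
  refine mul_ne_zero ?_ (Finset.sum_pos (fun i _ => hY _) Finset.univ_nonempty).ne'
  rcases R.sgn_eq (δ.tri 0) with h' | h' <;> rw [h'] <;> cases d <;> simp

/-- A simple closed curve in the direction of the ladderpoles has turning angle zero in the taut
structure. -/
theorem turningAngle_eq_zero {T : Type*} [Fintype T] {τ : OrientedGluing T} {D : τ.VeeringColoring}
    (R : D.Transversal) {α : T → Fin 3 → ℝ} (hD : ∀ t j, α t j = if j = D.wide t then π else 0)
    {γ δ : τ.NormalCurve} (hγ : γ.IsSimple) (h : γ.Homologous δ) {d : Bool}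
    (hδ : δ.RunsAlong D d) : γ.turningAngle α = 0 := by
  obtain ⟨Y, hY⟩ := R.exists_rise_pos
  obtain ⟨x, y, hx, hy, hxy, hdis⟩ := hγ
  rw [← R.turn_arg_shape hY hD]
  refine γ.turn_arg_shape_eq_zero (R.position_across Y) (R.shape_position hY) hx hy hxy hdis
    (fun i j p hp q hq hpq => ?_) fun h0 => ?_
  · obtain ⟨m, hm, hb⟩ := R.exists_base_arc γ i
    obtain ⟨m', hm', hb'⟩ := R.exists_base_arc γ j
    rw [R.shift_position, R.shift_position, hm, hm',
      Corner.place_eq_of_triangle _ (show (γ.arc (Fin.ofNat _ i)).corner.triangle =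
        (D.wideCorner (γ.arc (Fin.ofNat _ i)).corner.triangle).triangle from rfl),
      Corner.place_eq_of_triangle _ (show (γ.arc (Fin.ofNat _ j)).corner.triangle =
        (D.wideCorner (γ.arc (Fin.ofNat _ j)).corner.triangle).triangle from rfl)] at hpq
    exact R.samePoint_of_place_eq hY (Arc.isPointOfTriangle (hx _) (hy _) hp)
      (Arc.isPointOfTriangle (hx _) (hy _) hq) hb hb' hpq
  -- A zero period would make the height cocycle vanish on `γ`, hence on the homologous `δ`, along
  -- which heights are strictly monotone.
  · have him := R.im_shift_position Y γ (γ.n + 1)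
    rw [h0, Complex.zero_im] at him
    have h₂ := γ.two_mul_shift_period (R.height_across Y)
    rw [← him, mul_zero, (R.isCocycle_height Y).turn_eq h] at h₂
    exact R.turn_height_ne_zero hY hδ h₂.symm

end VeeringColoring.Transversal

end OrientedGluing

theorem proposition5p8 {T : Type*} [Fintype T] (τ : OrientedGluing T) (hτ : τ.HasTorusCusps)
    (α : T → Fin 3 → ℝ) (hα : τ.IsVeering α)
    (ℓ : τ.Cusp → τ.NormalCurve) (hcusp : ∀ κ, (ℓ κ).LiesIn κ)
    (hℓ : ∀ κ, (ℓ κ).IsLadderpoleDirection α) :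
    ∃ θ : T → Fin 3 → ℝ, τ.IsNonnegAngleStructure θ ∧
      ∀ κ, (ℓ κ).HasHolonomy θ (π / 4) := by
  obtain ⟨D, hD, hpole⟩ := hα.exists_coloring
  choose _ δ hδ hhom using hℓ
  choose d hd using fun κ => (hδ κ).exists_runsAlong hpole
  obtain ⟨s, hs⟩ := D.exists_ladder_sign
  -- Any transversal serves to show that each `δ κ` lies in its cusp `κ`; only then can the
  -- directions be adapted.
  obtain ⟨R₀, -⟩ := OrientedGluing.VeeringColoring.exists_transversal s hs
  obtain ⟨R, hR⟩ := OrientedGluing.exists_transversal_of_runsAlong D δ d hd fun κ =>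
    (hd κ).liesIn R₀ (hhom κ) (hcusp κ)
  refine ⟨R.angles α, R.isNonnegAngleStructure_angles hα.1.1 hD, fun κ γ hγ hγℓ => ?_⟩
  have h := hγℓ.trans (hhom κ)
  -- Simplicity of `γ` is used for the taut part, which is 0; the cocycle part `π / 8 * 2` depends
  -- on the homology class alone.
  rw [R.turn_angles, R.turningAngle_eq_zero hD hγ h (hd κ), R.isCocycle_flow_real.turn_eq h, hR]
  ring
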